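/- Let $n\ge 1$. For $0<\alpha\le 1$ let $\mathcal C_\alpha$ be the set of functions $\varphi$ on $\mathbb R^n$ with support in $\{|x|\le 1\}$, $\int_{\mathbb R^n}\varphi\,dx=0$ and $|\varphi(x)-\varphi(x')|\le|x-x'|^\alpha$ for all $x,x'\in\mathbb R^n$. Put $\varphi_t(x)=t^{-n}\varphi(x/t)$ and, for $f\in L^1_{\mathrm{loc}}(\mathbb R^n)$, $y\in\mathbb R^n$ and $t>0$, $$A_\alpha(f)(y,t)=\sup_{\varphi\in\mathcal C_\alpha}\Big|\int_{\mathbb R^n}\varphi_t(y-z)f(z)\,dz\Big|.$$ The intrinsic $g^*_\lambda$-function of $f$ is $$g^*_{\lambda,\alpha}(f)(x)=\left(\iint_{\mathbb R^n\times(0,\infty)}\Big(\frac{t}{t+|x-y|}\Big)^{\lambda n}\big(A_\alpha(f)(y,t)\big)^2\,\frac{dy\,dt}{t^{n+1}}\right)^{1/2}.$$ Let $\Phi$ be a positive increasing function on $(0,\infty)$. For $1\le p<\infty$ the generalized Morrey space $L^{p,\Phi}(\mathbb R^n)$ consists of all locally integrable functions $f$ on $\mathbb R^n$ for which there is a finite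 constant $C\ge 0$ with $$\int_{B(x_0,r)}|f(x)|^p\,dx\le C^p\,\Phi(r)\qquad\text{for all }x_0\in\mathbb R^n,\ r>0,$$ where $B(x_0,r)=\{x:|x-x_0|<r\}$; the norm $\|f\|_{L^{p,\Phi}}$ is the smallest such $C$. **Theorem.** Let $0<\alpha\le1$, $1<p<\infty$ and $\lambda>3$. Suppose that $\Phi$ satisfies the doubling condition $\Phi(2r)\le D\,\Phi(r)$ for all $r>0$, with a constant $D$ such that $1\le D<2^n$. Then there is a constant $C>0$ such that for every $f\in L^{p,\Phi}(\mathbb R^n)$ the function $g^*_{\lambda,\alpha}(f)$ belongs to $L^{p,\Phi}(\mathbb R^n)$ and $$\big\|g^*_{\lambda,\alpha}(f)\big\|_{L^{p,\Phi}}\le C\,\|f\|_{L^{p,\Phi}}.$$ -/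

import Mathlib

open MeasureTheory Set
open scoped ENNReal

noncomputable section

namespace IntrinsicSquare

/-- The Hölder class `𝒞_α` of kernels on `ℝⁿ`: supported in the closed unit ball, with mean
value zero, and `|φ(x) - φ(x')| ≤ |x - x'|^α` everywhere. (Such a `φ` is continuous with compact
support, hence integrable.) The scalars `𝕜` are `ℝ` or `ℂ`. -/
def kernelClass (𝕜 : Type*) [RCLike 𝕜] (n : ℕ) (α : ℝ) :
    Set (EuclideanSpace ℝ (Fin n) → 𝕜) :=
  {φ | Function.support φ ⊆ Metric.closedBall 0 1 ∧
    ∫ x, φ x = 0 ∧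
    ∀ x x', ‖φ x - φ x'‖ ≤ ‖x - x'‖ ^ α}

/-- The dilation `φ_t(x) = t⁻ⁿ φ(x / t)`. -/
def dilate {𝕜 : Type*} [RCLike 𝕜] {n : ℕ} (φ : EuclideanSpace ℝ (Fin n) → 𝕜) (t : ℝ)
    (x : EuclideanSpace ℝ (Fin n)) : 𝕜 :=
  (t ^ n)⁻¹ • φ (t⁻¹ • x)

/-- `A_α(f)(y,t) = sup_{φ ∈ 𝒞_α} |f * φ_t(y)|`, with
`f * φ_t(y) = ∫ φ_t(y - z) f(z) dz`. -/
def maximalConv {𝕜 : Type*} [RCLike 𝕜] {n : ℕ} (α : ℝ) (f : EuclideanSpace ℝ (Fin n) → 𝕜)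
    (y : EuclideanSpace ℝ (Fin n)) (t : ℝ) : ℝ≥0∞ :=
  ⨆ φ ∈ kernelClass 𝕜 n α, ‖∫ z, dilate φ t (y - z) * f z‖ₑ

/-- The upper half space `ℝⁿ × (0, ∞)`. -/
def upperHalfSpace (n : ℕ) : Set (EuclideanSpace ℝ (Fin n) × ℝ) :=
  univ ×ˢ Ioi 0

/-- The intrinsic `g*_λ`-function of `f` of order `α`, as a function with values in `[0, ∞]`:
`(∬ (t / (t + |x - y|))^{λ n} A_α(f)(y,t)² dy dt / t^{n+1})^{1/2}`, the integral being over the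
upper half space `ℝⁿ × (0, ∞)`. -/
def gStar {𝕜 : Type*} [RCLike 𝕜] {n : ℕ} (lam α : ℝ) (f : EuclideanSpace ℝ (Fin n) → 𝕜)
    (x : EuclideanSpace ℝ (Fin n)) : ℝ≥0∞ :=
  (∫⁻ q in upperHalfSpace n,
    ENNReal.ofReal ((q.2 / (q.2 + ‖x - q.1‖)) ^ (lam * n)) *
      maximalConv α f q.1 q.2 ^ 2 * ENNReal.ofReal ((q.2 ^ (n + 1))⁻¹)) ^ (1 / 2 : ℝ)

/-- A growth function: positive and (weakly) increasing on `(0, ∞)`. -/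
structure IsGrowthFunction (Φ : ℝ → ℝ) : Prop where
  pos : ∀ r, 0 < r → 0 < Φ r
  mono : MonotoneOn Φ (Ioi 0)

/-- `D` is a doubling constant of `Φ`: `D ≥ 1` and `Φ(2r) ≤ D Φ(r)` for all `r > 0`. -/
def IsDoublingConst (Φ : ℝ → ℝ) (D : ℝ) : Prop :=
  1 ≤ D ∧ ∀ r, 0 < r → Φ (2 * r) ≤ D * Φ r

/-- The generalized Morrey norm of `f`: the smallest `C ∈ [0, ∞]` such that
`∫_{B(x₀,r)} |f|^p ≤ C^p Φ(r)` for all balls `B(x₀, r)`.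
The values of `f` may be scalars or elements of `[0, ∞]`. -/
def morreyNorm {n : ℕ} {ε : Type*} [ENorm ε] (p : ℝ) (Φ : ℝ → ℝ)
    (f : EuclideanSpace ℝ (Fin n) → ε) : ℝ≥0∞ :=
  sInf {C : ℝ≥0∞ | ∀ (x₀ : EuclideanSpace ℝ (Fin n)) (r : ℝ), 0 < r →
    ∫⁻ x in Metric.ball x₀ r, ‖f x‖ₑ ^ p ≤ C ^ p * ENNReal.ofReal (Φ r)}

/-- The generalized Morrey space `L^{p,Φ}(ℝⁿ)`: locally integrable functions (for values in
`[0, ∞]`: measurable, with finite integral near every point, hence finite almost everywhere) for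
which some finite `C` satisfies `∫_{B(x₀,r)} |f|^p ≤ C^p Φ(r)` for all balls. -/
def MemMorrey {n : ℕ} {ε : Type*} [TopologicalSpace ε] [ContinuousENorm ε] (p : ℝ) (Φ : ℝ → ℝ)
    (f : EuclideanSpace ℝ (Fin n) → ε) : Prop :=
  LocallyIntegrable f volume ∧ morreyNorm p Φ f < ∞

end IntrinsicSquare

end

noncomputable section

namespace IntrinsicSquare

open Metric ComplexConjugate

section

/-! The proof has two halves: `g*` is bounded on every L^p with 1 < p < ∞
(`exists_lintegral_gStar_rpow_le`), and this passes to Morrey norms because `g*` of a function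
decays away from its support.

On L² the supremum over kernels is linearised: countably many kernels suffice, and one attaining the
maximum over finitely many of them is selected measurably in (y, t). The kernels are Hölder
continuous with mean value zero, so at scales t ≤ t' two of them have inner product O(t'^{-n}
(t/t')^α). The TT* method and Schur's test then bound A_α from L² to L²(dy dt/t), uniformly in the
selection. As A_α(f)(y, t) only sees f on the closed ball of radius t about y, the bound can be
applied to f cut off to the level sets of a maximal function Mw. Integrating over the levels gives ∫
g*(f)² w ≤ C ∫ |f|² Mw. For p > 2 one takes for w a power of `g*(f)` and uses Hölder and the maximal
theorem. For p < 2 a Calderón–Zygmund decomposition gives a distributional inequality: the good part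
is controlled on L², the mean-zero pieces in L¹ off the exceptional set. Integration over the levels
finishes the case.

On a ball B(x₀, r), f splits into its restriction to B(x₀, 2r), handled by the L^p bound and one
doubling, and its pieces on dyadic annuli. On B(x₀, r), `g*` of the k-th far piece is at most a
constant times (2^k r)^{-n} times the L¹ norm of f on the ball of radius 2^{k+2} r. By Hölder and
doubling these bounds form a geometric series of ratio (D/2^n)^{1/p}, which converges since D < 2^n.

The condition λ > 3 comes from `exists_gStar_le_of_decay`, which serves both the mean-zero pieces
and the annuli: half of the weight must be integrable in y, while the other half must beat t^{-2n}
as t → 0. -/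

/-- The Euclidean space `ℝⁿ`. -/
abbrev Eu (n : ℕ) := EuclideanSpace ℝ (Fin n)

/-! ### Volumes of balls -/

/-- The volume of the unit ball of `ℝⁿ`. -/
def unitVol (n : ℕ) : ℝ≥0∞ := volume (ball (0 : Eu n) 1)

lemma unitVol_pos (n : ℕ) : 0 < unitVol n := measure_ball_pos _ _ one_pos

lemma unitVol_ne_zero (n : ℕ) : unitVol n ≠ 0 := (unitVol_pos n).ne'

lemma unitVol_ne_top (n : ℕ) : unitVol n ≠ ∞ := measure_ball_lt_top.ne

lemma volume_ball_eq {n : ℕ} (x : Eu n) {r : ℝ} (hr : 0 < r) :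
    volume (ball x r) = ENNReal.ofReal (r ^ n) * unitVol n := by
  rw [Measure.addHaar_ball_of_pos _ _ hr, finrank_euclideanSpace_fin, unitVol]

lemma volume_closedBall_eq {n : ℕ} (x : Eu n) {r : ℝ} (hr : 0 ≤ r) :
    volume (closedBall x r) = ENNReal.ofReal (r ^ n) * unitVol n := by
  rw [Measure.addHaar_closedBall _ _ hr, finrank_euclideanSpace_fin, unitVol]

/-! ### The layer cake formula for functions with values in `[0, ∞]` -/

lemma lintegral_Ioo_rpow {q : ℝ} (hq : 0 < q) {a : ℝ} (ha : 0 ≤ a) :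
    ∫⁻ s in Ioo (0 : ℝ) a, ENNReal.ofReal (q * s ^ (q - 1)) = ENNReal.ofReal a ^ q := by
  have hint : IntervalIntegrable (fun s : ℝ => q * s ^ (q - 1)) volume 0 a :=
    (intervalIntegral.intervalIntegrable_rpow' (by linarith)).const_mul q
  rw [← ofReal_integral_eq_lintegral_ofReal]
  · rw [← integral_Ioc_eq_integral_Ioo, ← intervalIntegral.integral_of_le ha,
      intervalIntegral.integral_const_mul, integral_rpow (Or.inl (by linarith)),
      ENNReal.ofReal_rpow_of_nonneg ha hq.le]
    congr 1
    rw [sub_add_cancel, Real.zero_rpow hq.ne', sub_zero]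
    field_simp
  · exact ((intervalIntegrable_iff_integrableOn_Ioc_of_le ha).1 hint).mono_set Ioo_subset_Ioc_self
  · refine (ae_restrict_iff' measurableSet_Ioo).2 (Filter.Eventually.of_forall fun s hs => ?_)
    have := hs.1
    positivity

/-- The power is the integral of its derivative up to c. For c = ∞ the integral dominates a^q for
every finite a, so both sides are infinite. -/
lemma lintegral_indicator_lt_rpow {q : ℝ} (hq : 0 < q) (c : ℝ≥0∞) :
    ∫⁻ s in Ioi (0 : ℝ), {s : ℝ | ENNReal.ofReal s < c}.indicator
      (fun s => ENNReal.ofReal (q * s ^ (q - 1))) s = c ^ q := by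
  have key : ∀ a : ℝ, 0 ≤ a → ENNReal.ofReal a ≤ c → ENNReal.ofReal a ^ q ≤
      ∫⁻ s in Ioi (0 : ℝ), {s : ℝ | ENNReal.ofReal s < c}.indicator
        (fun s => ENNReal.ofReal (q * s ^ (q - 1))) s := by
    intro a ha hac
    rw [← lintegral_Ioo_rpow hq ha, ← lintegral_indicator measurableSet_Ioo,
      ← lintegral_indicator measurableSet_Ioi]
    refine lintegral_mono fun s => indicator_le (fun s hs => ?_) s
    rw [indicator_of_mem (show s ∈ Ioi (0 : ℝ) from hs.1), indicator_of_mem]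
    exact lt_of_lt_of_le ((ENNReal.ofReal_lt_ofReal_iff_of_nonneg hs.1.le).2 hs.2) hac
  by_cases hc : c = ∞
  · subst hc
    rw [ENNReal.top_rpow_of_pos hq, eq_top_iff]
    refine le_of_forall_lt fun b hb => ?_
    obtain ⟨b', hbb', hb'⟩ := exists_between hb
    refine hbb'.trans_le ?_
    have h := key ((b' ^ (1 / q)).toReal) ENNReal.toReal_nonneg le_top
    rwa [ENNReal.ofReal_toReal (by finiteness), ← ENNReal.rpow_mul,
      one_div_mul_cancel hq.ne', ENNReal.rpow_one] at h
  · refine le_antisymm ?_ ?_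
    · have hca : c = ENNReal.ofReal c.toReal := (ENNReal.ofReal_toReal hc).symm
      conv_rhs => rw [hca, ← lintegral_Ioo_rpow hq ENNReal.toReal_nonneg]
      rw [← lintegral_indicator measurableSet_Ioo, ← lintegral_indicator measurableSet_Ioi]
      refine lintegral_mono fun s => ?_
      by_cases h0 : s ∈ Ioi (0 : ℝ)
      · by_cases h1 : ENNReal.ofReal s < c
        · have h2 : s ∈ Ioo 0 c.toReal := ⟨h0, (ENNReal.ofReal_lt_iff_lt_toReal (le_of_lt h0) hc).1 h1⟩
          rw [indicator_of_mem h0, indicator_of_mem h2,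
            indicator_of_mem (show s ∈ {s : ℝ | ENNReal.ofReal s < c} from h1)]
        · rw [indicator_of_mem h0, 
            indicator_of_notMem (show s ∉ {s : ℝ | ENNReal.ofReal s < c} from h1)]
          exact zero_le
      · rw [indicator_of_notMem h0]
        exact zero_le
    · have h := key c.toReal ENNReal.toReal_nonneg (ENNReal.ofReal_toReal hc).le
      rwa [ENNReal.ofReal_toReal hc] at h

lemma lintegral_rpow_eq_lintegral_meas_lt {α : Type*} [MeasurableSpace α] {μ : Measure α}
    [SFinite μ] {q : ℝ} (hq : 0 < q) {h : α → ℝ≥0∞} (hh : Measurable h) :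
    ∫⁻ x, h x ^ q ∂μ = ∫⁻ s in Ioi (0 : ℝ),
      ENNReal.ofReal (q * s ^ (q - 1)) * μ {x | ENNReal.ofReal s < h x} := by
  simp_rw [← lintegral_indicator_lt_rpow hq]
  rw [lintegral_lintegral_swap]
  · refine lintegral_congr fun s => ?_
    rw [← lintegral_indicator_const (measurableSet_lt measurable_const hh)]
    refine lintegral_congr fun x => ?_
    simp [indicator]
  · refine Measurable.aemeasurable ?_
    have : MeasurableSet {z : α × ℝ | ENNReal.ofReal z.2 < h z.1} :=
      measurableSet_lt (by fun_prop) (by fun_prop)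
    exact Measurable.indicator (f := fun z : α × ℝ => ENNReal.ofReal (q * z.2 ^ (q - 1)))
      (by fun_prop) this

/-! ### The Hardy–Littlewood maximal function -/

/-- The uncentred Hardy–Littlewood maximal function of a nonnegative function. -/
def maximalFn {n : ℕ} (w : Eu n → ℝ≥0∞) (x : Eu n) : ℝ≥0∞ :=
  ⨆ (c : Eu n) (r : ℝ) (_ : x ∈ ball c r), (∫⁻ z in ball c r, w z) / volume (ball c r)

variable {n : ℕ} {w w' : Eu n → ℝ≥0∞}

lemma lt_maximalFn_iff {s : ℝ≥0∞} {x : Eu n} : s < maximalFn w x ↔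
    ∃ c r, x ∈ ball c r ∧ s < (∫⁻ z in ball c r, w z) / volume (ball c r) := by
  simp only [maximalFn, lt_iSup_iff, exists_prop]

/-- The maximal function is uncentred, so a ball whose average exceeds s lies entirely in the level
set. -/
lemma isOpen_lt_maximalFn (w : Eu n → ℝ≥0∞) (s : ℝ≥0∞) : IsOpen {x | s < maximalFn w x} := by
  have : {x | s < maximalFn w x} = ⋃ (c : Eu n) (r : ℝ)
      (_ : s < (∫⁻ z in ball c r, w z) / volume (ball c r)), ball c r := by
    ext x
    simp only [mem_ofPred_eq, lt_maximalFn_iff, mem_iUnion, exists_prop, and_comm]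
  rw [this]
  exact isOpen_iUnion fun c => isOpen_iUnion fun r => isOpen_iUnion fun _ => isOpen_ball

lemma measurable_maximalFn (w : Eu n → ℝ≥0∞) : Measurable (maximalFn w) :=
  measurable_of_Ioi fun s => (isOpen_lt_maximalFn w s).measurableSet

lemma average_le_maximalFn {x c : Eu n} {r : ℝ} (h : x ∈ ball c r) :
    (∫⁻ z in ball c r, w z) / volume (ball c r) ≤ maximalFn w x :=
  le_iSup_of_le c (le_iSup_of_le r (le_iSup_of_le h le_rfl))

lemma lintegral_ball_le {x c : Eu n} {r : ℝ} (h : x ∈ ball c r) :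
    ∫⁻ z in ball c r, w z ≤ maximalFn w x * (ENNReal.ofReal (r ^ n) * unitVol n) := by
  have hr : 0 < r := pos_of_mem_ball h
  rw [← volume_ball_eq c hr]
  exact (ENNReal.div_le_iff (measure_ball_pos _ _ hr).ne' measure_ball_lt_top.ne).1
    (average_le_maximalFn h)

lemma maximalFn_mono (h : ∀ x, w x ≤ w' x) (x : Eu n) : maximalFn w x ≤ maximalFn w' x := by
  unfold maximalFn
  gcongr
  exact h _

lemma maximalFn_add_const_le (hw : Measurable w) (c : ℝ≥0∞) (x : Eu n) :
    maximalFn (fun z => w z + c) x ≤ maximalFn w x + c := by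
  refine iSup_le fun y => iSup_le fun r => iSup_le fun h => ?_
  have hr : 0 < r := pos_of_mem_ball h
  rw [lintegral_add_left hw, setLIntegral_const, ENNReal.add_div,
    ENNReal.mul_div_cancel_right (measure_ball_pos _ _ hr).ne' measure_ball_lt_top.ne]
  gcongr
  exact average_le_maximalFn h

/-- The weak type `(1, 1)` inequality. -/
lemma mul_volume_lt_maximalFn_le (hn : 0 < n) (w : Eu n → ℝ≥0∞) {s : ℝ≥0∞} (hs : s ≠ 0)
    (hs' : s ≠ ∞) :
    s * volume {x | s < maximalFn w x} ≤ 5 ^ n * ∫⁻ x, w x := by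
  by_cases hI : ∫⁻ x, w x = ∞
  · rw [hI, ENNReal.mul_top (by simp)]
    exact le_top
  set t : Set (Eu n × ℝ) :=
    {a | 0 < a.2 ∧ s < (∫⁻ z in ball a.1 a.2, w z) / volume (ball a.1 a.2)} with ht
  have hball : ∀ a ∈ t, s * volume (ball a.1 a.2) ≤ ∫⁻ z in ball a.1 a.2, w z := by
    intro a ha
    exact ((ENNReal.lt_div_iff_mul_lt (Or.inl (measure_ball_pos _ _ ha.1).ne')
      (Or.inl measure_ball_lt_top.ne)).1 ha.2).le
  set K : ℝ≥0∞ := (∫⁻ x, w x) / (s * unitVol n) with hK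
  have hKtop : K ≠ ∞ := ENNReal.div_ne_top hI (mul_ne_zero hs (unitVol_ne_zero n))
  -- Vitali's selection needs bounded radii. The average exceeds s, so the volume is at most (∫
  -- w)/s. The 1 is there because a ≤ aⁿ requires a ≥ 1.
  have hrad : ∀ a ∈ t, a.2 ≤ max 1 K.toReal := by
    intro a ha
    rcases le_or_gt a.2 1 with h1 | h1
    · exact h1.trans (le_max_left _ _)
    · refine le_trans ?_ (le_max_right _ _)
      have h2 : ENNReal.ofReal (a.2 ^ n) ≤ K := by
        rw [hK, ENNReal.le_div_iff_mul_le
          (Or.inl (mul_ne_zero hs (unitVol_ne_zero n)))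
          (Or.inl (ENNReal.mul_ne_top hs' (unitVol_ne_top n)))]
        calc ENNReal.ofReal (a.2 ^ n) * (s * unitVol n)
            = s * volume (ball a.1 a.2) := by rw [volume_ball_eq _ ha.1]; ring
          _ ≤ ∫⁻ z in ball a.1 a.2, w z := hball a ha
          _ ≤ ∫⁻ z, w z := setLIntegral_le_lintegral _ _
      have h3 : a.2 ^ n ≤ K.toReal :=
        (ENNReal.ofReal_le_iff_le_toReal hKtop).1 h2
      exact (le_self_pow₀ h1.le hn.ne').trans h3
  obtain ⟨u, hut, hdisj, hcov⟩ := Vitali.exists_disjoint_subfamily_covering_enlargement_ball t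
    (fun a => a.1) (fun a => a.2) _ hrad 5 (by norm_num)
  have hu : u.Countable := hdisj.countable_of_isOpen (fun _ _ => isOpen_ball)
    (fun a ha => nonempty_ball.2 (hut ha).1)
  have hsub : {x | s < maximalFn w x} ⊆ ⋃ a ∈ u, ball a.1 (5 * a.2) := by
    intro x hx
    obtain ⟨c, r, hxc, hlt⟩ := lt_maximalFn_iff.1 hx
    obtain ⟨b, hb, hsub⟩ := hcov (c, r) ⟨pos_of_mem_ball hxc, hlt⟩
    exact mem_biUnion hb (hsub hxc)
  calc s * volume {x | s < maximalFn w x}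
      ≤ s * ∑' a : u, volume (ball a.1.1 (5 * a.1.2)) := by
        gcongr
        exact (measure_mono hsub).trans (measure_biUnion_le _ hu _)
    _ = 5 ^ n * ∑' a : u, s * volume (ball a.1.1 a.1.2) := by
        rw [← ENNReal.tsum_mul_left, ← ENNReal.tsum_mul_left]
        refine tsum_congr fun a => ?_
        have ha := (hut a.2).1
        rw [volume_ball_eq _ ha, volume_ball_eq _ (by positivity), mul_pow,
          ENNReal.ofReal_mul (by positivity), ENNReal.ofReal_pow (by norm_num)]
        norm_num
        ring
    _ ≤ 5 ^ n * ∑' a : u, ∫⁻ z in ball a.1.1 a.1.2, w z := by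
        gcongr with a
        exact hball _ (hut a.2)
    _ = 5 ^ n * ∫⁻ z in ⋃ a ∈ u, ball a.1 a.2, w z := by
        rw [lintegral_biUnion hu (fun _ _ => measurableSet_ball) hdisj]
    _ ≤ 5 ^ n * ∫⁻ x, w x := by
        gcongr
        exact Measure.restrict_le_self

/-- The weak type inequality for the part of `w` above half of the level. -/
lemma volume_lt_maximalFn_le (hn : 0 < n) (hw : Measurable w) {s : ℝ} (hs : 0 < s) :
    volume {x | ENNReal.ofReal s < maximalFn w x} ≤
      (2 * 5 ^ n) * (ENNReal.ofReal s⁻¹ *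
        ∫⁻ x, {x | ENNReal.ofReal s < 2 * w x}.indicator w x) := by
  -- The part of w below s/2 adds at most s/2 to the maximal function, so the part w₁ above it must
  -- contribute more than s/2.
  set s' : ℝ≥0∞ := ENNReal.ofReal (s / 2) with hs'
  have hs2 : ENNReal.ofReal s = s' + s' := by
    rw [hs', ← ENNReal.ofReal_add (by positivity) (by positivity), add_halves]
  set w₁ : Eu n → ℝ≥0∞ := {x | ENNReal.ofReal s < 2 * w x}.indicator w with hw₁
  have hm : MeasurableSet {x | ENNReal.ofReal s < 2 * w x} :=
    measurableSet_lt measurable_const (by fun_prop)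
  have hle : ∀ x, w x ≤ w₁ x + s' := by
    intro x
    by_cases hx : ENNReal.ofReal s < 2 * w x
    · rw [hw₁, indicator_of_mem (show x ∈ {x | ENNReal.ofReal s < 2 * w x} from hx)]
      exact le_self_add
    · rw [hw₁, indicator_of_notMem (show x ∉ {x | ENNReal.ofReal s < 2 * w x} from hx), zero_add]
      rw [not_lt, hs2, ← two_mul] at hx
      exact (ENNReal.mul_le_mul_iff_right (by simp) (by simp)).1 hx
  have hsub : {x | ENNReal.ofReal s < maximalFn w x} ⊆ {x | s' < maximalFn w₁ x} := by
    intro x hx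
    have h := hx.trans_le ((maximalFn_mono hle x).trans
      (maximalFn_add_const_le (hw.indicator hm) s' x))
    exact lt_of_add_lt_add_right (lt_of_eq_of_lt hs2.symm h)
  have hs0 : s' ≠ 0 := by simp [hs', hs]
  have hst : s' ≠ ∞ := ENNReal.ofReal_ne_top
  have hinv : 2 * ENNReal.ofReal s⁻¹ * s' = 1 := by
    rw [hs', mul_assoc, ← ENNReal.ofReal_mul (by positivity), ← ENNReal.ofReal_ofNat 2,
      ← ENNReal.ofReal_mul (by norm_num)]
    field_simp
    simp
  calc volume {x | ENNReal.ofReal s < maximalFn w x}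
      ≤ volume {x | s' < maximalFn w₁ x} := measure_mono hsub
    _ = 2 * ENNReal.ofReal s⁻¹ * (s' * volume {x | s' < maximalFn w₁ x}) := by
        rw [← mul_assoc, hinv, one_mul]
    _ ≤ 2 * ENNReal.ofReal s⁻¹ * (5 ^ n * ∫⁻ x, w₁ x) := by
        exact mul_le_mul_right (mul_volume_lt_maximalFn_le hn w₁ hs0 hst) _
    _ = _ := by ring

/-- The maximal theorem. -/
lemma exists_lintegral_maximalFn_rpow_le (hn : 0 < n) {q : ℝ} (hq : 1 < q) :
    ∃ C : ℝ≥0∞, C ≠ ∞ ∧ ∀ w : Eu n → ℝ≥0∞, Measurable w →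
      ∫⁻ x, maximalFn w x ^ q ≤ C * ∫⁻ x, w x ^ q := by
  have hq1 : 0 < q - 1 := by linarith
  have hq0 : 0 < q := by linarith
  refine ⟨2 * 5 ^ n * ENNReal.ofReal (q / (q - 1)) * 2 ^ (q - 1), by finiteness, fun w hw => ?_⟩
  have hmeas : MeasurableSet {z : ℝ × Eu n | ENNReal.ofReal z.1 < 2 * w z.2} :=
    measurableSet_lt (by fun_prop) (by fun_prop)
  calc ∫⁻ x, maximalFn w x ^ q
      = ∫⁻ s in Ioi (0 : ℝ), ENNReal.ofReal (q * s ^ (q - 1)) *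
          volume {x | ENNReal.ofReal s < maximalFn w x} :=
        lintegral_rpow_eq_lintegral_meas_lt hq0 (measurable_maximalFn w)
    -- The weak type bound turns s^{q-1} into s^{q-2}. The factor q/(q-1) normalises this to the
    -- layer cake density of exponent q - 1 > 0.
    _ ≤ ∫⁻ s in Ioi (0 : ℝ), ∫⁻ x, 2 * 5 ^ n * ENNReal.ofReal (q / (q - 1)) * (w x *
          {s : ℝ | ENNReal.ofReal s < 2 * w x}.indicator
            (fun s => ENNReal.ofReal ((q - 1) * s ^ (q - 1 - 1))) s) := by
        refine setLIntegral_mono' measurableSet_Ioi fun s hs => ?_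
        have hs0 : 0 < s := hs
        refine (mul_le_mul_right (volume_lt_maximalFn_le hn hw hs) _).trans (le_of_eq ?_)
        rw [lintegral_const_mul' _ _ (by finiteness), mul_left_comm, mul_assoc (2 * 5 ^ n)]
        congr 1
        rw [← lintegral_const_mul' _ _ (by finiteness), ← lintegral_const_mul' _ _ (by finiteness),
          ← lintegral_const_mul' _ _ (by finiteness)]
        refine lintegral_congr fun x => ?_
        by_cases hx : ENNReal.ofReal s < 2 * w x
        · rw [indicator_of_mem (show x ∈ {x | ENNReal.ofReal s < 2 * w x} from hx),
            indicator_of_mem (show s ∈ {s : ℝ | ENNReal.ofReal s < 2 * w x} from hx),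
            mul_left_comm (ENNReal.ofReal (q / (q - 1))), ← mul_assoc,
            ← ENNReal.ofReal_mul (by positivity), ← ENNReal.ofReal_mul (by positivity), mul_comm]
          congr 2
          rw [Real.rpow_sub_one hs0.ne' (q - 1)]
          field_simp
        · rw [indicator_of_notMem (show x ∉ {x | ENNReal.ofReal s < 2 * w x} from hx),
            indicator_of_notMem (show s ∉ {s : ℝ | ENNReal.ofReal s < 2 * w x} from hx)]
          simp
    _ = ∫⁻ x, 2 * 5 ^ n * ENNReal.ofReal (q / (q - 1)) * (w x * (2 * w x) ^ (q - 1)) := by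
        rw [lintegral_lintegral_swap]
        · refine lintegral_congr fun x => ?_
          rw [lintegral_const_mul' _ _ (by finiteness), lintegral_const_mul,
            lintegral_indicator_lt_rpow hq1]
          exact Measurable.indicator (by fun_prop) (measurableSet_lt (by fun_prop) (by fun_prop))
        · refine Measurable.aemeasurable ?_
          have h : Measurable fun z : ℝ × Eu n =>
              {z : ℝ × Eu n | ENNReal.ofReal z.1 < 2 * w z.2}.indicator
                (fun z => ENNReal.ofReal ((q - 1) * z.1 ^ (q - 1 - 1))) z :=
            Measurable.indicator (by fun_prop) hmeas
          exact Measurable.const_mul ((hw.comp measurable_snd).mul h) _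
    _ = 2 * 5 ^ n * ENNReal.ofReal (q / (q - 1)) * 2 ^ (q - 1) * ∫⁻ x, w x ^ q := by
        rw [← lintegral_const_mul' _ _ (by finiteness)]
        refine lintegral_congr fun x => ?_
        rw [ENNReal.mul_rpow_of_nonneg _ _ hq1.le]
        have : w x * w x ^ (q - 1) = w x ^ q := by
          conv_lhs => rw [← ENNReal.rpow_one (w x), ← ENNReal.rpow_mul, one_mul]
          rw [← ENNReal.rpow_add_of_nonneg _ _ zero_le_one hq1.le]
          congr 1
          ring
        rw [← this]
        ring

/-- Lebesgue differentiation, applied to the cut-offs of w to balls about the origin, which have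
finite integral. Its closed balls have the same averages as the open ones in `maximalFn`. -/
lemma ae_le_maximalFn (hw : Measurable w) (hloc : ∀ r : ℝ, ∫⁻ z in ball 0 r, w z ≠ ∞) :
    ∀ᵐ x, w x ≤ maximalFn w x := by
  have h : ∀ N : ℕ, ∀ᵐ x, Filter.Tendsto (fun a => (∫⁻ y in a, (ball 0 N).indicator w y) / volume a)
      ((Besicovitch.vitaliFamily volume).filterAt x)
      (nhds ((ball (0 : Eu n) N).indicator w x)) := by
    intro N
    refine VitaliFamily.ae_tendsto_lintegral_div' _ (hw.indicator measurableSet_ball) ?_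
    rw [lintegral_indicator measurableSet_ball]
    exact hloc N
  filter_upwards [ae_all_iff.2 h] with x hx
  obtain ⟨N, hN⟩ := exists_nat_gt ‖x‖
  have hx' := (hx N).comp (Besicovitch.tendsto_filterAt volume x)
  rw [indicator_of_mem (by simpa using hN)] at hx'
  refine le_of_tendsto hx' ?_
  filter_upwards [self_mem_nhdsWithin] with r hr
  have hr : 0 < r := hr
  simp only [Function.comp]
  have hae : closedBall x r =ᵐ[volume] ball x r := by
    refine (ae_eq_of_subset_of_measure_ge ball_subset_closedBall ?_
      measurableSet_ball.nullMeasurableSet measure_closedBall_lt_top.ne).symm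
    rw [volume_ball_eq _ hr, volume_closedBall_eq _ hr.le]
  rw [setLIntegral_congr hae, measure_congr hae]
  refine le_trans ?_ (average_le_maximalFn (mem_ball_self hr))
  gcongr
  exact indicator_le_self _ _ _

end

section

/-! ### Minkowski's inequality for countable sums -/

lemma lintegral_rpow_sum_le {α ι : Type*} [MeasurableSpace α] {μ : Measure α} {p : ℝ} (hp : 1 ≤ p)
    {a : ι → α → ℝ≥0∞} (ha : ∀ i, AEMeasurable (a i) μ) (s : Finset ι) :
    (∫⁻ x, (∑ i ∈ s, a i x) ^ p ∂μ) ^ (1 / p) ≤ ∑ i ∈ s, (∫⁻ x, a i x ^ p ∂μ) ^ (1 / p) := by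
  classical
  have hp0 : 0 < p := by linarith
  induction s using Finset.induction_on with
  | empty => simp [hp0]
  | insert i s hi ih =>
    simp only [Finset.sum_insert hi]
    have hs : AEMeasurable (fun x => ∑ i ∈ s, a i x) μ := Finset.aemeasurable_fun_sum s fun i _ => ha i
    exact (ENNReal.lintegral_Lp_add_le (ha i) hs hp).trans (by gcongr)

lemma lintegral_rpow_tsum_le {α ι : Type*} [Countable ι] [MeasurableSpace α] {μ : Measure α}
    {p : ℝ} (hp : 1 ≤ p) {a : ι → α → ℝ≥0∞} (ha : ∀ i, AEMeasurable (a i) μ) :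
    (∫⁻ x, (∑' i, a i x) ^ p ∂μ) ^ (1 / p) ≤ ∑' i, (∫⁻ x, a i x ^ p ∂μ) ^ (1 / p) := by
  have hp0 : 0 < p := by linarith
  have h1 : ∀ x, (∑' i, a i x) ^ p = ⨆ s : Finset ι, (∑ i ∈ s, a i x) ^ p := by
    intro x
    rw [ENNReal.tsum_eq_iSup_sum]
    exact (ENNReal.orderIsoRpow p hp0).map_iSup _
  simp_rw [h1]
  rw [lintegral_iSup_directed]
  · rw [show (⨆ s : Finset ι, ∫⁻ x, (∑ i ∈ s, a i x) ^ p ∂μ) ^ (1 / p) =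
      ⨆ s : Finset ι, (∫⁻ x, (∑ i ∈ s, a i x) ^ p ∂μ) ^ (1 / p) from
      (ENNReal.orderIsoRpow (1 / p) (by positivity)).map_iSup _]
    exact iSup_le fun s => (lintegral_rpow_sum_le hp ha s).trans (ENNReal.sum_le_tsum s)
  · exact fun s => (Finset.aemeasurable_fun_sum s fun i _ => ha i).pow_const p
  · refine Monotone.directed_le fun s t hst x => ?_
    dsimp only
    gcongr

variable {𝕜 : Type*} [RCLike 𝕜] {n : ℕ} {α : ℝ} {φ : Eu n → 𝕜} {f f' : Eu n → 𝕜}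

/-! ### The kernels -/

lemma zero_mem_kernelClass (𝕜 : Type*) [RCLike 𝕜] (n : ℕ) (α : ℝ) :
    (0 : Eu n → 𝕜) ∈ kernelClass 𝕜 n α := by
  refine ⟨by simp, by simp, fun x x' => ?_⟩
  simp only [Pi.zero_apply, sub_self, norm_zero]
  positivity

lemma kernel_eq_zero (hφ : φ ∈ kernelClass 𝕜 n α) {x : Eu n} (hx : 1 < ‖x‖) : φ x = 0 := by
  by_contra h
  have := hφ.1 (Function.mem_support.2 h)
  rw [mem_closedBall_zero_iff] at this
  linarith

/-- Compare with a point e of norm 2, where φ vanishes: |x - e| ≤ 3 and 3^α ≤ 3. Such a point exists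
only in positive dimension. -/
lemma kernel_norm_le (hn : 0 < n) (hα0 : 0 < α) (hα1 : α ≤ 1) (hφ : φ ∈ kernelClass 𝕜 n α)
    (x : Eu n) : ‖φ x‖ ≤ 3 := by
  rcases lt_or_ge 1 ‖x‖ with hx | hx
  · rw [kernel_eq_zero hφ hx, norm_zero]
    norm_num
  · have : Nonempty (Fin n) := ⟨⟨0, hn⟩⟩
    obtain ⟨e, he⟩ := exists_norm_eq (Eu n) (zero_le_two (α := ℝ))
    have h := hφ.2.2 x e
    rw [kernel_eq_zero hφ (x := e) (by rw [he]; norm_num), sub_zero] at h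
    refine h.trans ?_
    have h3 : ‖x - e‖ ≤ 3 := (norm_sub_le _ _).trans (by rw [he]; linarith)
    calc ‖x - e‖ ^ α ≤ 3 ^ α := by gcongr
      _ ≤ 3 ^ (1 : ℝ) := Real.rpow_le_rpow_of_exponent_le (by norm_num) hα1
      _ = 3 := Real.rpow_one 3

lemma kernel_continuous (hα0 : 0 < α) (hφ : φ ∈ kernelClass 𝕜 n α) : Continuous φ := by
  refine continuous_iff_continuousAt.2 fun x => ?_
  rw [ContinuousAt, tendsto_iff_norm_sub_tendsto_zero]
  refine squeeze_zero (fun _ => norm_nonneg _) (fun x' => hφ.2.2 x' x) ?_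
  have : Continuous fun x' : Eu n => ‖x' - x‖ ^ α :=
    (Real.continuous_rpow_const hα0.le).comp (by fun_prop)
  simpa [hα0.ne'] using this.tendsto x

lemma dilate_eq_zero (hφ : φ ∈ kernelClass 𝕜 n α) {t : ℝ} (ht : 0 < t) {x : Eu n}
    (hx : t < ‖x‖) : dilate φ t x = 0 := by
  rw [dilate, kernel_eq_zero hφ, smul_zero]
  rw [norm_smul, Real.norm_of_nonneg (by positivity), inv_mul_eq_div, one_lt_div ht]
  exact hx

lemma dilate_norm_le (hn : 0 < n) (hα0 : 0 < α) (hα1 : α ≤ 1) (hφ : φ ∈ kernelClass 𝕜 n α)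
    {t : ℝ} (ht : 0 < t) (x : Eu n) : ‖dilate φ t x‖ ≤ 3 * (t ^ n)⁻¹ := by
  rw [dilate, norm_smul, Real.norm_of_nonneg (by positivity), mul_comm]
  gcongr
  exact kernel_norm_le hn hα0 hα1 hφ _

lemma dilate_norm_sub_le (hφ : φ ∈ kernelClass 𝕜 n α) {t : ℝ} (ht : 0 < t) (x x' : Eu n) :
    ‖dilate φ t x - dilate φ t x'‖ ≤ (t ^ n)⁻¹ * (‖x - x'‖ / t) ^ α := by
  rw [dilate, dilate, ← smul_sub, norm_smul, Real.norm_of_nonneg (by positivity)]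
  gcongr
  refine (hφ.2.2 _ _).trans (le_of_eq ?_)
  rw [← smul_sub, norm_smul, Real.norm_of_nonneg (by positivity), inv_mul_eq_div]

lemma dilate_continuous (hα0 : 0 < α) (hφ : φ ∈ kernelClass 𝕜 n α) (t : ℝ) :
    Continuous (dilate φ t) :=
  ((kernel_continuous hα0 hφ).comp (continuous_const_smul t⁻¹)).const_smul (t ^ n)⁻¹

lemma dilate_enorm_le (hn : 0 < n) (hα0 : 0 < α) (hα1 : α ≤ 1) (hφ : φ ∈ kernelClass 𝕜 n α)
    {t : ℝ} (ht : 0 < t) (y z : Eu n) :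
    ‖dilate φ t (y - z)‖ₑ ≤ (closedBall y t).indicator (fun _ => ENNReal.ofReal (3 * (t ^ n)⁻¹)) z := by
  by_cases hz : z ∈ closedBall y t
  · rw [indicator_of_mem hz, ← ofReal_norm]
    exact ENNReal.ofReal_le_ofReal (dilate_norm_le hn hα0 hα1 hφ ht _)
  · rw [dilate_eq_zero hφ ht, enorm_zero]
    · exact zero_le
    · rw [mem_closedBall, dist_comm, dist_eq_norm, not_le] at hz
      exact hz

lemma lintegral_dilate_mul_le (hn : 0 < n) (hα0 : 0 < α) (hα1 : α ≤ 1)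
    (hφ : φ ∈ kernelClass 𝕜 n α) (f : Eu n → 𝕜) (y : Eu n) {t : ℝ} (ht : 0 < t) :
    ∫⁻ z, ‖dilate φ t (y - z) * f z‖ₑ ≤
      ENNReal.ofReal (3 * (t ^ n)⁻¹) * ∫⁻ z in closedBall y t, ‖f z‖ₑ := by
  rw [← lintegral_const_mul' _ _ (by finiteness), ← lintegral_indicator measurableSet_closedBall]
  refine lintegral_mono fun z => ?_
  rw [enorm_mul]
  refine (mul_le_mul_left (dilate_enorm_le hn hα0 hα1 hφ ht y z) _).trans ?_
  by_cases hz : z ∈ closedBall y t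
  · simp [indicator_of_mem hz]
  · simp [indicator_of_notMem hz]

lemma maximalConv_le (hn : 0 < n) (hα0 : 0 < α) (hα1 : α ≤ 1) (f : Eu n → 𝕜) (y : Eu n) {t : ℝ}
    (ht : 0 < t) : maximalConv α f y t ≤
      ENNReal.ofReal (3 * (t ^ n)⁻¹) * ∫⁻ z in closedBall y t, ‖f z‖ₑ :=
  iSup₂_le fun _ hφ => (enorm_integral_le_lintegral_enorm _).trans
    (lintegral_dilate_mul_le hn hα0 hα1 hφ f y ht)

/-- Locality of A_α: the dilated kernels live on the closed ball of radius t. The cut-off to level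
sets and the vanishing of far pieces rest on this. -/
lemma maximalConv_congr {y : Eu n} {t : ℝ} (ht : 0 < t)
    (h : ∀ᵐ z, z ∈ closedBall y t → f z = f' z) : maximalConv α f y t = maximalConv α f' y t := by
  refine iSup_congr fun φ => iSup_congr fun hφ => ?_
  congr 1
  refine integral_congr_ae ?_
  filter_upwards [h] with z hz
  by_cases hzt : z ∈ closedBall y t
  · rw [hz hzt]
  · rw [dilate_eq_zero hφ ht, zero_mul, zero_mul]
    rw [mem_closedBall, dist_comm, dist_eq_norm, not_le] at hzt
    exact hzt

/-- For a fixed kernel the integral commutes with the sum, by the absolute summability `hfin`. The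
supremum of a sum is at most the sum of the suprema. -/
lemma maximalConv_le_tsum {ι : Type*} [Countable ι] (hn : 0 < n) (hα0 : 0 < α) (hα1 : α ≤ 1)
    {F : ι → Eu n → 𝕜} (hF : ∀ i, AEStronglyMeasurable (F i) volume)
    (hsum : ∀ᵐ z, HasSum (fun i => F i z) (f z)) {y : Eu n} {t : ℝ} (ht : 0 < t)
    (hfin : ∑' i, ∫⁻ z in closedBall y t, ‖F i z‖ₑ ≠ ∞) :
    maximalConv α f y t ≤ ∑' i, maximalConv α (F i) y t := by
  refine iSup₂_le fun φ hφ => ?_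
  have h1 : ∫ z, dilate φ t (y - z) * f z = ∫ z, ∑' i, dilate φ t (y - z) * F i z := by
    refine integral_congr_ae ?_
    filter_upwards [hsum] with z hz
    exact (hz.mul_left _).tsum_eq.symm
  have hc : Continuous fun z => dilate φ t (y - z) :=
    (dilate_continuous hα0 hφ t).comp (continuous_const.sub continuous_id)
  rw [h1, integral_tsum (f := fun i z => dilate φ t (y - z) * F i z)
    (fun i => hc.aestronglyMeasurable.mul (hF i))]
  · refine enorm_tsum_le_tsum_enorm.trans ?_
    gcongr with i
    exact le_iSup₂_of_le φ hφ le_rfl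
  · refine ne_top_of_le_ne_top ?_ (ENNReal.tsum_le_tsum fun i =>
      lintegral_dilate_mul_le hn hα0 hα1 hφ (F i) y ht)
    rw [ENNReal.tsum_mul_left]
    finiteness

/-! ### Measurability -/

lemma isOpen_upperHalfSpace (n : ℕ) : IsOpen (upperHalfSpace n) := isOpen_univ.prod isOpen_Ioi

lemma mem_upperHalfSpace {q : Eu n × ℝ} : q ∈ upperHalfSpace n ↔ 0 < q.2 := by
  simp [upperHalfSpace]

lemma continuousOn_conv (hn : 0 < n) (hα0 : 0 < α) (hα1 : α ≤ 1) (hφ : φ ∈ kernelClass 𝕜 n α)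
    (hf : LocallyIntegrable f volume) :
    ContinuousOn (fun q : Eu n × ℝ => ∫ z, dilate φ q.2 (q.1 - z) * f z) (upperHalfSpace n) := by
  intro q₀ hq₀
  have ht₀ : 0 < q₀.2 := mem_upperHalfSpace.1 hq₀
  refine ContinuousAt.continuousWithinAt ?_
  -- A majorant valid for |y - y₀| < 1 and t₀/2 < t < 2t₀: the supports then stay in this ball and
  -- t^{-n} ≤ (t₀/2)^{-n}.
  have hbd : Integrable (fun z => (closedBall q₀.1 (1 + 2 * q₀.2)).indicator
      (fun z => (3 * ((q₀.2 / 2) ^ n)⁻¹) * ‖f z‖) z) volume := by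
    rw [integrable_indicator_iff measurableSet_closedBall]
    exact ((hf.integrableOn_isCompact (isCompact_closedBall _ _)).norm).const_mul _
  have hnhds : ∀ᶠ q : Eu n × ℝ in nhds q₀, dist q.1 q₀.1 < 1 ∧ q₀.2 / 2 < q.2 ∧ q.2 < 2 * q₀.2 := by
    have h1 : ∀ᶠ q : Eu n × ℝ in nhds q₀, dist q.1 q₀.1 < 1 :=
      (isOpen_lt (by fun_prop) (by fun_prop)).mem_nhds (by simp)
    have h2 : ∀ᶠ q : Eu n × ℝ in nhds q₀, q₀.2 / 2 < q.2 :=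
      (isOpen_lt (by fun_prop) (by fun_prop)).mem_nhds (by simp [ht₀])
    have h3 : ∀ᶠ q : Eu n × ℝ in nhds q₀, q.2 < 2 * q₀.2 :=
      (isOpen_lt (by fun_prop) (by fun_prop)).mem_nhds (show q₀.2 < 2 * q₀.2 by linarith)
    filter_upwards [h1, h2, h3] with q a b c using ⟨a, b, c⟩
  refine continuousAt_of_dominated ?_ ?_ hbd ?_
  · refine Filter.Eventually.of_forall fun q => ?_
    have hc : Continuous fun z => dilate φ q.2 (q.1 - z) :=
      (dilate_continuous hα0 hφ q.2).comp (continuous_const.sub continuous_id)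
    exact hc.aestronglyMeasurable.mul hf.aestronglyMeasurable
  · filter_upwards [hnhds] with q hq
    have ht : 0 < q.2 := by linarith [hq.2.1]
    refine Filter.Eventually.of_forall fun z => ?_
    rw [norm_mul]
    by_cases hz : z ∈ closedBall q₀.1 (1 + 2 * q₀.2)
    · rw [indicator_of_mem hz]
      gcongr
      refine (dilate_norm_le hn hα0 hα1 hφ ht _).trans ?_
      gcongr
      exact hq.2.1.le
    · rw [indicator_of_notMem hz, dilate_eq_zero hφ ht, norm_zero, zero_mul]
      rw [mem_closedBall, not_le] at hz
      rw [← dist_eq_norm]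
      have := dist_triangle z q.1 q₀.1
      rw [dist_comm z q.1] at this
      linarith [hq.1, hq.2.2]
  · refine Filter.Eventually.of_forall fun z => ?_
    have hc := kernel_continuous hα0 hφ
    have : ContinuousAt (fun q : Eu n × ℝ => q.2⁻¹ • (q.1 - z)) q₀ := by
      have h2 : ContinuousAt (fun q : Eu n × ℝ => q.2⁻¹) q₀ :=
        continuousAt_snd.inv₀ ht₀.ne'
      exact h2.smul (by fun_prop)
    have h3 : ContinuousAt (fun q : Eu n × ℝ => (q.2 ^ n)⁻¹) q₀ :=
      (continuousAt_snd.pow n).inv₀ (pow_ne_zero n ht₀.ne')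
    exact (h3.smul (hc.continuousAt.comp this)).mul continuousAt_const

/-- The function `(y, t) ↦ |f * φ_t(y)|` on the upper half space, extended by `0`. -/
def convInd (φ f : Eu n → 𝕜) : Eu n × ℝ → ℝ≥0∞ :=
  (upperHalfSpace n).indicator fun q => ‖∫ z, dilate φ q.2 (q.1 - z) * f z‖ₑ

/-- The function `A_α(f)` on the upper half space, extended by `0`. -/
def maxInd (α : ℝ) (f : Eu n → 𝕜) : Eu n × ℝ → ℝ≥0∞ :=
  (upperHalfSpace n).indicator fun q => maximalConv α f q.1 q.2

lemma maxInd_of_pos (f : Eu n → 𝕜) {q : Eu n × ℝ} (hq : 0 < q.2) :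
    maxInd α f q = maximalConv α f q.1 q.2 := indicator_of_mem (mem_upperHalfSpace.2 hq) _

lemma maxInd_eq_iSup (α : ℝ) (f : Eu n → 𝕜) (q : Eu n × ℝ) :
    maxInd α f q = ⨆ φ ∈ kernelClass 𝕜 n α, convInd φ f q := by
  by_cases hq : q ∈ upperHalfSpace n
  · rw [maxInd, indicator_of_mem hq, maximalConv]
    simp only [convInd, indicator_of_mem hq]
  · rw [maxInd, indicator_of_notMem hq]
    simp [convInd, indicator_of_notMem hq]

/-- A nonnegative continuous function on an open set stays lower semicontinuous when extended by 0.
-/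
lemma lowerSemicontinuous_convInd (hn : 0 < n) (hα0 : 0 < α) (hα1 : α ≤ 1)
    (hφ : φ ∈ kernelClass 𝕜 n α) (hf : LocallyIntegrable f volume) :
    LowerSemicontinuous (convInd φ f) := by
  rw [lowerSemicontinuous_iff_isOpen_preimage]
  intro s
  have h := (continuousOn_conv hn hα0 hα1 hφ hf).enorm.isOpen_inter_preimage
    (isOpen_upperHalfSpace n) (isOpen_Ioi (a := s))
  convert h using 1
  ext q
  by_cases hq : q ∈ upperHalfSpace n
  · simp [convInd, hq]
  · simp [convInd, hq]

/-- Lower semicontinuity survives uncountable suprema, which is how A_α(f) becomes measurable. -/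
lemma lowerSemicontinuous_maxInd (hn : 0 < n) (hα0 : 0 < α) (hα1 : α ≤ 1)
    (hf : LocallyIntegrable f volume) : LowerSemicontinuous (maxInd α f) := by
  rw [show maxInd α f = fun q => ⨆ φ ∈ kernelClass 𝕜 n α, convInd φ f q from
    funext (maxInd_eq_iSup α f)]
  exact lowerSemicontinuous_iSup fun φ => lowerSemicontinuous_iSup fun hφ =>
    lowerSemicontinuous_convInd hn hα0 hα1 hφ hf

lemma measurable_maxInd (hn : 0 < n) (hα0 : 0 < α) (hα1 : α ≤ 1)
    (hf : LocallyIntegrable f volume) : Measurable (maxInd α f) :=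
  (lowerSemicontinuous_maxInd hn hα0 hα1 hf).measurable

/-! ### The function `g*` -/

variable {lam : ℝ}

/-- The weight in the definition of `g*`. -/
def gWeight (n : ℕ) (lam : ℝ) (x : Eu n) (q : Eu n × ℝ) : ℝ≥0∞ :=
  ENNReal.ofReal ((q.2 / (q.2 + ‖x - q.1‖)) ^ (lam * n)) * ENNReal.ofReal ((q.2 ^ (n + 1))⁻¹)

lemma measurable_gWeight (n : ℕ) (lam : ℝ) :
    Measurable fun z : Eu n × (Eu n × ℝ) => gWeight n lam z.1 z.2 := by
  unfold gWeight
  fun_prop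

lemma measurable_gWeight_right (n : ℕ) (lam : ℝ) (x : Eu n) :
    Measurable fun q : Eu n × ℝ => gWeight n lam x q := by
  unfold gWeight
  fun_prop

lemma gStar_eq (lam α : ℝ) (f : Eu n → 𝕜) (x : Eu n) :
    gStar lam α f x =
      (∫⁻ q in upperHalfSpace n, gWeight n lam x q * maxInd α f q ^ 2) ^ (1 / 2 : ℝ) := by
  rw [gStar]
  congr 1
  refine setLIntegral_congr_fun (isOpen_upperHalfSpace n).measurableSet fun q hq => ?_
  simp only [maxInd, indicator_of_mem hq, gWeight]
  ring

lemma gStar_sq (lam α : ℝ) (f : Eu n → 𝕜) (x : Eu n) :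
    gStar lam α f x ^ 2 = ∫⁻ q in upperHalfSpace n, gWeight n lam x q * maxInd α f q ^ 2 := by
  rw [gStar_eq, ← ENNReal.rpow_natCast, ← ENNReal.rpow_mul]
  norm_num

lemma measurable_gStar (hn : 0 < n) (hα0 : 0 < α) (hα1 : α ≤ 1) (lam : ℝ)
    (hf : LocallyIntegrable f volume) : Measurable (gStar lam α f) := by
  rw [show gStar lam α f = fun x => (∫⁻ q in upperHalfSpace n,
    gWeight n lam x q * maxInd α f q ^ 2) ^ (1 / 2 : ℝ) from funext (gStar_eq lam α f)]
  refine Measurable.pow_const ?_ _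
  refine Measurable.lintegral_prod_right' (f := fun z : Eu n × (Eu n × ℝ) =>
    gWeight n lam z.1 z.2 * maxInd α f z.2 ^ 2) ?_
  exact (measurable_gWeight n lam).mul
    (((measurable_maxInd hn hα0 hα1 hf).comp measurable_snd).pow_const 2)

lemma gStar_congr (h : f =ᵐ[volume] f') (x : Eu n) : gStar lam α f x = gStar lam α f' x := by
  rw [gStar, gStar]
  congr 1
  refine setLIntegral_congr_fun (isOpen_upperHalfSpace n).measurableSet fun q hq => ?_
  rw [maximalConv_congr (mem_upperHalfSpace.1 hq) (f' := f')]
  filter_upwards [h] with z hz _ using hz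

/-- `g*` at x is a weighted L² norm of A_α(f), so Minkowski's inequality transfers the countable
subadditivity of A_α. -/
lemma gStar_le_tsum {ι : Type*} [Countable ι] (hn : 0 < n) (hα0 : 0 < α) (hα1 : α ≤ 1)
    {F : ι → Eu n → 𝕜} (hF : ∀ i, LocallyIntegrable (F i) volume)
    (hsum : ∀ᵐ z, HasSum (fun i => F i z) (f z))
    (hfin : ∀ (y : Eu n) (t : ℝ), ∑' i, ∫⁻ z in closedBall y t, ‖F i z‖ₑ ≠ ∞) (x : Eu n) :
    gStar lam α f x ≤ ∑' i, gStar lam α (F i) x := by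
  set μ := volume.restrict (upperHalfSpace n)
  have hw := measurable_gWeight_right n lam x
  have hsq : ∀ a b : ℝ≥0∞, a * b ^ 2 = (a ^ (1 / 2 : ℝ) * b) ^ (2 : ℝ) := by
    intro a b
    rw [ENNReal.mul_rpow_of_nonneg _ _ zero_le_two, ← ENNReal.rpow_mul]
    norm_num
  have hg : ∀ i, gStar lam α (F i) x =
      (∫⁻ q, (gWeight n lam x q ^ (1 / 2 : ℝ) * maxInd α (F i) q) ^ (2 : ℝ) ∂μ) ^ (1 / 2 : ℝ) := by
    intro i
    rw [gStar_eq]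
    congr 1
    exact lintegral_congr fun q => hsq _ _
  simp_rw [hg]
  refine le_trans ?_ (lintegral_rpow_tsum_le one_le_two fun i =>
    ((hw.pow_const _).mul (measurable_maxInd hn hα0 hα1 (hF i))).aemeasurable)
  rw [gStar_eq]
  refine ENNReal.rpow_le_rpow ?_ (by norm_num)
  refine setLIntegral_mono' (isOpen_upperHalfSpace n).measurableSet fun q hq => ?_
  have hq' := mem_upperHalfSpace.1 hq
  rw [hsq, ENNReal.tsum_mul_left]
  refine ENNReal.rpow_le_rpow (mul_le_mul_right ?_ _) zero_le_two
  simp_rw [maxInd_of_pos _ hq']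
  exact maximalConv_le_tsum hn hα0 hα1 (fun i => (hF i).aestronglyMeasurable) hsum hq' (hfin _ _)

end

section

/-! ### Schur's test for `T T*` -/

/-- From 2ab ≤ a² + b²; the two resulting terms agree by the symmetry of H. -/
lemma lintegral_lintegral_mul_mul_le {W : Type*} [MeasurableSpace W] {μ : Measure W} [SFinite μ]
    {F : W → ℝ≥0∞} (hF : Measurable F) {H : W → W → ℝ≥0∞} (hH : Measurable (Function.uncurry H))
    (hsymm : ∀ w w', H w w' = H w' w) {C : ℝ≥0∞} (hC : ∀ w, ∫⁻ w', H w w' ∂μ ≤ C) :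
    ∫⁻ w, ∫⁻ w', F w * F w' * H w w' ∂μ ∂μ ≤ C * ∫⁻ w, F w ^ 2 ∂μ := by
  have h1 : ∫⁻ w, ∫⁻ w', F w ^ 2 * H w w' ∂μ ∂μ ≤ C * ∫⁻ w, F w ^ 2 ∂μ := by
    rw [← lintegral_const_mul _ (hF.pow_const 2)]
    refine lintegral_mono fun w => ?_
    rw [lintegral_const_mul _ hH.of_uncurry_left, mul_comm]
    gcongr
    exact hC w
  have hm : Measurable (Function.uncurry fun w w' => F w ^ 2 * H w w') :=
    ((hF.comp measurable_fst).pow_const 2).mul hH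
  have h2 : ∫⁻ w, ∫⁻ w', F w' ^ 2 * H w w' ∂μ ∂μ = ∫⁻ w, ∫⁻ w', F w ^ 2 * H w w' ∂μ ∂μ := by
    rw [lintegral_lintegral_swap (f := fun w w' => F w ^ 2 * H w w') hm.aemeasurable]
    refine lintegral_congr fun w => lintegral_congr fun w' => ?_
    rw [hsymm]
  have h3 : ∀ a b : ℝ≥0∞, 2 * (a * b) ≤ a ^ 2 + b ^ 2 := by
    intro a b
    rcases le_total a b with h | h
    · obtain ⟨c, rfl⟩ := exists_add_of_le h
      rw [show a ^ 2 + (a + c) ^ 2 = 2 * (a * (a + c)) + c ^ 2 by ring]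
      exact le_self_add
    · obtain ⟨c, rfl⟩ := exists_add_of_le h
      rw [show (b + c) ^ 2 + b ^ 2 = 2 * ((b + c) * b) + c ^ 2 by ring]
      exact le_self_add
  have h4 : 2 * ∫⁻ w, ∫⁻ w', F w * F w' * H w w' ∂μ ∂μ ≤ 2 * (C * ∫⁻ w, F w ^ 2 ∂μ) := by
    calc 2 * ∫⁻ w, ∫⁻ w', F w * F w' * H w w' ∂μ ∂μ
        = ∫⁻ w, ∫⁻ w', 2 * (F w * F w') * H w w' ∂μ ∂μ := by
          rw [← lintegral_const_mul' _ _ (by finiteness)]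
          refine lintegral_congr fun w => ?_
          rw [← lintegral_const_mul' _ _ (by finiteness)]
          refine lintegral_congr fun w' => ?_
          ring
      _ ≤ ∫⁻ w, ∫⁻ w', F w ^ 2 * H w w' + F w' ^ 2 * H w w' ∂μ ∂μ := by
          gcongr with w w'
          rw [← add_mul]
          gcongr
          exact h3 _ _
      _ = ∫⁻ w, ∫⁻ w', F w ^ 2 * H w w' ∂μ ∂μ + ∫⁻ w, ∫⁻ w', F w' ^ 2 * H w w' ∂μ ∂μ := by
          rw [← lintegral_add_left (f := fun w => ∫⁻ w', F w ^ 2 * H w w' ∂μ)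
            hm.lintegral_prod_right']
          refine lintegral_congr fun w => ?_
          exact lintegral_add_left (f := fun w' => F w ^ 2 * H w w') hm.of_uncurry_left _
      _ ≤ 2 * (C * ∫⁻ w, F w ^ 2 ∂μ) := by
          rw [h2, two_mul]
          gcongr
  exact (ENNReal.mul_le_mul_iff_right (by simp) (by simp)).1 h4

lemma le_mul_of_sq_le_mul {a b : ℝ≥0∞} (ha : a ≠ ∞) (h : a ^ 2 ≤ b * a) : a ≤ b := by
  rcases eq_or_ne a 0 with rfl | h0
  · exact zero_le
  · rw [sq] at h
    exact (ENNReal.mul_le_mul_iff_left h0 ha).1 h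

lemma lintegral_mul_sq_le {Z : Type*} [MeasurableSpace Z] {ν : Measure Z} {f g : Z → ℝ≥0∞}
    (hf : AEMeasurable f ν) (hg : AEMeasurable g ν) :
    (∫⁻ z, f z * g z ∂ν) ^ 2 ≤ (∫⁻ z, f z ^ 2 ∂ν) * ∫⁻ z, g z ^ 2 ∂ν := by
  have h := ENNReal.lintegral_mul_le_Lp_mul_Lq ν (p := 2) (q := 2)
    (Real.HolderConjugate.two_two) hf hg
  have h' := pow_le_pow_left₀ zero_le h 2
  rw [mul_pow, ← ENNReal.rpow_natCast, ← ENNReal.rpow_natCast, ← ENNReal.rpow_natCast,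
    ← ENNReal.rpow_mul, ← ENNReal.rpow_mul] at h'
  norm_num at h'
  simpa using h'

lemma lintegral_enorm_sq_eq {X 𝕜 : Type*} [RCLike 𝕜] [MeasurableSpace X] {μ : Measure X}
    {g : X → 𝕜} (hg : Integrable (fun x => ‖g x‖ ^ 2) μ) :
    ∫⁻ x, ‖g x‖ₑ ^ 2 ∂μ = ‖∫ x, conj (g x) * g x ∂μ‖ₑ := by
  have h1 : ∫ x, conj (g x) * g x ∂μ = ((∫ x, ‖g x‖ ^ 2 ∂μ : ℝ) : 𝕜) := by
    rw [← integral_ofReal]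
    refine integral_congr_ae (Filter.Eventually.of_forall fun x => ?_)
    simp [RCLike.conj_mul]
  have h0 : 0 ≤ ∫ x, ‖g x‖ ^ 2 ∂μ := integral_nonneg fun x => by positivity
  rw [h1, ← ofReal_norm, RCLike.norm_ofReal, abs_of_nonneg h0,
    ofReal_integral_eq_lintegral_ofReal hg (Filter.Eventually.of_forall fun x => by positivity)]
  refine lintegral_congr fun x => ?_
  rw [ENNReal.ofReal_pow (norm_nonneg _), ofReal_norm]

/-- The TT* method. With F = Tf and G the conjugate of T*F, one has ‖F‖² = ∫ G f. The kernel of TT*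
is dominated by H, so Schur's test gives ‖G‖² ≤ C‖F‖². Cauchy–Schwarz gives ‖F‖⁴ ≤ C‖F‖²‖f‖², and
one factor ‖F‖² cancels. Bounded kernels and finite measures justify Fubini and make ‖F‖ finite. -/
lemma lintegral_enorm_integral_sq_le {W Z 𝕜 : Type*} [RCLike 𝕜] [MeasurableSpace W]
    [MeasurableSpace Z] {μ : Measure W} {ν : Measure Z} [IsFiniteMeasure μ] [IsFiniteMeasure ν]
    {k : W → Z → 𝕜} (hk : StronglyMeasurable (Function.uncurry k)) {B : ℝ}
    (hB : ∀ w z, ‖k w z‖ ≤ B) {H : W → W → ℝ≥0∞} (hH : Measurable (Function.uncurry H))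
    (hsymm : ∀ w w', H w w' = H w' w) {C : ℝ≥0∞} (hC : ∀ w, ∫⁻ w', H w w' ∂μ ≤ C)
    (hkH : ∀ w w', ‖∫ z, conj (k w z) * k w' z ∂ν‖ₑ ≤ H w w') {f : Z → 𝕜}
    (hfm : StronglyMeasurable f) (hf : Integrable f ν) :
    ∫⁻ w, ‖∫ z, k w z * f z ∂ν‖ₑ ^ 2 ∂μ ≤ C * ∫⁻ z, ‖f z‖ₑ ^ 2 ∂ν := by
  set F : W → 𝕜 := fun w => ∫ z, k w z * f z ∂ν with hF
  have hFm : StronglyMeasurable F :=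
    StronglyMeasurable.integral_prod_right (hk.mul (hfm.comp_measurable measurable_snd))
  have hconj : Continuous (conj : 𝕜 → 𝕜) := RCLike.continuous_conj
  have hB' : ∀ w z, ‖k w z‖ ≤ |B| := fun w z => (hB w z).trans (le_abs_self B)
  set M : ℝ := |B| * ∫ z, ‖f z‖ ∂ν with hM
  have hM0 : 0 ≤ M := by positivity
  have hFM : ∀ w, ‖F w‖ ≤ M := by
    intro w
    rw [hM, ← integral_const_mul]
    refine norm_integral_le_of_norm_le (hf.norm.const_mul _) (Filter.Eventually.of_forall fun z => ?_)
    rw [norm_mul]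
    gcongr
    exact hB' w z
  set G : Z → 𝕜 := fun z => ∫ w, conj (F w) * k w z ∂μ with hG
  have hm1 : StronglyMeasurable (fun p : W × Z => conj (F p.1) * k p.1 p.2) :=
    (hconj.comp_stronglyMeasurable (hFm.comp_measurable measurable_fst)).mul hk
  have hGm : StronglyMeasurable G := StronglyMeasurable.integral_prod_left hm1
  have hGM : ∀ z, ‖G z‖ ≤ M * |B| * μ.real univ := by
    intro z
    refine norm_integral_le_of_norm_le_const (Filter.Eventually.of_forall fun w => ?_)
    rw [norm_mul, RCLike.norm_conj]
    gcongr
    · exact hFM w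
    · exact hB' w z
  have hE : ∫⁻ w, ‖F w‖ₑ ^ 2 ∂μ = ‖∫ z, G z * f z ∂ν‖ₑ := by
    rw [lintegral_enorm_sq_eq]
    · congr 1
      calc ∫ w, conj (F w) * F w ∂μ
          = ∫ w, ∫ z, conj (F w) * k w z * f z ∂ν ∂μ := by
            refine integral_congr_ae (Filter.Eventually.of_forall fun w => ?_)
            simp only [mul_assoc]
            rw [integral_const_mul]
        _ = ∫ z, ∫ w, conj (F w) * k w z * f z ∂μ ∂ν := by
            refine integral_integral_swap ?_
            refine (hf.comp_snd μ).bdd_mul (c := M * |B|) hm1.aestronglyMeasurable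
              (Filter.Eventually.of_forall fun p => ?_)
            rw [norm_mul, RCLike.norm_conj]
            gcongr
            · exact hFM _
            · exact hB' _ _
        _ = ∫ z, G z * f z ∂ν := by
            refine integral_congr_ae (Filter.Eventually.of_forall fun z => ?_)
            exact integral_mul_const _ _
    · refine Integrable.of_bound (hFm.norm.pow 2).aestronglyMeasurable (M ^ 2)
        (Filter.Eventually.of_forall fun w => ?_)
      rw [norm_pow, norm_norm]
      gcongr
      exact hFM w
  have hG2 : ∫⁻ z, ‖G z‖ₑ ^ 2 ∂ν ≤ C * ∫⁻ w, ‖F w‖ₑ ^ 2 ∂μ := by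
    have hm2 : StronglyMeasurable (fun q : Z × (W × W) =>
        (F q.2.1 * conj (k q.2.1 q.1)) * (conj (F q.2.2) * k q.2.2 q.1)) := by
      have hk1 : StronglyMeasurable (fun q : Z × (W × W) => k q.2.1 q.1) :=
        hk.comp_measurable (g := fun q : Z × (W × W) => (q.2.1, q.1)) (by fun_prop)
      have hk2 : StronglyMeasurable (fun q : Z × (W × W) => k q.2.2 q.1) :=
        hk.comp_measurable (g := fun q : Z × (W × W) => (q.2.2, q.1)) (by fun_prop)
      have hF1 : StronglyMeasurable (fun q : Z × (W × W) => F q.2.1) :=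
        hFm.comp_measurable (g := fun q : Z × (W × W) => q.2.1) (by fun_prop)
      have hF2 : StronglyMeasurable (fun q : Z × (W × W) => F q.2.2) :=
        hFm.comp_measurable (g := fun q : Z × (W × W) => q.2.2) (by fun_prop)
      exact (hF1.mul (hconj.comp_stronglyMeasurable hk1)).mul
        ((hconj.comp_stronglyMeasurable hF2).mul hk2)
    rw [lintegral_enorm_sq_eq]
    · calc ‖∫ z, conj (G z) * G z ∂ν‖ₑ
          = ‖∫ z, ∫ p, (F p.1 * conj (k p.1 z)) * (conj (F p.2) * k p.2 z) ∂μ.prod μ ∂ν‖ₑ := by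
            congr 1
            refine integral_congr_ae (Filter.Eventually.of_forall fun z => ?_)
            dsimp only
            rw [integral_prod_mul (fun w => F w * conj (k w z)) (fun w => conj (F w) * k w z)]
            congr 1
            rw [hG, ← integral_conj]
            simp
        _ = ‖∫ p, ∫ z, (F p.1 * conj (k p.1 z)) * (conj (F p.2) * k p.2 z) ∂ν ∂μ.prod μ‖ₑ := by
            congr 1
            refine integral_integral_swap ?_
            refine Integrable.of_bound hm2.aestronglyMeasurable ((M * |B|) * (M * |B|))
              (Filter.Eventually.of_forall fun q => ?_)
            simp only [Function.uncurry, norm_mul, RCLike.norm_conj]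
            gcongr
            · exact hFM _
            · exact hB' _ _
            · exact hFM _
            · exact hB' _ _
        _ ≤ ∫⁻ p, ‖F p.1‖ₑ * ‖F p.2‖ₑ * H p.1 p.2 ∂μ.prod μ := by
            refine (enorm_integral_le_lintegral_enorm _).trans (lintegral_mono fun p => ?_)
            have : ∫ z, (F p.1 * conj (k p.1 z)) * (conj (F p.2) * k p.2 z) ∂ν =
                F p.1 * conj (F p.2) * ∫ z, conj (k p.1 z) * k p.2 z ∂ν := by
              rw [← integral_const_mul]
              refine integral_congr_ae (Filter.Eventually.of_forall fun z => ?_)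
              ring
            rw [this, enorm_mul, enorm_mul, RCLike.enorm_conj]
            gcongr
            exact hkH _ _
        _ = ∫⁻ w, ∫⁻ w', ‖F w‖ₑ * ‖F w'‖ₑ * H w w' ∂μ ∂μ := by
            rw [lintegral_prod]
            exact (((hFm.enorm.comp measurable_fst).mul
              (hFm.enorm.comp measurable_snd)).mul hH).aemeasurable
        _ ≤ C * ∫⁻ w, ‖F w‖ₑ ^ 2 ∂μ := lintegral_lintegral_mul_mul_le hFm.enorm hH hsymm hC
    · refine Integrable.of_bound (hGm.norm.pow 2).aestronglyMeasurable
        ((M * |B| * μ.real univ) ^ 2) (Filter.Eventually.of_forall fun w => ?_)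
      rw [norm_pow, norm_norm]
      gcongr
      exact hGM w
  -- Finiteness is what permits the final cancellation; it is immediate because the quantity is the
  -- norm of a scalar.
  have hEfin : ∫⁻ w, ‖F w‖ₑ ^ 2 ∂μ ≠ ∞ := by
    rw [hE]
    exact enorm_ne_top
  refine le_mul_of_sq_le_mul hEfin ?_
  calc (∫⁻ w, ‖F w‖ₑ ^ 2 ∂μ) ^ 2
      ≤ (∫⁻ z, ‖G z‖ₑ * ‖f z‖ₑ ∂ν) ^ 2 := by
        rw [hE]
        gcongr
        refine (enorm_integral_le_lintegral_enorm _).trans (le_of_eq ?_)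
        simp_rw [enorm_mul]
    _ ≤ (∫⁻ z, ‖G z‖ₑ ^ 2 ∂ν) * ∫⁻ z, ‖f z‖ₑ ^ 2 ∂ν :=
        lintegral_mul_sq_le hGm.enorm.aemeasurable hfm.enorm.aemeasurable
    _ ≤ (C * ∫⁻ w, ‖F w‖ₑ ^ 2 ∂μ) * ∫⁻ z, ‖f z‖ₑ ^ 2 ∂ν := by gcongr
    _ = _ := by ring

/-! ### Almost orthogonality of the kernels -/

variable {𝕜 : Type*} [RCLike 𝕜] {n : ℕ} {α : ℝ} {φ ψ : Eu n → 𝕜}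

lemma integral_dilate (hφ : φ ∈ kernelClass 𝕜 n α) (t : ℝ) (y : Eu n) :
    ∫ z, dilate φ t (y - z) = 0 := by
  rw [integral_sub_left_eq_self (dilate φ t) volume y]
  unfold dilate
  rw [integral_smul, Measure.integral_comp_smul, hφ.2.1, smul_zero, smul_zero]

/-- Since φ has mean value zero, the value of the other kernel at the centre y may be subtracted.
Its Hölder bound over distances at most t gives (t/t')^α, and t^{-n} cancels against the volume of
the ball. -/
lemma norm_integral_dilate_mul_dilate_le (hn : 0 < n) (hα0 : 0 < α) (hα1 : α ≤ 1)
    (hφ : φ ∈ kernelClass 𝕜 n α) (hψ : ψ ∈ kernelClass 𝕜 n α) {t t' : ℝ} (ht : 0 < t)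
    (y y' : Eu n) (ht' : 0 < t') :
    ‖∫ z, conj (dilate φ t (y - z)) * dilate ψ t' (y' - z)‖ ≤
      3 * (unitVol n).toReal * ((t' ^ n)⁻¹ * (t / t') ^ α) := by
  have hc1 : Continuous fun z => dilate φ t (y - z) :=
    (dilate_continuous hα0 hφ t).comp (continuous_const.sub continuous_id)
  have hc2 : Continuous fun z => dilate ψ t' (y' - z) :=
    (dilate_continuous hα0 hψ t').comp (continuous_const.sub continuous_id)
  have hsupp : ∀ z, z ∉ closedBall y t → dilate φ t (y - z) = 0 := by
    intro z hz
    refine dilate_eq_zero hφ ht ?_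
    rw [mem_closedBall, dist_comm, dist_eq_norm, not_le] at hz
    exact hz
  have hcs : HasCompactSupport fun z => conj (dilate φ t (y - z)) :=
    HasCompactSupport.intro (isCompact_closedBall y t) fun z hz => by rw [hsupp z hz, map_zero]
  have hi1 : Integrable (fun z => conj (dilate φ t (y - z))) volume :=
    (RCLike.continuous_conj.comp hc1).integrable_of_hasCompactSupport hcs
  have hi2 : Integrable (fun z => conj (dilate φ t (y - z)) * dilate ψ t' (y' - z)) volume :=
    ((RCLike.continuous_conj.comp hc1).mul hc2).integrable_of_hasCompactSupport hcs.mul_right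
  have h0 : ∫ z, conj (dilate φ t (y - z)) * dilate ψ t' (y' - z) =
      ∫ z, conj (dilate φ t (y - z)) * (dilate ψ t' (y' - z) - dilate ψ t' (y' - y)) := by
    simp_rw [mul_sub]
    rw [integral_sub hi2 (hi1.mul_const _), integral_mul_const, integral_conj,
      integral_dilate hφ, map_zero, zero_mul, sub_zero]
  have h1 : ∀ z, ‖conj (dilate φ t (y - z)) * (dilate ψ t' (y' - z) - dilate ψ t' (y' - y))‖ ≤
      (closedBall y t).indicator
        (fun _ => 3 * (t ^ n)⁻¹ * ((t' ^ n)⁻¹ * (t / t') ^ α)) z := by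
    intro z
    by_cases hz : z ∈ closedBall y t
    · rw [indicator_of_mem hz, norm_mul, RCLike.norm_conj]
      gcongr
      · exact dilate_norm_le hn hα0 hα1 hφ ht _
      · refine (dilate_norm_sub_le hψ ht' _ _).trans ?_
        rw [sub_sub_sub_cancel_left]
        gcongr
        rw [← dist_eq_norm, dist_comm]
        exact hz
    · rw [indicator_of_notMem hz, hsupp z hz, map_zero, zero_mul, norm_zero]
  rw [h0]
  have hib : Integrable (fun z => (closedBall y t).indicator
      (fun _ => 3 * (t ^ n)⁻¹ * ((t' ^ n)⁻¹ * (t / t') ^ α)) z) volume :=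
    (integrable_indicator_iff measurableSet_closedBall).2
      (integrableOn_const measure_closedBall_lt_top.ne)
  refine (norm_integral_le_of_norm_le hib (Filter.Eventually.of_forall h1)).trans (le_of_eq ?_)
  rw [integral_indicator measurableSet_closedBall, setIntegral_const, Measure.real,
    volume_closedBall_eq _ ht.le, ENNReal.toReal_mul, ENNReal.toReal_ofReal (by positivity),
    smul_eq_mul]
  have : t ^ n ≠ 0 := by positivity
  field_simp

lemma integral_dilate_mul_dilate_eq_zero (hφ : φ ∈ kernelClass 𝕜 n α)
    (hψ : ψ ∈ kernelClass 𝕜 n α) {t t' : ℝ} (ht : 0 < t) (ht' : 0 < t') {y y' : Eu n}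
    (h : t + t' < ‖y - y'‖) :
    ∫ z, conj (dilate φ t (y - z)) * dilate ψ t' (y' - z) = 0 := by
  refine integral_eq_zero_of_ae (Filter.Eventually.of_forall fun z => ?_)
  dsimp only [Pi.zero_apply]
  by_cases hz : t < ‖y - z‖
  · rw [dilate_eq_zero hφ ht hz, map_zero, zero_mul]
  · rw [dilate_eq_zero hψ ht', mul_zero]
    have : ‖y - y'‖ ≤ ‖y - z‖ + ‖y' - z‖ := by
      rw [show y - y' = (y - z) - (y' - z) by abel]
      exact norm_sub_le _ _
    linarith

end

section

/-! ### Integrals of powers -/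

lemma lintegral_Ioc_rpow {a : ℝ} (ha : -1 < a) {R : ℝ} (hR : 0 < R) :
    ∫⁻ t in Ioc (0 : ℝ) R, ENNReal.ofReal (t ^ a) = ENNReal.ofReal (R ^ (a + 1) / (a + 1)) := by
  rw [← ofReal_integral_eq_lintegral_ofReal]
  · rw [← intervalIntegral.integral_of_le hR.le, integral_rpow (Or.inl ha),
      Real.zero_rpow (by linarith), sub_zero]
  · exact (intervalIntegrable_iff_integrableOn_Ioc_of_le hR.le).1
      (intervalIntegral.intervalIntegrable_rpow' ha)
  · refine (ae_restrict_iff' measurableSet_Ioc).2 (Filter.Eventually.of_forall fun s hs => ?_)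
    have := hs.1
    positivity

lemma lintegral_Ioi_rpow {a : ℝ} (ha : a < -1) {R : ℝ} (hR : 0 < R) :
    ∫⁻ t in Ioi R, ENNReal.ofReal (t ^ a) = ENNReal.ofReal (-R ^ (a + 1) / (a + 1)) := by
  rw [← ofReal_integral_eq_lintegral_ofReal]
  · rw [integral_Ioi_rpow_of_lt ha hR]
  · exact integrableOn_Ioi_rpow_of_lt ha hR
  · refine (ae_restrict_iff' measurableSet_Ioi).2 (Filter.Eventually.of_forall fun s hs => ?_)
    have : 0 < s := hR.trans hs
    positivity

/-- Splitting at t = R: the integral converges at 0 because b > s and at infinity because s > 0. -/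
lemma lintegral_min_rpow {s b : ℝ} (hs : 0 < s) (hb : s < b) {R : ℝ} (hR : 0 < R) :
    ∫⁻ t in Ioi (0 : ℝ), ENNReal.ofReal (min 1 (t / R) ^ b * t ^ (-s - 1)) =
      ENNReal.ofReal (R ^ (-s) * (1 / (b - s) + 1 / s)) := by
  have hbs : 0 < b - s := by linarith
  rw [← Ioc_union_Ioi_eq_Ioi hR.le, lintegral_union measurableSet_Ioi
    (Ioc_disjoint_Ioi le_rfl), mul_add, ENNReal.ofReal_add (by positivity) (by positivity)]
  congr 1
  · have h : ∀ t ∈ Ioc 0 R, ENNReal.ofReal (min 1 (t / R) ^ b * t ^ (-s - 1)) =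
        ENNReal.ofReal (R ^ (-b)) * ENNReal.ofReal (t ^ (b - s - 1)) := by
      intro t ht
      have ht0 := ht.1
      rw [← ENNReal.ofReal_mul (by positivity), min_eq_right ((div_le_one hR).2 ht.2),
        Real.div_rpow ht0.le hR.le, Real.rpow_neg hR.le,
        show b - s - 1 = b + (-s - 1) by ring, Real.rpow_add ht0]
      congr 1
      ring
    rw [setLIntegral_congr_fun measurableSet_Ioc h, lintegral_const_mul' _ _ (by finiteness),
      lintegral_Ioc_rpow (by linarith) hR, ← ENNReal.ofReal_mul (by positivity), sub_add_cancel,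
      show -s = -b + (b - s) by ring, Real.rpow_add hR]
    congr 1
    ring
  · have h : ∀ t ∈ Ioi R, ENNReal.ofReal (min 1 (t / R) ^ b * t ^ (-s - 1)) =
        ENNReal.ofReal (t ^ (-s - 1)) := by
      intro t ht
      rw [min_eq_left ((one_le_div hR).2 (le_of_lt ht)), Real.one_rpow, one_mul]
    rw [setLIntegral_congr_fun measurableSet_Ioi h, lintegral_Ioi_rpow (by linarith) hR,
      sub_add_cancel]
    congr 1
    field_simp

/-- Integration over the upper half space. -/
lemma lintegral_upperHalfSpace {n : ℕ} {g : Eu n × ℝ → ℝ≥0∞} (hg : Measurable g) :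
    ∫⁻ q in upperHalfSpace n, g q = ∫⁻ t in Ioi (0 : ℝ), ∫⁻ y, g (y, t) := by
  rw [upperHalfSpace, Measure.volume_eq_prod, ← Measure.prod_restrict, Measure.restrict_univ,
    lintegral_prod_symm' _ hg]

/-! ### The `L²` estimate for `A_α` -/

variable {𝕜 : Type*} [RCLike 𝕜] {n : ℕ} {α : ℝ} {f : Eu n → 𝕜}

/-- A bound for the inner products of two kernels. -/
def crossBound (n : ℕ) (α : ℝ) (w w' : Eu n × ℝ) : ℝ≥0∞ :=
  {p : (Eu n × ℝ) × (Eu n × ℝ) | 0 < p.1.2 ∧ 0 < p.2.2 ∧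
      ‖p.1.1 - p.2.1‖ ≤ 2 * max p.1.2 p.2.2}.indicator
    (fun p => ENNReal.ofReal (3 * (unitVol n).toReal * ((max p.1.2 p.2.2 ^ n)⁻¹ *
      (min p.1.2 p.2.2 / max p.1.2 p.2.2) ^ α))) (w, w')

lemma crossBound_symm (w w' : Eu n × ℝ) : crossBound n α w w' = crossBound n α w' w := by
  simp only [crossBound, indicator, mem_ofPred_eq]
  rw [max_comm w.2, min_comm w.2, norm_sub_rev w.1]
  congr 1
  rw [eq_iff_iff]
  tauto

lemma measurable_crossBound : Measurable (Function.uncurry (crossBound n α)) := by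
  have h1 : Measurable fun p : (Eu n × ℝ) × (Eu n × ℝ) =>
      ENNReal.ofReal (3 * (unitVol n).toReal * ((max p.1.2 p.2.2 ^ n)⁻¹ *
      (min p.1.2 p.2.2 / max p.1.2 p.2.2) ^ α)) := by fun_prop
  have h2 : MeasurableSet {p : (Eu n × ℝ) × (Eu n × ℝ) | 0 < p.1.2} :=
    measurableSet_lt (by fun_prop) (by fun_prop)
  have h3 : MeasurableSet {p : (Eu n × ℝ) × (Eu n × ℝ) | 0 < p.2.2} :=
    measurableSet_lt (by fun_prop) (by fun_prop)
  have h4 : MeasurableSet {p : (Eu n × ℝ) × (Eu n × ℝ) |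
      ‖p.1.1 - p.2.1‖ ≤ 2 * max p.1.2 p.2.2} :=
    measurableSet_le (by fun_prop) (by fun_prop)
  exact Measurable.indicator h1 (h2.inter (h3.inter h4))

/-- The Schur constant for dy dt/t. Integrating in y over a ball of radius 2 max(t, t') cancels
max^{-n} and leaves 2^n times the unit volume. Integrating (min/max)^α dt/t then gives 1/α on each
side of t = t'. -/
lemma lintegral_crossBound_le (hα0 : 0 < α) (w : Eu n × ℝ) :
    ∫⁻ w' in upperHalfSpace n, ENNReal.ofReal w'.2⁻¹ * crossBound n α w w' ≤
      ENNReal.ofReal (3 * (unitVol n).toReal * 2 ^ n * (2 / α)) * unitVol n := by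
  rcases le_or_gt w.2 0 with hw | hw
  · have : ∀ w', crossBound n α w w' = 0 := fun w' => indicator_of_notMem (fun h => hw.not_gt h.1) _
    simp [this]
  have hm : Measurable fun w' : Eu n × ℝ => ENNReal.ofReal w'.2⁻¹ * crossBound n α w w' :=
    Measurable.mul (by fun_prop) measurable_crossBound.of_uncurry_left
  have h2 : (2 : ℝ) / α = 1 / (2 * α - α) + 1 / α := by
    field_simp
    norm_num
  have hlast : ENNReal.ofReal (3 * (unitVol n).toReal * 2 ^ n * (2 / α)) =
      ENNReal.ofReal (3 * (unitVol n).toReal * 2 ^ n * w.2 ^ α) *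
        ENNReal.ofReal (w.2 ^ (-α) * (1 / (2 * α - α) + 1 / α)) := by
    rw [← ENNReal.ofReal_mul (by positivity), h2, Real.rpow_neg hw.le]
    congr 1
    field_simp
  rw [lintegral_upperHalfSpace hm, hlast, ← lintegral_min_rpow hα0 (by linarith) hw,
    ← lintegral_const_mul' _ _ (by finiteness),
    ← lintegral_mul_const' _ _ (unitVol_ne_top n)]
  refine setLIntegral_mono' measurableSet_Ioi fun t ht => ?_
  have ht : 0 < t := ht
  have hmax : 0 < max w.2 t := lt_max_of_lt_left hw
  calc ∫⁻ y, ENNReal.ofReal t⁻¹ * crossBound n α w (y, t)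
      ≤ ∫⁻ y, (closedBall w.1 (2 * max w.2 t)).indicator (fun _ => ENNReal.ofReal t⁻¹ *
          ENNReal.ofReal (3 * (unitVol n).toReal * ((max w.2 t ^ n)⁻¹ *
            (min w.2 t / max w.2 t) ^ α))) y := by
        refine lintegral_mono fun y => ?_
        by_cases hy : y ∈ closedBall w.1 (2 * max w.2 t)
        · rw [indicator_of_mem hy]
          gcongr
          exact indicator_le_self _ _ _
        · rw [indicator_of_notMem hy, crossBound, indicator_of_notMem, mul_zero]
          rw [mem_closedBall, dist_comm, dist_eq_norm] at hy
          exact fun h => hy h.2.2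
    _ = ENNReal.ofReal (3 * (unitVol n).toReal * 2 ^ n * w.2 ^ α) *
          ENNReal.ofReal (min 1 (t / w.2) ^ (2 * α) * t ^ (-α - 1)) * unitVol n := by
        rw [lintegral_indicator_const measurableSet_closedBall,
          volume_closedBall_eq _ (by positivity), ← mul_assoc,
          ← ENNReal.ofReal_mul (by positivity), ← ENNReal.ofReal_mul (by positivity),
          ← ENNReal.ofReal_mul (by positivity)]
        congr 2
        have hmn : max w.2 t ^ n ≠ 0 := by positivity
        -- This puts the integrand into the form of `lintegral_min_rpow` with exponents b = 2α and s
        -- = α.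
        have key : (min w.2 t / max w.2 t) ^ α = w.2 ^ α * min 1 (t / w.2) ^ (2 * α) * t ^ (-α) := by
          rcases le_total t w.2 with h | h
          · rw [min_eq_right h, max_eq_left h, min_eq_right ((div_le_one hw).2 h), two_mul,
              Real.rpow_add (by positivity), Real.div_rpow ht.le hw.le, Real.rpow_neg ht.le]
            field_simp
          · rw [min_eq_left h, max_eq_right h, min_eq_left ((one_le_div hw).2 h), Real.one_rpow,
              Real.div_rpow hw.le ht.le, Real.rpow_neg ht.le]
            field_simp
        rw [key, Real.rpow_sub_one ht.ne', mul_pow]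
        field_simp

/-! ### Truncation and linearisation of the supremum over kernels -/

/-- An exhaustion of the upper half space. -/
def truncBox (n N : ℕ) : Set (Eu n × ℝ) := closedBall 0 N ×ˢ Icc ((N : ℝ) + 1)⁻¹ N

lemma measurableSet_truncBox (n N : ℕ) : MeasurableSet (truncBox n N) :=
  measurableSet_closedBall.prod measurableSet_Icc

lemma truncBox_pos {N : ℕ} {q : Eu n × ℝ} (hq : q ∈ truncBox n N) : 0 < q.2 :=
  lt_of_lt_of_le (by positivity) hq.2.1

lemma truncBox_subset (n N : ℕ) : truncBox n N ⊆ upperHalfSpace n :=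
  fun _ hq => mem_upperHalfSpace.2 (truncBox_pos hq)

lemma volume_truncBox_ne_top (n N : ℕ) : volume (truncBox n N) ≠ ∞ := by
  rw [truncBox, Measure.volume_eq_prod, Measure.prod_prod]
  exact ENNReal.mul_ne_top measure_closedBall_lt_top.ne measure_Icc_lt_top.ne

lemma eventually_mem_truncBox {q : Eu n × ℝ} (hq : 0 < q.2) :
    ∀ᶠ N : ℕ in Filter.atTop, q ∈ truncBox n N := by
  have h := tendsto_natCast_atTop_atTop (R := ℝ)
  filter_upwards [h.eventually_ge_atTop ‖q.1‖, h.eventually_ge_atTop q.2,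
    h.eventually_ge_atTop q.2⁻¹] with N h1 h2 h3
  refine ⟨by simpa using h1, ?_, h2⟩
  rw [inv_le_comm₀ (by positivity) hq]
  linarith

/-- With the kernel selected by j, f ↦ f * φ_t(y) is one linear operator, to which TT* applies. The
orthogonality bounds hold for any pair of kernels, so the constant depends neither on j nor on N. -/
lemma lintegral_truncBox_convInd_le (hn : 0 < n) (hα0 : 0 < α) (hα1 : α ≤ 1)
    {φ : ℕ → Eu n → 𝕜} (hφ : ∀ i, φ i ∈ kernelClass 𝕜 n α) {j : Eu n × ℝ → ℕ} (hj : Measurable j)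
    (N : ℕ) (hfm : StronglyMeasurable f) (hf : LocallyIntegrable f volume) :
    ∫⁻ q in truncBox n N, ENNReal.ofReal q.2⁻¹ * convInd (φ (j q)) f q ^ 2 ≤
      ENNReal.ofReal (3 * (unitVol n).toReal * 2 ^ n * (2 / α)) * unitVol n *
        ∫⁻ z, ‖f z‖ₑ ^ 2 := by
  set C := ENNReal.ofReal (3 * (unitVol n).toReal * 2 ^ n * (2 / α)) * unitVol n
  set K := truncBox n N with hK
  -- On the box |y| ≤ N and t ≤ N, so all kernels are supported in this ball.
  set Z := closedBall (0 : Eu n) (2 * N)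
  have hdm : Measurable fun q : Eu n × ℝ => ENNReal.ofReal q.2⁻¹ := by fun_prop
  set μ := (volume.restrict K).withDensity fun q => ENNReal.ofReal q.2⁻¹ with hμ
  have : IsFiniteMeasure μ := by
    refine isFiniteMeasure_withDensity ?_
    refine ne_top_of_le_ne_top (b := ENNReal.ofReal (N + 1) * volume K)
      (ENNReal.mul_ne_top ENNReal.ofReal_ne_top (volume_truncBox_ne_top n N)) ?_
    rw [← setLIntegral_const]
    refine setLIntegral_mono' (measurableSet_truncBox n N) fun q hq => ?_
    refine ENNReal.ofReal_le_ofReal ?_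
    rw [inv_le_comm₀ (truncBox_pos hq) (by positivity)]
    exact hq.2.1
  have : IsFiniteMeasure ((volume : Measure (Eu n)).restrict Z) :=
    ⟨by rw [Measure.restrict_apply_univ]; exact measure_closedBall_lt_top⟩
  set k : Eu n × ℝ → Eu n → 𝕜 :=
    fun w z => K.indicator (fun w => dilate (φ (j w)) w.2 (w.1 - z)) w with hk
  have hkm : StronglyMeasurable (Function.uncurry k) := by
    have h1 : Measurable fun p : ℕ × ((Eu n × ℝ) × Eu n) =>
        dilate (φ p.1) p.2.1.2 (p.2.1.1 - p.2.2) := by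
      refine measurable_from_prod_countable_right fun i => ?_
      have hc := (kernel_continuous hα0 (hφ i)).measurable
      unfold dilate
      exact Measurable.smul (by fun_prop) (hc.comp (by fun_prop))
    have h2 : Measurable fun p : (Eu n × ℝ) × Eu n => dilate (φ (j p.1)) p.1.2 (p.1.1 - p.2) :=
      h1.comp ((hj.comp measurable_fst).prodMk measurable_id)
    exact (h2.indicator (measurable_fst (measurableSet_truncBox n N))).stronglyMeasurable
  have hkB : ∀ w z, ‖k w z‖ ≤ 3 * ((N : ℝ) + 1) ^ n := by
    intro w z
    by_cases hw : w ∈ K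
    · simp only [hk, indicator_of_mem hw]
      have ht := truncBox_pos hw
      refine (dilate_norm_le hn hα0 hα1 (hφ _) ht _).trans ?_
      rw [← inv_pow]
      have h0 : w.2⁻¹ ≤ (N : ℝ) + 1 := by
        rw [inv_le_comm₀ ht (by positivity)]
        exact hw.2.1
      gcongr
    · simp only [hk, indicator_of_notMem hw, norm_zero]
      positivity
  have hsupp : ∀ w ∈ K, ∀ z ∉ Z, dilate (φ (j w)) w.2 (w.1 - z) = 0 := by
    intro w hw z hz
    refine dilate_eq_zero (hφ _) (truncBox_pos hw) ?_
    have h1 : ‖w.1‖ ≤ N := by simpa using hw.1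
    have h2 : w.2 ≤ N := hw.2.2
    have h3 : 2 * N < ‖z‖ := by simpa [Z] using hz
    have h4 : ‖z‖ ≤ ‖w.1‖ + ‖w.1 - z‖ := by
      have := norm_sub_le w.1 (w.1 - z)
      rwa [sub_sub_cancel] at this
    linarith
  have hkH : ∀ w w', ‖∫ z in Z, conj (k w z) * k w' z‖ₑ ≤ crossBound n α w w' := by
    intro w w'
    by_cases hw : w ∈ K
    swap
    · simp [hk, indicator_of_notMem hw]
    by_cases hw' : w' ∈ K
    swap
    · simp [hk, indicator_of_notMem hw']
    have ht := truncBox_pos hw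
    have ht' := truncBox_pos hw'
    simp only [hk, indicator_of_mem hw, indicator_of_mem hw']
    rw [setIntegral_eq_integral_of_forall_compl_eq_zero fun z hz => by
      rw [hsupp w hw z hz, map_zero, zero_mul]]
    by_cases hd : ‖w.1 - w'.1‖ ≤ 2 * max w.2 w'.2
    · rw [crossBound, indicator_of_mem (show (w, w') ∈ {p : (Eu n × ℝ) × (Eu n × ℝ) |
        0 < p.1.2 ∧ 0 < p.2.2 ∧ ‖p.1.1 - p.2.1‖ ≤ 2 * max p.1.2 p.2.2} from ⟨ht, ht', hd⟩),
        ← ofReal_norm]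
      refine ENNReal.ofReal_le_ofReal ?_
      rcases le_total w.2 w'.2 with h | h
      · simp only [max_eq_right h, min_eq_left h]
        exact norm_integral_dilate_mul_dilate_le hn hα0 hα1 (hφ _) (hφ _) ht _ _ ht'
      · simp only [max_eq_left h, min_eq_right h]
        -- Conjugation exchanges the two kernels, so that the one of smaller scale supplies the
        -- cancellation.
        rw [← RCLike.norm_conj, ← integral_conj]
        simp only [map_mul, RCLike.conj_conj, mul_comm (dilate _ w.2 _)]
        exact norm_integral_dilate_mul_dilate_le hn hα0 hα1 (hφ _) (hφ _) ht' _ _ ht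
    · rw [integral_dilate_mul_dilate_eq_zero (hφ _) (hφ _) ht ht', enorm_zero]
      · exact zero_le
      · push Not at hd
        linarith [le_max_left w.2 w'.2, le_max_right w.2 w'.2]
  have hC : ∀ w, ∫⁻ w', crossBound n α w w' ∂μ ≤ C := by
    intro w
    rw [hμ, lintegral_withDensity_eq_lintegral_mul _ hdm measurable_crossBound.of_uncurry_left]
    refine le_trans ?_ (lintegral_crossBound_le hα0 w)
    exact lintegral_mono_set (truncBox_subset n N)
  have hfZ : IntegrableOn f Z volume := hf.integrableOn_isCompact (isCompact_closedBall _ _)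
  have hmain := lintegral_enorm_integral_sq_le hkm hkB measurable_crossBound crossBound_symm hC hkH
    hfm hfZ
  refine le_trans (le_of_eq ?_) (hmain.trans (mul_le_mul_right (setLIntegral_le_lintegral _ _) _))
  have hFm : Measurable fun w => ‖∫ z in Z, k w z * f z‖ₑ ^ 2 :=
    (StronglyMeasurable.integral_prod_right (ν := volume.restrict Z)
      (hkm.mul (hfm.comp_measurable measurable_snd))).enorm.pow_const 2
  rw [hμ, lintegral_withDensity_eq_lintegral_mul _ hdm hFm]
  refine setLIntegral_congr_fun (measurableSet_truncBox n N) fun q hq => ?_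
  simp only [Pi.mul_apply, convInd, indicator_of_mem (truncBox_subset n N hq), hk,
    indicator_of_mem hq]
  rw [setIntegral_eq_integral_of_forall_compl_eq_zero fun z hz => by
      rw [hsupp q hq z hz, zero_mul]]

/-- Induction, comparing the current best with one new function at a time. This selection linearises
the maximum over finitely many kernels. -/
lemma exists_measurable_argmax {X : Type*} [MeasurableSpace X] {a : ℕ → X → ℝ≥0∞}
    (ha : ∀ i, Measurable (a i)) (N : ℕ) :
    ∃ j : X → ℕ, Measurable j ∧ ∀ x, ∀ i ≤ N, a i x ≤ a (j x) x := by
  induction N with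
  | zero => exact ⟨fun _ => 0, measurable_const, fun x i hi => by rw [Nat.le_zero.1 hi]⟩
  | succ N ih =>
    obtain ⟨j, hj, hja⟩ := ih
    have hm : Measurable fun x => a (j x) x := by
      have h1 : Measurable fun p : ℕ × X => a p.1 p.2 := measurable_from_prod_countable_right ha
      exact h1.comp (hj.prodMk measurable_id)
    refine ⟨fun x => if a (j x) x ≤ a (N + 1) x then N + 1 else j x,
      Measurable.ite (measurableSet_le hm (ha _)) measurable_const hj, fun x i hi => ?_⟩
    dsimp only
    split_ifs with h
    · rcases Nat.le_succ_iff.1 hi with h1 | h1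
      · exact (hja x i h1).trans h
      · rw [h1]
    · rcases Nat.le_succ_iff.1 hi with h1 | h1
      · exact hja x i h1
      · rw [h1]
        exact (not_le.1 h).le

/-- The `L²` bound for `A_α`. -/
lemma exists_lintegral_maxInd_sq_le (𝕜 : Type*) [RCLike 𝕜] (hn : 0 < n) (hα0 : 0 < α)
    (hα1 : α ≤ 1) :
    ∃ C : ℝ≥0∞, C ≠ ∞ ∧ ∀ f : Eu n → 𝕜, StronglyMeasurable f → LocallyIntegrable f volume →
      ∫⁻ q in upperHalfSpace n, ENNReal.ofReal q.2⁻¹ * maxInd α f q ^ 2 ≤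
        C * ∫⁻ z, ‖f z‖ₑ ^ 2 := by
  refine ⟨ENNReal.ofReal (3 * (unitVol n).toReal * 2 ^ n * (2 / α)) * unitVol n,
    ENNReal.mul_ne_top ENNReal.ofReal_ne_top (unitVol_ne_top n), fun f hfm hf => ?_⟩
  have hlub : IsLUB ((convInd (n := n) · f) '' kernelClass 𝕜 n α) (maxInd α f) := by
    have : maxInd α f = sSup ((convInd (n := n) · f) '' kernelClass 𝕜 n α) := by
      ext q
      rw [maxInd_eq_iSup, sSup_image, iSup_apply]
      simp_rw [iSup_apply]
    rw [this]
    exact isLUB_sSup _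
  -- A supremum of lower semicontinuous functions is already attained by a countable subfamily. The
  -- zero kernel is added below so that the family is nonempty and can be enumerated.
  obtain ⟨S, hS, hScount, hSlub⟩ := exists_countable_lowerSemicontinuous_isLUB
    (𝓕 := (convInd (n := n) · f) '' kernelClass 𝕜 n α) (by
      rintro _ ⟨φ, hφ, rfl⟩
      exact lowerSemicontinuous_convInd hn hα0 hα1 hφ hf) hlub
  obtain ⟨g, hg⟩ := (hScount.union (countable_singleton (convInd (0 : Eu n → 𝕜) f))).exists_eq_range
    ⟨_, Or.inr rfl⟩
  have hgmem : ∀ i, ∃ φ ∈ kernelClass 𝕜 n α, convInd φ f = g i := by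
    intro i
    have hi : g i ∈ S ∪ {convInd (0 : Eu n → 𝕜) f} := hg ▸ mem_range_self i
    rcases hi with hi | hi
    · exact hS hi
    · exact ⟨0, zero_mem_kernelClass 𝕜 n α, hi.symm⟩
  choose φ hφ hφg using hgmem
  have hsup : ∀ q, maxInd α f q ≤ ⨆ i, convInd (φ i) f q := by
    have : maxInd α f ≤ fun q => ⨆ i, convInd (φ i) f q := by
      refine hSlub.2 fun s hs => ?_
      obtain ⟨i, hi⟩ : s ∈ range g := hg ▸ Or.inl hs
      intro q
      dsimp only
      rw [← hi, ← hφg]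
      exact le_iSup (fun i => convInd (φ i) f q) i
    exact this
  have hcm : ∀ i, Measurable (convInd (φ i) f) := fun i =>
    (lowerSemicontinuous_convInd hn hα0 hα1 (hφ i) hf).measurable
  choose j hj hja using exists_measurable_argmax hcm
  -- The maximum over the first kernels on the N-th box; its lower limit dominates the full
  -- integrand, and Fatou's lemma applies.
  set S' : ℕ → Eu n × ℝ → ℝ≥0∞ := fun N => (truncBox n N).indicator
    fun q => ENNReal.ofReal q.2⁻¹ * convInd (φ (j N q)) f q ^ 2 with hS'
  have hSm : ∀ N, Measurable (S' N) := by
    intro N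
    have h1 : Measurable fun p : ℕ × (Eu n × ℝ) => convInd (φ p.1) f p.2 :=
      measurable_from_prod_countable_right hcm
    have h2 : Measurable fun q => convInd (φ (j N q)) f q := h1.comp ((hj N).prodMk measurable_id)
    exact Measurable.indicator (Measurable.mul (by fun_prop) (h2.pow_const 2))
      (measurableSet_truncBox n N)
  have hpt : ∀ q ∈ upperHalfSpace n, ENNReal.ofReal q.2⁻¹ * maxInd α f q ^ 2 ≤
      Filter.liminf (fun N => S' N q) Filter.atTop := by
    intro q hq
    have h1 : maxInd α f q ^ 2 ≤ ⨆ i, convInd (φ i) f q ^ 2 := by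
      rw [← ENNReal.iSup_pow]
      gcongr
      exact hsup q
    refine (mul_le_mul_right h1 _).trans ?_
    rw [ENNReal.mul_iSup]
    refine iSup_le fun i => ?_
    refine Filter.le_liminf_of_le (by isBoundedDefault) ?_
    filter_upwards [eventually_mem_truncBox (mem_upperHalfSpace.1 hq),
      Filter.eventually_ge_atTop i] with N hN hiN
    simp only [hS', indicator_of_mem hN]
    gcongr
    exact hja N q i hiN
  calc ∫⁻ q in upperHalfSpace n, ENNReal.ofReal q.2⁻¹ * maxInd α f q ^ 2
      ≤ ∫⁻ q in upperHalfSpace n, Filter.liminf (fun N => S' N q) Filter.atTop :=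
        setLIntegral_mono' (isOpen_upperHalfSpace n).measurableSet hpt
    _ ≤ Filter.liminf (fun N => ∫⁻ q in upperHalfSpace n, S' N q) Filter.atTop :=
        lintegral_liminf_le hSm
    _ ≤ _ := by
        refine Filter.liminf_le_of_le (by isBoundedDefault) fun b hb => ?_
        obtain ⟨N, hN⟩ := hb.exists
        refine hN.trans ?_
        refine (setLIntegral_le_lintegral _ _).trans ?_
        rw [hS', lintegral_indicator (measurableSet_truncBox n N)]
        exact lintegral_truncBox_convInd_le hn hα0 hα1 hφ (hj N) N hfm hf

end

section

variable {𝕜 : Type*} [RCLike 𝕜] {n : ℕ} {α lam : ℝ} {f : Eu n → 𝕜}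

/-! ### The weighted `L²` estimate -/

/-- A constant for averages with the weight of `g*`. -/
def avgConst (n : ℕ) (b : ℝ) : ℝ≥0∞ :=
  ∑' k : ℕ, ENNReal.ofReal (((2 : ℝ) ^ k)⁻¹ ^ b * (2 ^ (k + 1)) ^ n) * unitVol n

/-- A geometric series of ratio 2^{n-b}. -/
lemma avgConst_ne_top {b : ℝ} (hb : n < b) : avgConst n b ≠ ∞ := by
  have h : ∀ k : ℕ, ENNReal.ofReal (((2 : ℝ) ^ k)⁻¹ ^ b * (2 ^ (k + 1)) ^ n) =
      2 ^ n * ENNReal.ofReal ((2 : ℝ) ^ ((n : ℝ) - b)) ^ k := by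
    intro k
    rw [← ENNReal.ofReal_pow (by positivity), ← ENNReal.ofReal_ofNat 2,
      ← ENNReal.ofReal_pow (by norm_num), ← ENNReal.ofReal_mul (by positivity)]
    congr 1
    rw [← Real.rpow_natCast (2 ^ ((n : ℝ) - b)) k, ← Real.rpow_mul (by norm_num),
      ← Real.rpow_natCast 2 k, ← Real.rpow_neg (by norm_num), ← Real.rpow_mul (by norm_num),
      pow_succ, mul_pow, ← pow_mul, ← Real.rpow_natCast 2 (k * n), mul_left_comm, ← mul_assoc,
      mul_comm ((2 : ℝ) ^ (n : ℕ)), ← Real.rpow_add (by norm_num), mul_comm _ ((2 : ℝ) ^ n)]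
    have : ((k * n : ℕ) : ℝ) + -(k : ℝ) * b = ((n : ℝ) - b) * k := by
      push_cast
      ring
    rw [this, mul_comm]
  rw [avgConst]
  simp_rw [h]
  rw [ENNReal.tsum_mul_right, ENNReal.tsum_mul_left, ENNReal.tsum_geometric]
  have : ENNReal.ofReal ((2 : ℝ) ^ ((n : ℝ) - b)) < 1 := by
    rw [ENNReal.ofReal_lt_one]
    exact Real.rpow_lt_one_of_one_lt_of_neg (by norm_num) (by linarith)
  have h2 : (1 - ENNReal.ofReal ((2 : ℝ) ^ ((n : ℝ) - b)))⁻¹ ≠ ∞ := by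
    rw [ENNReal.inv_ne_top]
    exact (tsub_pos_of_lt this).ne'
  exact ENNReal.mul_ne_top (ENNReal.mul_ne_top (by finiteness) h2) (unitVol_ne_top n)

lemma avgConst_ne_zero (n : ℕ) (b : ℝ) : avgConst n b ≠ 0 := by
  intro h
  have h0 := ENNReal.tsum_eq_zero.1 h 0
  have : (0 : ℝ) < (2 ^ 0)⁻¹ ^ b * (2 ^ (0 + 1)) ^ n := by positivity
  simp only [mul_eq_zero, ENNReal.ofReal_eq_zero, unitVol_ne_zero, or_false] at h0
  linarith

/-- Where t + |x - y| is about 2^k t the weight is at most 2^{-kb}, and x lies in the ball of radius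
2^{k+1} t about y. These balls contain every x' within t of y, so the maximal function may be taken
at any such x', and hence replaced by its infimum. -/
lemma lintegral_weight_mul_le {b : ℝ} (hb : 0 ≤ b) {w : Eu n → ℝ≥0∞} (hw : Measurable w) {x' y : Eu n} {t : ℝ}
    (ht : 0 < t) (hx' : x' ∈ closedBall y t) :
    ∫⁻ x, ENNReal.ofReal ((t / (t + ‖x - y‖)) ^ b) * w x ≤
      avgConst n b * ENNReal.ofReal (t ^ n) * maximalFn w x' := by
  have hpt : ∀ x, ENNReal.ofReal ((t / (t + ‖x - y‖)) ^ b) * w x ≤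
      ∑' k : ℕ, (ball y (2 ^ (k + 1) * t)).indicator
        (fun x => ENNReal.ofReal (((2 : ℝ) ^ k)⁻¹ ^ b) * w x) x := by
    intro x
    have h1 : 1 ≤ (t + ‖x - y‖) / t := by
      rw [one_le_div ht]
      linarith [norm_nonneg (x - y)]
    obtain ⟨k, hk1, hk2⟩ := exists_nat_pow_near h1 one_lt_two
    refine le_trans ?_ (ENNReal.le_tsum k)
    have hmem : x ∈ ball y (2 ^ (k + 1) * t) := by
      rw [mem_ball, dist_eq_norm]
      rw [div_lt_iff₀ ht] at hk2
      linarith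
    rw [indicator_of_mem hmem]
    gcongr
    rw [← inv_div]
    gcongr
  calc ∫⁻ x, ENNReal.ofReal ((t / (t + ‖x - y‖)) ^ b) * w x
      ≤ ∫⁻ x, ∑' k : ℕ, (ball y (2 ^ (k + 1) * t)).indicator
        (fun x => ENNReal.ofReal (((2 : ℝ) ^ k)⁻¹ ^ b) * w x) x := lintegral_mono hpt
    _ = ∑' k : ℕ, ENNReal.ofReal (((2 : ℝ) ^ k)⁻¹ ^ b) * ∫⁻ x in ball y (2 ^ (k + 1) * t), w x := by
        rw [lintegral_tsum fun k => ((hw.const_mul _).indicator measurableSet_ball).aemeasurable]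
        refine tsum_congr fun k => ?_
        rw [lintegral_indicator measurableSet_ball, lintegral_const_mul _ hw]
    _ ≤ ∑' k : ℕ, ENNReal.ofReal (((2 : ℝ) ^ k)⁻¹ ^ b * (2 ^ (k + 1)) ^ n) * unitVol n *
          ENNReal.ofReal (t ^ n) * maximalFn w x' := by
        refine ENNReal.tsum_le_tsum fun k => ?_
        have hk : x' ∈ ball y (2 ^ (k + 1) * t) := by
          refine mem_ball.2 (lt_of_le_of_lt (mem_closedBall.1 hx') ?_)
          have : (1 : ℝ) < 2 ^ (k + 1) := one_lt_pow₀ one_lt_two (by simp)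
          nlinarith
        refine (mul_le_mul_right (lintegral_ball_le hk) _).trans (le_of_eq ?_)
        rw [mul_pow, ENNReal.ofReal_mul (by positivity), ENNReal.ofReal_mul (by positivity)]
        ring
    _ = _ := by rw [ENNReal.tsum_mul_right, ENNReal.tsum_mul_right, avgConst]

/-! ### Level sets of the maximal function and the weighted inequality -/

lemma isOpen_closedBall_subset {Ω : Set (Eu n)} (hΩ : IsOpen Ω) :
    IsOpen {q : Eu n × ℝ | closedBall q.1 q.2 ⊆ Ω} := by
  rw [isOpen_iff_mem_nhds]
  intro q₀ hq₀
  rcases lt_or_ge q₀.2 0 with h0 | h0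
  · have : ∀ᶠ q : Eu n × ℝ in nhds q₀, q.2 < 0 :=
      (isOpen_lt (by fun_prop) (by fun_prop)).mem_nhds h0
    filter_upwards [this] with q hq
    simp [closedBall_eq_empty.2 hq]
  · obtain ⟨δ, hδ, hsub⟩ := (isCompact_closedBall q₀.1 q₀.2).exists_cthickening_subset_open hΩ hq₀
    rw [cthickening_closedBall hδ.le h0] at hsub
    have : ∀ᶠ q : Eu n × ℝ in nhds q₀, q.2 + dist q.1 q₀.1 < δ + q₀.2 :=
      (isOpen_lt (by fun_prop) (by fun_prop)).mem_nhds
        (show q₀.2 + dist q₀.1 q₀.1 < δ + q₀.2 by rw [dist_self]; linarith)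
    filter_upwards [this] with q hq
    exact (closedBall_subset_closedBall' hq.le).trans hsub

/-- The infimum of the maximal function over the ball `{x | |x - y| ≤ t}`. -/
def infMax (w : Eu n → ℝ≥0∞) (q : Eu n × ℝ) : ℝ≥0∞ := ⨅ x ∈ closedBall q.1 q.2, maximalFn w x

/-- The infimum exceeds s exactly when, for some s' > s, the ball lies in the open set where the
maximal function exceeds s'. This is an open condition on the ball. -/
lemma measurable_infMax (w : Eu n → ℝ≥0∞) : Measurable (infMax w) := by
  refine measurable_of_Ioi fun s => IsOpen.measurableSet ?_
  have : infMax w ⁻¹' Ioi s = ⋃ s' ∈ Ioi s,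
      {q : Eu n × ℝ | closedBall q.1 q.2 ⊆ {x | s' < maximalFn w x}} := by
    ext q
    simp only [mem_preimage, mem_Ioi, mem_iUnion, exists_prop]
    constructor
    · intro h
      obtain ⟨s', h1, h2⟩ := exists_between h
      exact ⟨s', h1, fun x hx => h2.trans_le (iInf₂_le x hx)⟩
    · rintro ⟨s', h1, h2⟩
      exact h1.trans_le (le_iInf₂ fun x hx => (h2 hx).le)
  rw [this]
  exact isOpen_biUnion fun s' _ => isOpen_closedBall_subset (isOpen_lt_maximalFn w s')

/-- Layer cake in the values of `infMax`. If it exceeds s at (y, t), the ball about y lies in Ω =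
{Mw > s}, and by locality f may be replaced there by its restriction to Ω. The L² bound for that
restriction, integrated over s, rebuilds Mw on the right. -/
lemma lintegral_maxInd_mul_infMax_le {C : ℝ≥0∞}
    (hC : ∀ f : Eu n → 𝕜, StronglyMeasurable f → LocallyIntegrable f volume →
      ∫⁻ q in upperHalfSpace n, ENNReal.ofReal q.2⁻¹ * maxInd α f q ^ 2 ≤ C * ∫⁻ z, ‖f z‖ₑ ^ 2)
    (hn : 0 < n) (hα0 : 0 < α) (hα1 : α ≤ 1)
    (hfm : StronglyMeasurable f) (hf : LocallyIntegrable f volume) (w : Eu n → ℝ≥0∞) :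
    ∫⁻ q in upperHalfSpace n, ENNReal.ofReal q.2⁻¹ * maxInd α f q ^ 2 * infMax w q ≤
      C * ∫⁻ z, ‖f z‖ₑ ^ 2 * maximalFn w z := by
  have hlayer : ∀ c : ℝ≥0∞, c = ∫⁻ s in Ioi (0 : ℝ), {s : ℝ | ENNReal.ofReal s < c}.indicator 1 s := by
    intro c
    have h := lintegral_indicator_lt_rpow one_pos c
    rw [ENNReal.rpow_one] at h
    conv_lhs => rw [← h]
    simp only [sub_self, Real.rpow_zero, mul_one, ENNReal.ofReal_one]
    rfl
  have hAm : Measurable fun q : Eu n × ℝ => ENNReal.ofReal q.2⁻¹ * maxInd α f q ^ 2 :=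
    Measurable.mul (by fun_prop) ((measurable_maxInd hn hα0 hα1 hf).pow_const 2)
  calc ∫⁻ q in upperHalfSpace n, ENNReal.ofReal q.2⁻¹ * maxInd α f q ^ 2 * infMax w q
      = ∫⁻ q in upperHalfSpace n, ∫⁻ s in Ioi (0 : ℝ),
          ENNReal.ofReal q.2⁻¹ * maxInd α f q ^ 2 *
            {s : ℝ | ENNReal.ofReal s < infMax w q}.indicator 1 s := by
        refine lintegral_congr fun q => ?_
        rw [lintegral_const_mul, ← hlayer]
        exact measurable_one.indicator (measurableSet_lt (by fun_prop) measurable_const)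
    _ = ∫⁻ s in Ioi (0 : ℝ), ∫⁻ q in upperHalfSpace n,
          ENNReal.ofReal q.2⁻¹ * maxInd α f q ^ 2 *
            {s : ℝ | ENNReal.ofReal s < infMax w q}.indicator 1 s := by
        refine lintegral_lintegral_swap (Measurable.aemeasurable ?_)
        have h1 : MeasurableSet {p : (Eu n × ℝ) × ℝ | ENNReal.ofReal p.2 < infMax w p.1} :=
          measurableSet_lt (by fun_prop) ((measurable_infMax w).comp measurable_fst)
        exact (hAm.comp measurable_fst).mul (measurable_one.indicator h1)
    _ ≤ ∫⁻ s in Ioi (0 : ℝ), C * ∫⁻ z, ‖f z‖ₑ ^ 2 *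
          {s : ℝ | ENNReal.ofReal s < maximalFn w z}.indicator 1 s := by
        refine lintegral_mono fun s => ?_
        set Ω : Set (Eu n) := {z | ENNReal.ofReal s < maximalFn w z}
        have hΩ : MeasurableSet Ω := (isOpen_lt_maximalFn w _).measurableSet
        have h1 := hC (Ω.indicator f) (hfm.indicator hΩ) (hf.indicator hΩ)
        have h2 : ∀ z, ‖Ω.indicator f z‖ₑ ^ 2 = ‖f z‖ₑ ^ 2 *
            {s : ℝ | ENNReal.ofReal s < maximalFn w z}.indicator 1 s := by
          intro z
          by_cases hz : ENNReal.ofReal s < maximalFn w z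
          · rw [indicator_of_mem (show z ∈ Ω from hz), indicator_of_mem (show s ∈
              {s : ℝ | ENNReal.ofReal s < maximalFn w z} from hz), Pi.one_apply, mul_one]
          · rw [indicator_of_notMem (show z ∉ Ω from hz), indicator_of_notMem (show s ∉
              {s : ℝ | ENNReal.ofReal s < maximalFn w z} from hz), mul_zero, enorm_zero]
            norm_num
        simp_rw [h2] at h1
        refine le_trans ?_ h1
        refine setLIntegral_mono' (isOpen_upperHalfSpace n).measurableSet fun q hq => ?_
        by_cases hs : ENNReal.ofReal s < infMax w q
        · rw [indicator_of_mem (show s ∈ {s : ℝ | ENNReal.ofReal s < infMax w q} from hs),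
            Pi.one_apply, mul_one]
          have hq' := mem_upperHalfSpace.1 hq
          rw [maxInd_of_pos _ hq', maxInd_of_pos _ hq', maximalConv_congr hq' (f' := Ω.indicator f)]
          refine Filter.Eventually.of_forall fun z hz => ?_
          exact (indicator_of_mem (show z ∈ Ω from hs.trans_le (iInf₂_le z hz)) _).symm
        · rw [indicator_of_notMem (show s ∉ {s : ℝ | ENNReal.ofReal s < infMax w q} from hs),
            mul_zero]
          exact zero_le
    _ = C * ∫⁻ z, ∫⁻ s in Ioi (0 : ℝ), ‖f z‖ₑ ^ 2 *
          {s : ℝ | ENNReal.ofReal s < maximalFn w z}.indicator 1 s := by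
        have h1 : MeasurableSet {p : ℝ × Eu n | ENNReal.ofReal p.1 < maximalFn w p.2} :=
          measurableSet_lt (by fun_prop) ((measurable_maximalFn w).comp measurable_snd)
        have h2 : Measurable (Function.uncurry fun (s : ℝ) (z : Eu n) => ‖f z‖ₑ ^ 2 *
            {s : ℝ | ENNReal.ofReal s < maximalFn w z}.indicator (1 : ℝ → ℝ≥0∞) s) :=
          ((hfm.enorm.comp measurable_snd).pow_const 2).mul (measurable_one.indicator h1)
        rw [← lintegral_lintegral_swap h2.aemeasurable]
        exact lintegral_const_mul C h2.lintegral_prod_right'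
    _ = C * ∫⁻ z, ‖f z‖ₑ ^ 2 * maximalFn w z := by
        congr 1
        refine lintegral_congr fun z => ?_
        rw [lintegral_const_mul, ← hlayer]
        exact measurable_one.indicator (measurableSet_lt (by fun_prop) measurable_const)

/-- The weighted `L²` inequality of Fefferman–Stein type for `g*`. -/
lemma exists_lintegral_gStar_sq_mul_le (𝕜 : Type*) [RCLike 𝕜] (hn : 0 < n) (hα0 : 0 < α)
    (hα1 : α ≤ 1) (hlam : 1 < lam) :
    ∃ C : ℝ≥0∞, C ≠ ∞ ∧ ∀ f : Eu n → 𝕜, StronglyMeasurable f → LocallyIntegrable f volume →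
      ∀ w : Eu n → ℝ≥0∞, Measurable w →
      ∫⁻ x, gStar lam α f x ^ 2 * w x ≤ C * ∫⁻ z, ‖f z‖ₑ ^ 2 * maximalFn w z := by
  obtain ⟨C, hC, hCf⟩ := exists_lintegral_maxInd_sq_le 𝕜 hn hα0 hα1
  have hb : (n : ℝ) < lam * n := by
    have : (0 : ℝ) < n := by exact_mod_cast hn
    nlinarith
  have hb0 : 0 ≤ lam * n := (Nat.cast_nonneg n).trans hb.le
  refine ⟨avgConst n (lam * n) * C, ENNReal.mul_ne_top (avgConst_ne_top hb) hC,
    fun f hfm hf w hw => ?_⟩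
  have hAm := measurable_maxInd hn hα0 hα1 hf
  have hm : Measurable fun p : Eu n × (Eu n × ℝ) =>
      gWeight n lam p.1 p.2 * maxInd α f p.2 ^ 2 * w p.1 :=
    ((measurable_gWeight n lam).mul ((hAm.comp measurable_snd).pow_const 2)).mul
      (hw.comp measurable_fst)
  calc ∫⁻ x, gStar lam α f x ^ 2 * w x
      = ∫⁻ x, ∫⁻ q in upperHalfSpace n, gWeight n lam x q * maxInd α f q ^ 2 * w x := by
        refine lintegral_congr fun x => ?_
        rw [gStar_sq, lintegral_mul_const]
        exact (measurable_gWeight_right n lam x).mul (hAm.pow_const 2)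
    _ = ∫⁻ q in upperHalfSpace n, ∫⁻ x, gWeight n lam x q * maxInd α f q ^ 2 * w x :=
        lintegral_lintegral_swap hm.aemeasurable
    _ ≤ ∫⁻ q in upperHalfSpace n, avgConst n (lam * n) *
          (ENNReal.ofReal q.2⁻¹ * maxInd α f q ^ 2 * infMax w q) := by
        refine setLIntegral_mono' (isOpen_upperHalfSpace n).measurableSet fun q hq => ?_
        have ht := mem_upperHalfSpace.1 hq
        have hinf : ∫⁻ x, ENNReal.ofReal ((q.2 / (q.2 + ‖x - q.1‖)) ^ (lam * n)) * w x ≤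
            avgConst n (lam * n) * ENNReal.ofReal (q.2 ^ n) * infMax w q := by
          have h0 : avgConst n (lam * n) * ENNReal.ofReal (q.2 ^ n) ≠ 0 :=
            mul_ne_zero (avgConst_ne_zero _ _) (by simp; positivity)
          have h1 : avgConst n (lam * n) * ENNReal.ofReal (q.2 ^ n) ≠ ∞ :=
            ENNReal.mul_ne_top (avgConst_ne_top hb) ENNReal.ofReal_ne_top
          rw [mul_comm (avgConst _ _ * _), ← ENNReal.div_le_iff h0 h1]
          refine le_iInf₂ fun x' hx' => ?_
          rw [ENNReal.div_le_iff h0 h1, mul_comm (maximalFn _ _)]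
          exact lintegral_weight_mul_le hb0 hw ht hx'
        calc ∫⁻ x, gWeight n lam x q * maxInd α f q ^ 2 * w x
            = ENNReal.ofReal ((q.2 ^ (n + 1))⁻¹) * maxInd α f q ^ 2 *
                ∫⁻ x, ENNReal.ofReal ((q.2 / (q.2 + ‖x - q.1‖)) ^ (lam * n)) * w x := by
              rw [← lintegral_const_mul _ (by fun_prop)]
              refine lintegral_congr fun x => ?_
              rw [gWeight]
              ring
          _ ≤ ENNReal.ofReal ((q.2 ^ (n + 1))⁻¹) * maxInd α f q ^ 2 *
                (avgConst n (lam * n) * ENNReal.ofReal (q.2 ^ n) * infMax w q) := by gcongr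
          _ = _ := by
              have : ENNReal.ofReal q.2⁻¹ =
                  ENNReal.ofReal ((q.2 ^ (n + 1))⁻¹) * ENNReal.ofReal (q.2 ^ n) := by
                rw [← ENNReal.ofReal_mul (by positivity)]
                congr 1
                field_simp
                ring
              rw [this]
              ring
    _ ≤ avgConst n (lam * n) * C * ∫⁻ z, ‖f z‖ₑ ^ 2 * maximalFn w z := by
        rw [lintegral_const_mul', mul_assoc]
        · gcongr
          exact lintegral_maxInd_mul_infMax_le hCf hn hα0 hα1 hfm hf w
        · exact avgConst_ne_top hb

/-! ### The `L^p` estimate for `p ≥ 2` -/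

lemma maximalFn_one_le (x : Eu n) : maximalFn (fun _ => 1) x ≤ 1 := by
  refine iSup_le fun c => iSup_le fun r => iSup_le fun h => ?_
  have hr : 0 < r := pos_of_mem_ball h
  rw [setLIntegral_const, one_mul,
    ENNReal.div_self (measure_ball_pos _ _ hr).ne' measure_ball_lt_top.ne]

lemma le_of_le_mul_rpow {a b : ℝ≥0∞} {θ : ℝ} (hθ0 : 0 < θ) (hθ1 : θ < 1) (ha : a ≠ ∞)
    (h : a ≤ b * a ^ (1 - θ)) : a ≤ b ^ (1 / θ) := by
  rcases eq_or_ne a 0 with rfl | h0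
  · exact zero_le
  · have h1 : a ^ θ * a ^ (1 - θ) ≤ b * a ^ (1 - θ) := by
      rw [← ENNReal.rpow_add _ _ h0 ha, add_sub_cancel, ENNReal.rpow_one]
      exact h
    have h2 : a ^ (1 - θ) ≠ 0 := by
      rw [Ne, ENNReal.rpow_eq_zero_iff]
      rintro (⟨h, _⟩ | ⟨h, _⟩)
      · exact h0 h
      · exact ha h
    have h3 : a ^ (1 - θ) ≠ ∞ := ENNReal.rpow_ne_top_of_nonneg (by linarith) ha
    have h4 : a ^ θ ≤ b := (ENNReal.mul_le_mul_iff_left h2 h3).1 h1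
    calc a = (a ^ θ) ^ (1 / θ) := by
          rw [← ENNReal.rpow_mul, mul_one_div_cancel hθ0.ne', ENNReal.rpow_one]
      _ ≤ b ^ (1 / θ) := by gcongr

/-- For p > 2 the weight is `g*(f)^(p-2)` itself. Hölder with p/2 and its conjugate q = p/(p-2), and
the maximal theorem on L^q, bound ∫ g*^p by a constant times ‖f‖_p² (∫ g*^p)^{1-2/p}; the last power
is absorbed. -/
lemma exists_lintegral_gStar_rpow_le_of_two_le (𝕜 : Type*) [RCLike 𝕜] (hn : 0 < n) (hα0 : 0 < α)
    (hα1 : α ≤ 1) (hlam : 1 < lam) {p : ℝ} (hp : 2 ≤ p) :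
    ∃ C : ℝ≥0∞, C ≠ ∞ ∧ ∀ f : Eu n → 𝕜, StronglyMeasurable f → LocallyIntegrable f volume →
      ∫⁻ x, gStar lam α f x ^ p ≤ C * ∫⁻ z, ‖f z‖ₑ ^ p := by
  obtain ⟨C, hC, hCf⟩ := exists_lintegral_gStar_sq_mul_le 𝕜 hn hα0 hα1 hlam
  rcases hp.eq_or_lt with rfl | hp
  · refine ⟨C, hC, fun f hfm hf => ?_⟩
    have h := hCf f hfm hf (fun _ => 1) measurable_const
    simp only [mul_one] at h
    simp only [ENNReal.rpow_ofNat]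
    refine h.trans ?_
    gcongr with z
    calc ‖f z‖ₑ ^ 2 * maximalFn (fun _ => 1) z ≤ ‖f z‖ₑ ^ 2 * 1 := by
          gcongr
          exact maximalFn_one_le z
      _ = ‖f z‖ₑ ^ 2 := mul_one _
  have hp0 : 0 < p := by linarith
  have hp2 : 0 < p - 2 := by linarith
  set q := p / (p - 2) with hq
  have hq1 : 1 < q := by
    rw [hq, one_lt_div hp2]
    linarith
  have hq0 : 0 < q := by linarith
  have hpq : (p / 2).HolderConjugate q := by
    rw [Real.holderConjugate_iff]
    refine ⟨by linarith, ?_⟩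
    rw [hq]
    field_simp
    ring
  obtain ⟨Cq, hCq, hCqw⟩ := exists_lintegral_maximalFn_rpow_le hn hq1
  refine ⟨(C * Cq ^ (1 / q)) ^ (p / 2), by finiteness, fun f hfm hf => ?_⟩
  set F := ∫⁻ z, ‖f z‖ₑ ^ p with hF
  have hgm := measurable_gStar hn hα0 hα1 lam hf
  -- Truncation in height and space makes the integral finite, as the absorption requires; Fatou's
  -- lemma removes it at the end.
  set h : ℕ → Eu n → ℝ≥0∞ := fun N => (ball 0 N).indicator fun x => min (gStar lam α f x) N with hh
  have hhm : ∀ N, Measurable (h N) := fun N =>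
    (hgm.min measurable_const).indicator measurableSet_ball
  have hhg : ∀ N x, h N x ≤ gStar lam α f x := fun N x =>
    (indicator_le_self _ _ _).trans (min_le_left _ _)
  have hfin : ∀ N, ∫⁻ x, h N x ^ p ≠ ∞ := by
    intro N
    refine ne_top_of_le_ne_top (b := (N : ℝ≥0∞) ^ p * volume (ball (0 : Eu n) N))
      (ENNReal.mul_ne_top (by finiteness) measure_ball_lt_top.ne) ?_
    rw [← lintegral_indicator_const measurableSet_ball]
    refine lintegral_mono fun x => ?_
    by_cases hx : x ∈ ball (0 : Eu n) N
    · simp only [hh, indicator_of_mem hx]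
      gcongr
      exact min_le_right _ _
    · simp [hh, indicator_of_notMem hx, hp0]
  have key : ∀ N, ∫⁻ x, h N x ^ p ≤ (C * Cq ^ (1 / q)) ^ (p / 2) * F := by
    intro N
    have hw : Measurable fun x => h N x ^ (p - 2) := (hhm N).pow_const _
    have h1 : ∫⁻ x, h N x ^ p ≤
        C * Cq ^ (1 / q) * F ^ (2 / p) * (∫⁻ x, h N x ^ p) ^ (1 - 2 / p) := by
      calc ∫⁻ x, h N x ^ p
          ≤ ∫⁻ x, gStar lam α f x ^ 2 * h N x ^ (p - 2) := by
            refine lintegral_mono fun x => ?_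
            calc h N x ^ p = h N x ^ (2 : ℝ) * h N x ^ (p - 2) := by
                  rw [← ENNReal.rpow_add_of_nonneg _ _ zero_le_two hp2.le, add_sub_cancel]
              _ ≤ gStar lam α f x ^ 2 * h N x ^ (p - 2) := by
                  rw [ENNReal.rpow_ofNat]
                  gcongr
                  exact hhg N x
        _ ≤ C * ∫⁻ z, ‖f z‖ₑ ^ 2 * maximalFn (fun x => h N x ^ (p - 2)) z := hCf f hfm hf _ hw
        _ ≤ C * ((∫⁻ z, (‖f z‖ₑ ^ 2) ^ (p / 2)) ^ (1 / (p / 2)) *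
              (∫⁻ z, maximalFn (fun x => h N x ^ (p - 2)) z ^ q) ^ (1 / q)) := by
            gcongr
            exact ENNReal.lintegral_mul_le_Lp_mul_Lq _ hpq
              (hfm.enorm.pow_const 2).aemeasurable (measurable_maximalFn _).aemeasurable
        _ ≤ C * (F ^ (2 / p) * (Cq * ∫⁻ x, h N x ^ p) ^ (1 / q)) := by
            have e1 : ∫⁻ z, (‖f z‖ₑ ^ 2) ^ (p / 2) = F := by
              refine lintegral_congr fun z => ?_
              rw [← ENNReal.rpow_natCast, ← ENNReal.rpow_mul]
              congr 1
              push_cast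
              ring
            have e2 : ∫⁻ x, h N x ^ p = ∫⁻ x, (h N x ^ (p - 2)) ^ q := by
              refine lintegral_congr fun z => ?_
              rw [← ENNReal.rpow_mul]
              congr 1
              rw [hq]
              field_simp
            rw [e1, one_div_div, e2]
            gcongr
            exact hCqw _ hw
        _ = _ := by
            rw [ENNReal.mul_rpow_of_nonneg _ _ (by positivity)]
            have : 1 / q = 1 - 2 / p := by
              rw [hq]
              field_simp
            rw [← this]
            ring
    have h2 := le_of_le_mul_rpow (θ := 2 / p) (by positivity) (by rw [div_lt_one hp0]; exact hp)
      (hfin N) h1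
    rw [one_div_div 2 p, ENNReal.mul_rpow_of_nonneg _ _ (by positivity), ← ENNReal.rpow_mul] at h2
    rwa [show 2 / p * (p / 2) = 1 by field_simp, ENNReal.rpow_one] at h2
  calc ∫⁻ x, gStar lam α f x ^ p
      ≤ ∫⁻ x, Filter.liminf (fun N => h N x ^ p) Filter.atTop := by
        refine lintegral_mono fun x => ?_
        have hball : ∀ᶠ N : ℕ in Filter.atTop, x ∈ ball (0 : Eu n) N := by
          filter_upwards [(tendsto_natCast_atTop_atTop (R := ℝ)).eventually_gt_atTop ‖x‖] with N hN
          simpa using hN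
        have h1 : Filter.Tendsto (fun N : ℕ => min (gStar lam α f x) N) Filter.atTop
            (nhds (min (gStar lam α f x) ∞)) :=
          tendsto_const_nhds.min ENNReal.tendsto_nat_nhds_top
        rw [min_top_right] at h1
        have h2 : Filter.Tendsto (fun N : ℕ => h N x ^ p) Filter.atTop
            (nhds (gStar lam α f x ^ p)) := by
          refine ((ENNReal.continuous_rpow_const.tendsto _).comp h1).congr' ?_
          filter_upwards [hball] with N hN
          simp only [hh, indicator_of_mem hN, Function.comp]
        exact h2.liminf_eq.ge
    _ ≤ Filter.liminf (fun N => ∫⁻ x, h N x ^ p) Filter.atTop :=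
        lintegral_liminf_le fun N => (hhm N).pow_const p
    _ ≤ _ := by
        refine Filter.liminf_le_of_le (by isBoundedDefault) fun b hb => ?_
        obtain ⟨N, hN⟩ := hb.exists
        exact hN.trans (key N)

end

section

variable {𝕜 : Type*} [RCLike 𝕜] {n : ℕ} {α lam : ℝ} {f : Eu n → 𝕜}

/-! ### Pointwise decay of `g*` -/

lemma lintegral_weight_le {b : ℝ} (hb : 0 ≤ b) (x : Eu n) {t : ℝ} (ht : 0 < t) :
    ∫⁻ y, ENNReal.ofReal ((t / (t + ‖y - x‖)) ^ b) ≤ avgConst n b * ENNReal.ofReal (t ^ n) := by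
  have h := lintegral_weight_mul_le hb (w := fun _ : Eu n => 1) measurable_const (x' := x) (y := x) ht
    (mem_closedBall_self ht.le)
  simp only [mul_one] at h
  refine h.trans ?_
  calc avgConst n b * ENNReal.ofReal (t ^ n) * maximalFn (fun _ => 1) x
      ≤ avgConst n b * ENNReal.ofReal (t ^ n) * 1 := by
        gcongr
        exact maximalFn_one_le x
    _ = _ := mul_one _

/-- If `A_α(f)(y, t) = O(t^{-n-ε})`, and `A_α(f)(y, t)` vanishes unless `t + |x - y| ≥ R`, then
`g*(f)(x) = O(R^{-n-ε})`. -/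
lemma exists_gStar_le_of_decay (hn : 0 < n) {ε : ℝ} (hε : 0 ≤ ε)
    (hεlam : 4 * ε < (lam - 3) * n) :
    ∃ C : ℝ≥0∞, C ≠ ∞ ∧ ∀ (f : Eu n → 𝕜) (x : Eu n) (R : ℝ) (a : ℝ≥0∞), 0 < R →
      (∀ y t, 0 < t → maximalConv α f y t ≤ a * ENNReal.ofReal (t ^ (-n - ε))) →
      (∀ y t, 0 < t → t + ‖x - y‖ < R → maximalConv α f y t = 0) →
      gStar lam α f x ≤ C * a * ENNReal.ofReal (R ^ (-n - ε)) := by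
  have hn' : (0 : ℝ) < n := by exact_mod_cast hn
  have hlam : 3 < lam := by
    by_contra h
    push Not at h
    nlinarith
  -- The exponent is split as λn = μ + b. Integrability of the weight in y needs μ > n, convergence
  -- at t = 0 needs b > s = 2n + 2ε; the latter is exactly 4ε < (λ - 3)n.
  set μ := (lam - 1) / 2 * n with hμ
  set b := (lam + 1) / 2 * n with hb
  set s := 2 * n + 2 * ε with hs
  have hμn : (n : ℝ) < μ := by rw [hμ]; nlinarith
  have hμ0 : 0 ≤ μ := by linarith
  have hb0 : 0 ≤ b := by rw [hb]; nlinarith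
  have hs0 : 0 < s := by linarith
  have hsb : s < b := by rw [hs, hb]; nlinarith
  have hbs : 0 < b - s := by linarith
  have hμb : lam * n = μ + b := by rw [hμ, hb]; ring
  set c := 1 / (b - s) + 1 / s with hc
  have hc0 : 0 < c := by positivity
  refine ⟨(avgConst n μ * ENNReal.ofReal c) ^ (1 / 2 : ℝ), ?_, fun f x R a hR h1 h2 => ?_⟩
  · have := avgConst_ne_top hμn
    finiteness
  refine (ENNReal.pow_le_pow_left_iff two_ne_zero).1 ?_
  rw [gStar_sq, mul_pow, mul_pow, ← ENNReal.rpow_natCast (_ ^ (1 / 2 : ℝ)), ← ENNReal.rpow_mul,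
    show (1 / 2 : ℝ) * (2 : ℕ) = 1 by norm_num, ENNReal.rpow_one]
  calc ∫⁻ q in upperHalfSpace n, gWeight n lam x q * maxInd α f q ^ 2
      ≤ ∫⁻ q in upperHalfSpace n, ENNReal.ofReal ((q.2 / (q.2 + ‖q.1 - x‖)) ^ μ) *
          (a ^ 2 * ENNReal.ofReal (min 1 (q.2 / R) ^ b * q.2 ^ (-s - 1 - n))) := by
        refine setLIntegral_mono' (isOpen_upperHalfSpace n).measurableSet fun q hq => ?_
        have ht := mem_upperHalfSpace.1 hq
        rw [maxInd_of_pos _ ht]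
        rcases lt_or_ge (q.2 + ‖x - q.1‖) R with hqR | hqR
        · rw [h2 q.1 q.2 ht hqR]
          simp
        · have hd : 0 < q.2 + ‖x - q.1‖ := by positivity
          calc gWeight n lam x q * maximalConv α f q.1 q.2 ^ 2
              ≤ gWeight n lam x q * (a * ENNReal.ofReal (q.2 ^ (-n - ε))) ^ 2 := by
                gcongr
                exact h1 _ _ ht
            _ = a ^ 2 * ENNReal.ofReal ((q.2 / (q.2 + ‖x - q.1‖)) ^ (lam * n) *
                  (q.2 ^ (n + 1))⁻¹ * (q.2 ^ (-n - ε)) ^ 2) := by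
                rw [gWeight, mul_pow, ← ENNReal.ofReal_pow (by positivity),
                  ENNReal.ofReal_mul (by positivity), ENNReal.ofReal_mul (by positivity)]
                ring
            _ ≤ a ^ 2 * ENNReal.ofReal ((q.2 / (q.2 + ‖q.1 - x‖)) ^ μ *
                  (min 1 (q.2 / R) ^ b * q.2 ^ (-s - 1 - n))) := by
                have e1 : (q.2 ^ (n + 1))⁻¹ * (q.2 ^ (-n - ε)) ^ 2 = q.2 ^ (-s - 1 - n) := by
                  rw [← Real.rpow_natCast, ← Real.rpow_natCast, ← Real.rpow_neg ht.le,
                    ← Real.rpow_mul ht.le, ← Real.rpow_add ht]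
                  congr 1
                  rw [hs]
                  push_cast
                  ring
                rw [mul_assoc, e1, hμb, Real.rpow_add (by positivity), norm_sub_rev x q.1, mul_assoc]
                rw [norm_sub_rev] at hqR hd
                gcongr
                -- Only points with t + |x - y| ≥ R contribute, so t/(t + |x - y|) is also at most
                -- t/R.
                refine le_min ?_ ?_
                · rw [div_le_one hd]
                  linarith [norm_nonneg (q.1 - x)]
                · gcongr
            _ = _ := by
                rw [ENNReal.ofReal_mul (by positivity)]
                ring
    _ = ∫⁻ t in Ioi (0 : ℝ), ∫⁻ y : Eu n, ENNReal.ofReal ((t / (t + ‖y - x‖)) ^ μ) *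
          (a ^ 2 * ENNReal.ofReal (min 1 (t / R) ^ b * t ^ (-s - 1 - n))) :=
        lintegral_upperHalfSpace (by fun_prop)
    _ ≤ ∫⁻ t in Ioi (0 : ℝ), a ^ 2 * avgConst n μ *
          ENNReal.ofReal (min 1 (t / R) ^ b * t ^ (-s - 1)) := by
        refine setLIntegral_mono' measurableSet_Ioi fun t ht => ?_
        have ht : 0 < t := ht
        rw [lintegral_mul_const _ (by fun_prop)]
        refine (mul_le_mul_left (lintegral_weight_le hμ0 x ht) _).trans (le_of_eq ?_)
        have e1 : t ^ (-s - 1) = t ^ n * t ^ (-s - 1 - n) := by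
          rw [← Real.rpow_natCast, ← Real.rpow_add ht]
          congr 1
          ring
        rw [e1, mul_left_comm (min 1 (t / R) ^ b), ENNReal.ofReal_mul (p := t ^ n) (by positivity)]
        ring
    _ = a ^ 2 * avgConst n μ * ENNReal.ofReal (R ^ (-s) * c) := by
        rw [lintegral_const_mul _ (by fun_prop), lintegral_min_rpow hs0 hsb hR]
    _ = avgConst n μ * ENNReal.ofReal c * a ^ 2 * ENNReal.ofReal (R ^ (-n - ε)) ^ 2 := by
        rw [← ENNReal.ofReal_pow (by positivity), ← Real.rpow_natCast (R ^ _), ← Real.rpow_mul hR.le,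
          show (-n - ε) * ((2 : ℕ) : ℝ) = -s by rw [hs]; push_cast; ring,
          ENNReal.ofReal_mul (by positivity)]
        ring

lemma maximalConv_eq_zero {y : Eu n} {t : ℝ} (ht : 0 < t) (h : ∀ z ∈ closedBall y t, f z = 0) :
    maximalConv α f y t = 0 := by
  rw [maximalConv_congr ht (f' := 0) (Filter.Eventually.of_forall h)]
  simp [maximalConv]

/-- Now the cancellation is that of f: subtract the kernel's value at c and use its Hölder bound
over the support. -/
lemma maximalConv_le_of_integral_eq_zero (hn : 0 < n) (hα0 : 0 < α) (hα1 : α ≤ 1) {c : Eu n}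
    {ρ : ℝ} (hf : Integrable f volume) (hsupp : ∀ z ∉ closedBall c ρ, f z = 0)
    (h0 : ∫ z, f z = 0) (y : Eu n) {t : ℝ} (ht : 0 < t) :
    maximalConv α f y t ≤ ENNReal.ofReal ((t ^ n)⁻¹ * (ρ / t) ^ α) * ∫⁻ z, ‖f z‖ₑ := by
  refine iSup₂_le fun φ hφ => ?_
  have hc : Continuous fun z => dilate φ t (y - z) :=
    (dilate_continuous hα0 hφ t).comp (continuous_const.sub continuous_id)
  have hi : Integrable (fun z => dilate φ t (y - z) * f z) volume :=
    hf.bdd_mul hc.aestronglyMeasurable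
      (Filter.Eventually.of_forall fun z => dilate_norm_le hn hα0 hα1 hφ ht _)
  have h1 : ∫ z, dilate φ t (y - z) * f z =
      ∫ z, (dilate φ t (y - z) - dilate φ t (y - c)) * f z := by
    simp_rw [sub_mul]
    rw [integral_sub hi (hf.const_mul _), integral_const_mul, h0, mul_zero, sub_zero]
  rw [h1, ← lintegral_const_mul' _ _ (by finiteness)]
  refine (enorm_integral_le_lintegral_enorm _).trans (lintegral_mono fun z => ?_)
  dsimp only
  by_cases hz : z ∈ closedBall c ρ
  · rw [enorm_mul]
    gcongr
    rw [← ofReal_norm]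
    refine ENNReal.ofReal_le_ofReal ((dilate_norm_sub_le hφ ht _ _).trans ?_)
    rw [sub_sub_sub_cancel_left]
    gcongr
    rw [← dist_eq_norm, dist_comm]
    exact hz
  · rw [hsupp z hz, mul_zero, enorm_zero]
    exact zero_le

/-- Functions with mean value zero that are supported in a ball. -/
lemma exists_lintegral_gStar_le_of_integral_eq_zero (𝕜 : Type*) [RCLike 𝕜] (hn : 0 < n)
    (hα0 : 0 < α) (hα1 : α ≤ 1) (hlam : 3 < lam) :
    ∃ C : ℝ≥0∞, C ≠ ∞ ∧ ∀ (f : Eu n → 𝕜) (c : Eu n) (ρ : ℝ), 0 < ρ → Integrable f volume →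
      (∀ z ∉ closedBall c ρ, f z = 0) → ∫ z, f z = 0 →
      ∫⁻ x in {x | 2 * ρ ≤ dist x c}, gStar lam α f x ≤ C * ∫⁻ z, ‖f z‖ₑ := by
  have hn' : (0 : ℝ) < n := by exact_mod_cast hn
  have hln : 0 < (lam - 3) * n := mul_pos (by linarith) hn'
  -- The extra decay is limited by the Hölder exponent and by the requirement 4ε < (λ - 3)n.
  set ε := min α ((lam - 3) * n / 8) with hε
  have hε0 : 0 < ε := lt_min hα0 (by linarith)
  have hεα : ε ≤ α := min_le_left _ _
  have hεl : 4 * ε < (lam - 3) * n := by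
    have := min_le_right α ((lam - 3) * n / 8)
    linarith
  obtain ⟨C, hC, hCf⟩ := exists_gStar_le_of_decay (𝕜 := 𝕜) (α := α) hn hε0.le hεl
  refine ⟨C * 3 * ENNReal.ofReal (3 ^ (n + ε)) * avgConst n (n + ε), ?_,
    fun f c ρ hρ hf hsupp h0 => ?_⟩
  · have := avgConst_ne_top (n := n) (b := n + ε) (by linarith)
    finiteness
  set I := ∫⁻ z, ‖f z‖ₑ with hI
  have hA : ∀ y t, 0 < t → maximalConv α f y t ≤
      (3 * ENNReal.ofReal (ρ ^ ε) * I) * ENNReal.ofReal (t ^ (-n - ε)) := by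
    intro y t ht
    have e1 : 3 * ENNReal.ofReal (ρ ^ ε) * I * ENNReal.ofReal (t ^ (-n - ε)) =
        ENNReal.ofReal (3 * ((t ^ n)⁻¹ * (ρ / t) ^ ε)) * I := by
      have : (t ^ n)⁻¹ * (ρ / t) ^ ε = ρ ^ ε * t ^ (-n - ε) := by
        rw [Real.rpow_sub ht, Real.rpow_neg ht.le, Real.rpow_natCast, Real.div_rpow hρ.le ht.le]
        ring
      rw [this, ENNReal.ofReal_mul (by norm_num), ENNReal.ofReal_mul (by positivity),
        ENNReal.ofReal_ofNat]
      ring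
    rw [e1]
    -- At large scales cancellation gives (ρ/t)^α ≤ (ρ/t)^ε. At small scales the size bound
    -- suffices, as (ρ/t)^ε ≥ 1.
    rcases le_or_gt ρ t with h | h
    · refine (maximalConv_le_of_integral_eq_zero hn hα0 hα1 hf hsupp h0 y ht).trans ?_
      refine mul_le_mul_left (ENNReal.ofReal_le_ofReal ?_) _
      have h1 : (ρ / t) ^ α ≤ (ρ / t) ^ ε :=
        Real.rpow_le_rpow_of_exponent_ge (by positivity) ((div_le_one ht).2 h) hεα
      have h2 : (t ^ n)⁻¹ * (ρ / t) ^ α ≤ (t ^ n)⁻¹ * (ρ / t) ^ ε := by gcongr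
      have h3 : 0 ≤ (t ^ n)⁻¹ * (ρ / t) ^ ε := by positivity
      linarith
    · refine (maximalConv_le hn hα0 hα1 f y ht).trans ?_
      have h1 : 1 ≤ (ρ / t) ^ ε := Real.one_le_rpow ((one_le_div ht).2 h.le) hε0.le
      gcongr
      · exact le_mul_of_one_le_right (by positivity) h1
      · exact setLIntegral_le_lintegral _ _
  have hpt : ∀ x ∈ {x | 2 * ρ ≤ dist x c}, gStar lam α f x ≤
      C * (3 * I) * ENNReal.ofReal (3 ^ (n + ε) * (ρ ^ n)⁻¹) *
        ENNReal.ofReal ((ρ / (ρ + ‖x - c‖)) ^ (n + ε)) := by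
    intro x hx
    have hx : 2 * ρ ≤ dist x c := hx
    have hd : 0 < dist x c := by linarith
    -- A ball about y of radius t that meets the support has t + |x - y| ≥ |x - c| - ρ ≥ |x - c|/2.
    refine (hCf f x (dist x c / 2) _ (by positivity) hA fun y t ht hty => ?_).trans ?_
    · refine maximalConv_eq_zero ht fun z hz => hsupp z fun hzc => ?_
      have h1 := dist_triangle x z c
      have h2 := dist_triangle x y z
      rw [dist_comm y z] at h2
      rw [← dist_eq_norm] at hty
      linarith [mem_closedBall.1 hz, mem_closedBall.1 hzc]
    · rw [mul_assoc C, mul_assoc C, mul_assoc C]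
      refine mul_le_mul_right ?_ C
      rw [show ∀ u v : ℝ≥0∞, 3 * u * I * v = 3 * I * (u * v) from fun u v => by ring,
        mul_assoc (3 * I), ← ENNReal.ofReal_mul (by positivity), ← ENNReal.ofReal_mul (by positivity)]
      refine mul_le_mul_right (ENNReal.ofReal_le_ofReal ?_) _
      rw [← dist_eq_norm]
      -- Here |x - c| ≥ 2ρ enters; the decay becomes a multiple of the weight with exponent n + ε,
      -- which is integrable because ε > 0.
      have h1 : (dist x c / 2) ^ (-n - ε) ≤ ((ρ + dist x c) / 3) ^ (-n - ε) :=
        Real.rpow_le_rpow_of_nonpos (by positivity) (by linarith) (by linarith)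
      refine (mul_le_mul_of_nonneg_left h1 (by positivity)).trans (le_of_eq ?_)
      have hpos : 0 < ρ + dist x c := by positivity
      rw [show -n - ε = -(n + ε) by ring, Real.rpow_neg (by positivity),
        Real.div_rpow hpos.le (by norm_num), Real.div_rpow hρ.le hpos.le, Real.rpow_add hρ,
        Real.rpow_natCast]
      have : ρ ^ n ≠ 0 := by positivity
      field_simp
  have hm : MeasurableSet {x | 2 * ρ ≤ dist x c} := measurableSet_le (by fun_prop) (by fun_prop)
  calc ∫⁻ x in {x | 2 * ρ ≤ dist x c}, gStar lam α f x
      ≤ ∫⁻ x, C * (3 * I) * ENNReal.ofReal (3 ^ (n + ε) * (ρ ^ n)⁻¹) *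
        ENNReal.ofReal ((ρ / (ρ + ‖x - c‖)) ^ (n + ε)) :=
        (setLIntegral_mono' hm hpt).trans (setLIntegral_le_lintegral _ _)
    _ ≤ C * (3 * I) * ENNReal.ofReal (3 ^ (n + ε) * (ρ ^ n)⁻¹) *
          (avgConst n (n + ε) * ENNReal.ofReal (ρ ^ n)) := by
        rw [lintegral_const_mul _ (by fun_prop)]
        gcongr
        exact lintegral_weight_le (by positivity) c hρ
    _ = _ := by
        have e : ENNReal.ofReal (3 ^ (n + ε)) =
            ENNReal.ofReal (3 ^ (n + ε) * (ρ ^ n)⁻¹) * ENNReal.ofReal (ρ ^ n) := by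
          rw [← ENNReal.ofReal_mul (by positivity)]
          congr 1
          have : ρ ^ n ≠ 0 := by positivity
          field_simp
        rw [e]
        ring

end

section

variable {𝕜 : Type*} [RCLike 𝕜] {n : ℕ} {α lam : ℝ} {f : Eu n → 𝕜}

/-! ### A Whitney type decomposition -/

lemma volume_univ_eq_top (hn : 0 < n) : volume (univ : Set (Eu n)) = ∞ := by
  have : Nonempty (Fin n) := ⟨⟨0, hn⟩⟩
  exact measure_univ_of_isAddLeftInvariant _

/-- Vitali's lemma selects disjoint core balls whose fivefold enlargements cover Ω. Removing from
each enlargement the other cores, and then the earlier sets in an enumeration, makes the pieces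
disjoint while each keeps its own core. -/
lemma exists_whitney (hn : 0 < n) {Ω : Set (Eu n)} (hΩ : IsOpen Ω) (hvol : volume Ω ≠ ∞) :
    ∃ (u : Set (Eu n)) (r : Eu n → ℝ) (Q : Eu n → Set (Eu n)), u.Countable ∧
      (∀ b ∈ u, 0 < r b) ∧ (∀ b ∈ u, MeasurableSet (Q b)) ∧ (∀ b ∈ u, ball b (r b) ⊆ Q b) ∧
      (∀ b ∈ u, Q b ⊆ ball b (5 * r b)) ∧ (∀ b ∈ u, ball b (20 * r b) ⊆ Ω) ∧
      (∀ b ∈ u, ∃ z ∉ Ω, dist z b < 25 * r b) ∧ u.PairwiseDisjoint Q ∧ ⋃ b ∈ u, Q b = Ω := by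
  have hne : Ωᶜ.Nonempty := by
    rw [nonempty_compl]
    rintro rfl
    exact hvol (volume_univ_eq_top hn)
  have hcl : IsClosed Ωᶜ := hΩ.isClosed_compl
  -- The 20-fold ball stays in Ω but the complement has a point at distance 20r. Later 20 ≥ 2 · 5
  -- puts points outside Ω beyond the doubled fivefold ball.
  set r : Eu n → ℝ := fun b => infDist b Ωᶜ / 20 with hr
  have hrpos : ∀ b ∈ Ω, 0 < r b := by
    intro b hb
    have := (hcl.notMem_iff_infDist_pos hne).1 (fun h => h hb)
    positivity
  have hball : ∀ b, ball b (20 * r b) ⊆ Ω := by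
    intro b
    rw [hr, mul_div_cancel₀ _ (by norm_num)]
    exact ball_infDist_compl_subset
  set K := volume Ω / unitVol n with hK
  have hKtop : K ≠ ∞ := ENNReal.div_ne_top hvol (unitVol_ne_zero n)
  have hrad : ∀ a ∈ Ω, r a ≤ max 1 K.toReal := by
    intro a ha
    rcases le_or_gt (r a) 1 with h1 | h1
    · exact h1.trans (le_max_left _ _)
    · refine le_trans ?_ (le_max_right _ _)
      have h2 : ENNReal.ofReal (r a ^ n) ≤ K := by
        rw [hK, ENNReal.le_div_iff_mul_le (Or.inl (unitVol_ne_zero n)) (Or.inl (unitVol_ne_top n)),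
          ← volume_ball_eq a (hrpos a ha)]
        refine measure_mono ((ball_subset_ball ?_).trans (hball a))
        linarith
      exact (le_self_pow₀ h1.le hn.ne').trans ((ENNReal.ofReal_le_iff_le_toReal hKtop).1 h2)
  obtain ⟨u, huΩ, hdisj, hcov⟩ := Vitali.exists_disjoint_subfamily_covering_enlargement_ball Ω
    (fun a => a) r _ hrad 5 (by norm_num)
  have hu : u.Countable := hdisj.countable_of_isOpen (fun _ _ => isOpen_ball)
    (fun a ha => nonempty_ball.2 (hrpos a (huΩ ha)))
  obtain ⟨e, he⟩ := countable_iff_exists_injOn.1 hu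
  set A : Eu n → Set (Eu n) := fun b => ball b (5 * r b) \ ⋃ c ∈ u \ {b}, ball c (r c) with hA
  have hAm : ∀ b, MeasurableSet (A b) := fun b => measurableSet_ball.diff
    (MeasurableSet.biUnion (hu.mono sdiff_subset) fun _ _ => measurableSet_ball)
  set Q : Eu n → Set (Eu n) := fun b => A b \ ⋃ c ∈ {c ∈ u | e c < e b}, A c with hQ
  have hAcov : ∀ x ∈ Ω, ∃ b ∈ u, x ∈ A b := by
    intro x hx
    by_cases h : ∃ c ∈ u, x ∈ ball c (r c)
    · obtain ⟨c, hc, hxc⟩ := h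
      refine ⟨c, hc, ball_subset_ball (by linarith [hrpos c (huΩ hc)]) hxc, ?_⟩
      simp only [mem_iUnion, not_exists]
      intro c' hc' hxc'
      exact (hdisj hc hc'.1 (fun h => hc'.2 h.symm)).le_bot ⟨hxc, hxc'⟩
    · push Not at h
      obtain ⟨b, hb, hsub⟩ := hcov x hx
      refine ⟨b, hb, hsub (mem_ball_self (hrpos x hx)), ?_⟩
      simp only [mem_iUnion, not_exists]
      intro c hc hxc
      exact h c hc.1 hxc
  have hQ5 : ∀ b, Q b ⊆ ball b (5 * r b) := fun b x hx => hx.1.1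
  refine ⟨u, r, Q, hu, fun b hb => hrpos b (huΩ hb), fun b _ => (hAm b).diff
    (MeasurableSet.biUnion (hu.mono fun c hc => hc.1) fun c _ => hAm c), ?_, fun b _ => hQ5 b,
    fun b _ => hball b, ?_, ?_, ?_⟩
  · intro b hb x hx
    refine ⟨⟨ball_subset_ball (by linarith [hrpos b (huΩ hb)]) hx, ?_⟩, ?_⟩
    · simp only [mem_iUnion, not_exists]
      intro c hc hxc
      exact (hdisj hb hc.1 (fun h => hc.2 h.symm)).le_bot ⟨hx, hxc⟩
    · simp only [mem_iUnion, not_exists]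
      intro c hc hxc
      refine hxc.2 (mem_biUnion (x := b) ⟨hb, ?_⟩ hx)
      rintro rfl
      exact lt_irrefl _ hc.2
  · intro b hb
    obtain ⟨z, hz, hdz⟩ := hcl.exists_infDist_eq_dist hne b
    refine ⟨z, hz, ?_⟩
    have := hrpos b (huΩ hb)
    rw [dist_comm, ← hdz]
    simp only [hr] at this ⊢
    linarith
  · intro b hb c hc hbc
    refine disjoint_left.2 fun x hxb hxc => ?_
    rcases lt_trichotomy (e b) (e c) with h | h | h
    · exact hxc.2 (mem_biUnion (x := b) ⟨hb, h⟩ hxb.1)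
    · exact hbc (he hb hc h)
    · exact hxb.2 (mem_biUnion (x := c) ⟨hc, h⟩ hxc.1)
  · refine Subset.antisymm (iUnion₂_subset fun b hb x hx => ?_) fun x hx => ?_
    · exact hball b (ball_subset_ball (by linarith [hrpos b (huΩ hb)]) (hQ5 b hx))
    · obtain ⟨b₀, hb₀⟩ := hAcov x hx
      -- The piece containing x is the one of the first A-set that contains it.
      obtain ⟨b, hb, hmin⟩ := (measure e).wf.has_min {b | b ∈ u ∧ x ∈ A b} ⟨b₀, hb₀⟩
      refine mem_biUnion hb.1 ⟨hb.2, ?_⟩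
      simp only [mem_iUnion, not_exists]
      intro c hc hxc
      exact hmin c ⟨hc.1, hxc⟩ hc.2

/-! ### The Calderón–Zygmund decomposition -/

lemma enorm_setAverage_mul_le {Q : Set (Eu n)} (hQ : volume Q ≠ ∞) (f : Eu n → 𝕜) :
    ‖⨍ z in Q, f z‖ₑ * volume Q ≤ ∫⁻ z in Q, ‖f z‖ₑ := by
  have h := congrArg (fun v => ‖v‖ₑ) (measure_smul_setAverage (μ := volume) f hQ)
  simp only [enorm_smul] at h
  rw [Real.enorm_of_nonneg measureReal_nonneg, Measure.real, ENNReal.ofReal_toReal hQ] at h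
  rw [mul_comm, h]
  exact enorm_integral_le_lintegral_enorm _

/-- The Calderón–Zygmund decomposition of `f` at height `s`. -/
lemma exists_calderonZygmund (hn : 0 < n) (hfm : StronglyMeasurable f)
    (hf : LocallyIntegrable f volume) {s : ℝ≥0∞} (hs : s ≠ ∞)
    (hvol : volume {x | s < maximalFn (fun z => ‖f z‖ₑ) x} ≠ ∞) :
    ∃ (u : Set (Eu n)) (r : Eu n → ℝ) (β : Eu n → Eu n → 𝕜) (g : Eu n → 𝕜), u.Countable ∧
      (∀ b ∈ u, 0 < r b) ∧
      (∀ b ∈ u, ball b (20 * r b) ⊆ {x | s < maximalFn (fun z => ‖f z‖ₑ) x}) ∧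
      (∀ b ∈ u, Integrable (β b) volume) ∧ (∀ b ∈ u, ∀ z ∉ closedBall b (5 * r b), β b z = 0) ∧
      (∀ b ∈ u, ∫ z, β b z = 0) ∧
      ∑' b : u, ∫⁻ z, ‖β b z‖ₑ ≤
        2 * 25 ^ n * s * volume {x | s < maximalFn (fun z => ‖f z‖ₑ) x} ∧
      StronglyMeasurable g ∧ LocallyIntegrable g volume ∧
      (∀ z, HasSum (fun b : u => β b z) (f z - g z)) ∧
      ∫⁻ z, ‖g z‖ₑ ^ 2 ≤ (∫⁻ z in {x | maximalFn (fun z => ‖f z‖ₑ) x ≤ s}, ‖f z‖ₑ ^ 2) +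
        (25 ^ n * s) ^ 2 * volume {x | s < maximalFn (fun z => ‖f z‖ₑ) x} := by
  classical
  set Ω := {x | s < maximalFn (fun z => ‖f z‖ₑ) x} with hΩdef
  have hΩ : IsOpen Ω := isOpen_lt_maximalFn _ s
  obtain ⟨u, r, Q, hu, hr, hQm, hrQ, hQ5, h20, h25, hdisj, hcov⟩ := exists_whitney hn hΩ hvol
  have : Countable u := hu.to_subtype
  have hQΩ : ∀ b ∈ u, Q b ⊆ Ω := fun b hb => hcov ▸ subset_biUnion_of_mem hb
  have hQfin : ∀ b ∈ u, volume (Q b) ≠ ∞ := fun b hb =>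
    ne_top_of_le_ne_top hvol (measure_mono (hQΩ b hb))
  have hQpos : ∀ b ∈ u, volume (Q b) ≠ 0 := fun b hb h =>
    (measure_ball_pos volume b (hr b hb)).ne' (measure_mono_null (hrQ b hb) h)
  -- The 25-fold ball contains a point where the maximal function is at most s, and Q contains the
  -- core ball of comparable volume.
  have hfQ : ∀ b ∈ u, ∫⁻ z in Q b, ‖f z‖ₑ ≤ 25 ^ n * s * volume (Q b) := by
    intro b hb
    obtain ⟨z, hz, hzb⟩ := h25 b hb
    have hrb := hr b hb
    calc ∫⁻ z in Q b, ‖f z‖ₑ ≤ ∫⁻ z in ball b (25 * r b), ‖f z‖ₑ :=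
          lintegral_mono_set ((hQ5 b hb).trans (ball_subset_ball (by linarith)))
      _ ≤ maximalFn (fun z => ‖f z‖ₑ) z * (ENNReal.ofReal ((25 * r b) ^ n) * unitVol n) :=
          lintegral_ball_le hzb
      _ ≤ s * (ENNReal.ofReal ((25 * r b) ^ n) * unitVol n) := by
          gcongr
          exact not_lt.1 hz
      _ = 25 ^ n * s * volume (ball b (r b)) := by
          rw [volume_ball_eq _ hrb, mul_pow, ENNReal.ofReal_mul (by positivity),
            ENNReal.ofReal_pow (by norm_num), ENNReal.ofReal_ofNat]
          ring
      _ ≤ 25 ^ n * s * volume (Q b) := by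
          gcongr
          exact hrQ b hb
  set m : Eu n → 𝕜 := fun b => ⨍ z in Q b, f z with hm
  have hmb : ∀ b ∈ u, ‖m b‖ₑ * volume (Q b) ≤ ∫⁻ z in Q b, ‖f z‖ₑ := fun b hb =>
    enorm_setAverage_mul_le (hQfin b hb) f
  have hms : ∀ b ∈ u, ‖m b‖ₑ ≤ 25 ^ n * s := fun b hb =>
    (ENNReal.mul_le_mul_iff_left (hQpos b hb) (hQfin b hb)).1 ((hmb b hb).trans (hfQ b hb))
  have hfint : ∀ b ∈ u, IntegrableOn f (Q b) volume := fun b hb =>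
    (hf.integrableOn_isCompact (isCompact_closedBall b (5 * r b))).mono_set
      ((hQ5 b hb).trans ball_subset_closedBall)
  set β : Eu n → Eu n → 𝕜 := fun b => (Q b).indicator fun z => f z - m b with hβ
  have hβsm : ∀ b ∈ u, StronglyMeasurable (β b) := fun b hb =>
    (hfm.sub stronglyMeasurable_const).indicator (hQm b hb)
  have hβint : ∀ b ∈ u, Integrable (β b) volume := fun b hb =>
    (integrable_indicator_iff (hQm b hb)).2
      ((hfint b hb).sub (integrableOn_const (hQfin b hb)))
  have hβ1 : ∀ b ∈ u, ∫⁻ z, ‖β b z‖ₑ ≤ 2 * 25 ^ n * s * volume (Q b) := by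
    intro b hb
    calc ∫⁻ z, ‖β b z‖ₑ = ∫⁻ z in Q b, ‖f z - m b‖ₑ := by
          rw [← lintegral_indicator (hQm b hb)]
          refine lintegral_congr fun z => ?_
          by_cases hz : z ∈ Q b
          · simp [hβ, hz]
          · simp [hβ, hz]
      _ ≤ ∫⁻ z in Q b, ‖f z‖ₑ + ‖m b‖ₑ := lintegral_mono fun z => enorm_sub_le
      _ = (∫⁻ z in Q b, ‖f z‖ₑ) + ‖m b‖ₑ * volume (Q b) := by
          rw [lintegral_add_right _ measurable_const, setLIntegral_const]
      _ ≤ 25 ^ n * s * volume (Q b) + 25 ^ n * s * volume (Q b) :=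
          add_le_add (hfQ b hb) ((hmb b hb).trans (hfQ b hb))
      _ = _ := by ring
  -- By disjointness at most one term is nonzero at each point: g is the average of f on each Q and
  -- f itself outside Ω.
  set g : Eu n → 𝕜 := fun z => f z - ∑' b : u, β b z with hg
  have hone : ∀ (b : Eu n) (hb : b ∈ u), ∀ z ∈ Q b, ∀ c : u, c ≠ ⟨b, hb⟩ → β c z = 0 := by
    intro b hb z hz c hc
    refine indicator_of_notMem (fun hzc => ?_) _
    exact (hdisj c.2 hb fun h => hc (Subtype.ext h)).le_bot ⟨hzc, hz⟩
  have hsumQ : ∀ b ∈ u, ∀ z ∈ Q b, HasSum (fun c : u => β c z) (f z - m b) := by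
    intro b hb z hz
    have := hasSum_single (f := fun c : u => β c z) ⟨b, hb⟩ (hone b hb z hz)
    simpa [hβ, hz] using this
  have hsumF : ∀ z ∉ Ω, HasSum (fun c : u => β c z) 0 := by
    intro z hz
    have : (fun c : u => β c z) = fun _ => 0 := by
      ext c
      exact indicator_of_notMem (fun hzc => hz (hQΩ c c.2 hzc)) _
    rw [this]
    exact hasSum_zero
  have hcase : ∀ z, z ∈ Ω → ∃ b ∈ u, z ∈ Q b := by
    intro z hz
    rw [← hcov] at hz
    simpa using hz
  have hsum : ∀ z, HasSum (fun c : u => β c z) (∑' c : u, β c z) := by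
    intro z
    by_cases hz : z ∈ Ω
    · obtain ⟨b, hb, hzb⟩ := hcase z hz
      exact (hsumQ b hb z hzb).summable.hasSum
    · exact (hsumF z hz).summable.hasSum
  have hgQ : ∀ b ∈ u, ∀ z ∈ Q b, g z = m b := by
    intro b hb z hz
    simp only [hg, (hsumQ b hb z hz).tsum_eq, sub_sub_cancel]
  have hgF : ∀ z ∉ Ω, g z = f z := by
    intro z hz
    simp only [hg, (hsumF z hz).tsum_eq, sub_zero]
  have hgm : StronglyMeasurable g := by
    refine hfm.sub (stronglyMeasurable_of_tendsto (u := Filter.atTop)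
      (f := fun (S : Finset u) z => ∑ c ∈ S, β c z)
      (fun S => Finset.stronglyMeasurable_fun_sum S fun c _ => hβsm c c.2) ?_)
    exact tendsto_pi_nhds.2 fun z => hsum z
  have hgle : ∀ z, ‖g z‖ ≤ ‖f z‖ + ((25 : ℝ≥0∞) ^ n * s).toReal := by
    intro z
    by_cases hz : z ∈ Ω
    · obtain ⟨b, hb, hzb⟩ := hcase z hz
      rw [hgQ b hb z hzb]
      have h1 : ‖m b‖ ≤ ((25 : ℝ≥0∞) ^ n * s).toReal := by
        rw [← toReal_enorm]
        exact ENNReal.toReal_mono (by finiteness) (hms b hb)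
      linarith [norm_nonneg (f z)]
    · rw [hgF z hz]
      linarith [@ENNReal.toReal_nonneg ((25 : ℝ≥0∞) ^ n * s)]
  have hgloc : LocallyIntegrable g volume := by
    have h1 : LocallyIntegrable (fun z => ‖f z‖ + ((25 : ℝ≥0∞) ^ n * s).toReal) volume :=
      LocallyIntegrable.add (fun x => (hf x).imp fun _ h => ⟨h.1, h.2.norm⟩)
        (locallyIntegrable_const _)
    refine h1.mono hgm.aestronglyMeasurable (Filter.Eventually.of_forall fun z => ?_)
    rw [Real.norm_of_nonneg (by positivity)]
    exact hgle z
  refine ⟨u, r, β, g, hu, hr, h20, hβint, ?_, ?_, ?_, hgm, hgloc, ?_, ?_⟩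
  · intro b hb z hz
    exact indicator_of_notMem (fun h => hz (ball_subset_closedBall (hQ5 b hb h))) _
  · intro b hb
    rw [hβ]
    dsimp only
    rw [integral_indicator (hQm b hb), integral_sub (hfint b hb)
      (integrableOn_const (hQfin b hb)), setIntegral_const,
      measure_smul_setAverage f (hQfin b hb), sub_self]
  · calc ∑' b : u, ∫⁻ z, ‖β b z‖ₑ ≤ ∑' b : u, 2 * 25 ^ n * s * volume (Q b) :=
          ENNReal.tsum_le_tsum fun b => hβ1 b b.2
      _ = 2 * 25 ^ n * s * volume Ω := by
          rw [ENNReal.tsum_mul_left, ← measure_biUnion hu hdisj hQm, hcov]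
  · intro z
    simp only [hg, sub_sub_cancel]
    exact hsum z
  · have hcompl : Ωᶜ = {x | maximalFn (fun z => ‖f z‖ₑ) x ≤ s} := by
      ext x
      simp [hΩdef]
    rw [← lintegral_add_compl _ hΩ.measurableSet, add_comm, hcompl]
    refine add_le_add (le_of_eq ?_) ?_
    · rw [← hcompl]
      refine setLIntegral_congr_fun hΩ.measurableSet.compl fun z hz => ?_
      rw [hgF z hz]
    · rw [← setLIntegral_const]
      refine setLIntegral_mono' hΩ.measurableSet fun z hz => ?_
      obtain ⟨b, hb, hzb⟩ := hcase z hz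
      rw [hgQ b hb z hzb]
      gcongr
      exact hms b hb

end

section

variable {𝕜 : Type*} [RCLike 𝕜] {n : ℕ} {α lam : ℝ} {f : Eu n → 𝕜}

/-! ### The `L^p` estimate for `p < 2` -/

lemma lintegral_closedBall_ne_top (hf : LocallyIntegrable f volume) (y : Eu n) (t : ℝ) :
    ∫⁻ z in closedBall y t, ‖f z‖ₑ ≠ ∞ :=
  (hf.integrableOn_isCompact (isCompact_closedBall y t)).2.ne

lemma gStar_add_le (hn : 0 < n) (hα0 : 0 < α) (hα1 : α ≤ 1) {g h : Eu n → 𝕜}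
    (hg : LocallyIntegrable g volume) (hh : LocallyIntegrable h volume)
    (hfgh : ∀ z, f z = g z + h z) (x : Eu n) :
    gStar lam α f x ≤ gStar lam α g x + gStar lam α h x := by
  have h1 := gStar_le_tsum (lam := lam) (f := f) hn hα0 hα1 (F := ![g, h])
    (by simp [Fin.forall_fin_two, hg, hh])
    (Filter.Eventually.of_forall fun z => by
      rw [hfgh z]
      convert hasSum_fintype (fun i : Fin 2 => (![g, h]) i z) using 1
      simp [Fin.sum_univ_two])
    (fun y t => by
      rw [tsum_fintype, Fin.sum_univ_two]
      exact ENNReal.add_ne_top.2 ⟨lintegral_closedBall_ne_top hg y t,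
        lintegral_closedBall_ne_top hh y t⟩) x
  simpa [tsum_fintype, Fin.sum_univ_two] using h1

/-- Chebyshev with the L² bound for the good part, and with the L¹ bound off Ω for the sum over the
bad pieces; Ω itself is discarded. The L² norm of f on {Mf ≤ s} is kept as it is, so that the
inequality can be integrated over s. -/
lemma exists_volume_lt_gStar_le (𝕜 : Type*) [RCLike 𝕜] (hn : 0 < n) (hα0 : 0 < α) (hα1 : α ≤ 1)
    (hlam : 3 < lam) :
    ∃ C : ℝ≥0∞, C ≠ ∞ ∧ ∀ f : Eu n → 𝕜, StronglyMeasurable f → LocallyIntegrable f volume →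
      ∀ s : ℝ≥0∞, s ≠ 0 → s ≠ ∞ → volume {x | s < maximalFn (fun z => ‖f z‖ₑ) x} ≠ ∞ →
      volume {x | 2 * s < gStar lam α f x} ≤
        C * ((s ^ 2)⁻¹ * (∫⁻ z in {x | maximalFn (fun z => ‖f z‖ₑ) x ≤ s}, ‖f z‖ₑ ^ 2) +
          volume {x | s < maximalFn (fun z => ‖f z‖ₑ) x}) := by
  obtain ⟨C₂, hC₂, hC₂f⟩ := exists_lintegral_gStar_rpow_le_of_two_le 𝕜 (lam := lam) hn hα0 hα1
    (by linarith) le_rfl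
  obtain ⟨C₁, hC₁, hC₁f⟩ := exists_lintegral_gStar_le_of_integral_eq_zero 𝕜 (lam := lam) hn hα0 hα1
    hlam
  refine ⟨C₂ + (C₂ * (25 ^ n) ^ 2 + (C₁ * (2 * 25 ^ n)) + 1), by finiteness,
    fun f hfm hf s hs hs' hvol => ?_⟩
  set Ω := {x | s < maximalFn (fun z => ‖f z‖ₑ) x} with hΩdef
  have hΩ : MeasurableSet Ω := (isOpen_lt_maximalFn _ s).measurableSet
  set J := ∫⁻ z in {x | maximalFn (fun z => ‖f z‖ₑ) x ≤ s}, ‖f z‖ₑ ^ 2 with hJ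
  obtain ⟨u, r, β, g, hu, hr, hball, hβint, hβsupp, hβ0, hβ1, hgm, hgloc, hsum, hg2⟩ :=
    exists_calderonZygmund hn hfm hf hs' hvol
  have : Countable u := hu.to_subtype
  have hloc : LocallyIntegrable (fun z => f z - g z) volume := hf.sub hgloc
  have hβloc : ∀ b : u, LocallyIntegrable (β b) volume := fun b => (hβint b b.2).locallyIntegrable
  set S : Eu n → ℝ≥0∞ := fun x => ∑' b : u, gStar lam α (β b) x with hS
  have hle : ∀ x, gStar lam α f x ≤ gStar lam α g x + S x := by
    intro x
    refine (gStar_add_le hn hα0 hα1 hgloc hloc (fun z => by ring) x).trans ?_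
    gcongr
    refine gStar_le_tsum hn hα0 hα1 hβloc (Filter.Eventually.of_forall hsum) (fun y t => ?_) x
    refine ne_top_of_le_ne_top ?_ ((ENNReal.tsum_le_tsum fun b =>
      setLIntegral_le_lintegral _ _).trans hβ1)
    finiteness
  have hsub : {x | 2 * s < gStar lam α f x} ⊆
      {x | s ≤ gStar lam α g x} ∪ (Ω ∪ ({x | s ≤ S x} ∩ Ωᶜ)) := by
    intro x hx
    have hx : 2 * s < gStar lam α f x := hx
    by_cases h1 : s ≤ gStar lam α g x
    · exact Or.inl h1
    by_cases h2 : x ∈ Ω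
    · exact Or.inr (Or.inl h2)
    refine Or.inr (Or.inr ⟨?_, h2⟩)
    by_contra h3
    have h3 : ¬ s ≤ S x := h3
    refine lt_irrefl (2 * s) (hx.trans_le ((hle x).trans ?_))
    rw [two_mul]
    exact add_le_add (not_le.1 h1).le (not_le.1 h3).le
  have hgm' : Measurable (gStar lam α g) := measurable_gStar hn hα0 hα1 lam hgloc
  have hSm : Measurable S := Measurable.tsum fun b => measurable_gStar hn hα0 hα1 lam (hβloc b)
  have hs2 : s ^ 2 ≠ 0 := pow_ne_zero 2 hs
  have hs2' : s ^ 2 ≠ ∞ := ENNReal.pow_ne_top hs'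
  have e1 : volume {x | s ≤ gStar lam α g x} ≤
      C₂ * ((s ^ 2)⁻¹ * J) + C₂ * (25 ^ n) ^ 2 * volume Ω := by
    have h1 : s ^ 2 * volume {x | s ≤ gStar lam α g x} ≤
        C₂ * (J + (25 ^ n * s) ^ 2 * volume Ω) := by
      have h2 := mul_meas_ge_le_lintegral (μ := volume) (hgm'.pow_const 2) (s ^ 2)
      have h3 : {x | s ^ 2 ≤ gStar lam α g x ^ 2} = {x | s ≤ gStar lam α g x} := by
        ext x
        exact ENNReal.pow_le_pow_left_iff two_ne_zero
      rw [h3] at h2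
      refine h2.trans ?_
      have h4 := hC₂f g hgm hgloc
      simp only [ENNReal.rpow_ofNat] at h4
      exact h4.trans (mul_le_mul_right hg2 _)
    calc volume {x | s ≤ gStar lam α g x}
        = (s ^ 2)⁻¹ * (s ^ 2 * volume {x | s ≤ gStar lam α g x}) := by
          rw [← mul_assoc, ENNReal.inv_mul_cancel hs2 hs2', one_mul]
      _ ≤ (s ^ 2)⁻¹ * (C₂ * (J + (25 ^ n * s) ^ 2 * volume Ω)) := by gcongr
      _ = C₂ * ((s ^ 2)⁻¹ * J) + C₂ * (25 ^ n) ^ 2 * volume Ω * ((s ^ 2)⁻¹ * s ^ 2) := by ring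
      _ = _ := by rw [ENNReal.inv_mul_cancel hs2 hs2', mul_one]
  have e2 : volume ({x | s ≤ S x} ∩ Ωᶜ) ≤ C₁ * (2 * 25 ^ n) * volume Ω := by
    have h1 : ∫⁻ x in Ωᶜ, S x ≤ C₁ * (2 * 25 ^ n * s * volume Ω) := by
      rw [hS, lintegral_tsum fun b => (measurable_gStar hn hα0 hα1 lam (hβloc b)).aemeasurable]
      calc ∑' b : u, ∫⁻ x in Ωᶜ, gStar lam α (β b) x
          ≤ ∑' b : u, C₁ * ∫⁻ z, ‖β b z‖ₑ := by
            refine ENNReal.tsum_le_tsum fun b => ?_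
            refine le_trans (lintegral_mono_set ?_) (hC₁f (β b) b (5 * r b)
              (by linarith [hr b b.2]) (hβint b b.2) (hβsupp b b.2) (hβ0 b b.2))
            intro x hx
            have h2 : x ∉ ball (b : Eu n) (20 * r b) := fun h => hx (hball b b.2 h)
            rw [mem_ball, not_lt] at h2
            show 2 * (5 * r b) ≤ dist x b
            linarith [hr b b.2]
        _ ≤ C₁ * (2 * 25 ^ n * s * volume Ω) := by
            rw [ENNReal.tsum_mul_left]
            gcongr
    have h2 := mul_meas_ge_le_lintegral (μ := volume.restrict Ωᶜ) hSm s
    rw [Measure.restrict_apply (measurableSet_le measurable_const hSm)] at h2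
    calc volume ({x | s ≤ S x} ∩ Ωᶜ)
        = s⁻¹ * (s * volume ({x | s ≤ S x} ∩ Ωᶜ)) := by
          rw [← mul_assoc, ENNReal.inv_mul_cancel hs hs', one_mul]
      _ ≤ s⁻¹ * (C₁ * (2 * 25 ^ n * s * volume Ω)) := by
          exact mul_le_mul_right (h2.trans h1) _
      _ = C₁ * (2 * 25 ^ n) * volume Ω * (s⁻¹ * s) := by ring
      _ = _ := by rw [ENNReal.inv_mul_cancel hs hs', mul_one]
  calc volume {x | 2 * s < gStar lam α f x}
      ≤ volume {x | s ≤ gStar lam α g x} + (volume Ω + volume ({x | s ≤ S x} ∩ Ωᶜ)) :=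
        (measure_mono hsub).trans ((measure_union_le _ _).trans
          (add_le_add le_rfl (measure_union_le _ _)))
    _ ≤ (C₂ * ((s ^ 2)⁻¹ * J) + C₂ * (25 ^ n) ^ 2 * volume Ω) +
          (volume Ω + C₁ * (2 * 25 ^ n) * volume Ω) := by gcongr
    _ = C₂ * ((s ^ 2)⁻¹ * J) + (C₂ * (25 ^ n) ^ 2 + (C₁ * (2 * 25 ^ n)) + 1) * volume Ω := by ring
    _ ≤ _ := by
        rw [mul_add]
        exact add_le_add (mul_le_mul_left le_self_add _) (mul_le_mul_left le_add_self _)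

/-- The integral of s^{p-3} from c to infinity converges because p < 2. The bound serves the term
∫_{Mf ≤ s} |f|² after the order of integration is exchanged. -/
lemma lintegral_rpow_sub_le {p : ℝ} (hp1 : 1 < p) (hp2 : p < 2) (c : ℝ≥0∞) :
    ∫⁻ s in Ioi (0 : ℝ), c ^ 2 * {s : ℝ | c ≤ ENNReal.ofReal s}.indicator
      (fun s => ENNReal.ofReal (p * s ^ (p - 3))) s ≤ ENNReal.ofReal (p / (2 - p)) * c ^ p := by
  rcases eq_or_ne c 0 with rfl | h0
  · simp
  rcases eq_or_ne c ∞ with rfl | h1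
  · simp
  have hc : 0 < c.toReal := ENNReal.toReal_pos h0 h1
  rw [lintegral_const_mul' _ _ (by finiteness)]
  have h2 : ∫⁻ s in Ioi (0 : ℝ), {s : ℝ | c ≤ ENNReal.ofReal s}.indicator
      (fun s => ENNReal.ofReal (p * s ^ (p - 3))) s ≤
      ENNReal.ofReal p * ∫⁻ s in Ioi c.toReal, ENNReal.ofReal (s ^ (p - 3)) := by
    rw [← lintegral_const_mul' _ _ (by finiteness), Measure.restrict_congr_set
      (Ioi_ae_eq_Ici (a := c.toReal)), ← lintegral_indicator measurableSet_Ici]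
    refine (setLIntegral_le_lintegral _ _).trans (lintegral_mono fun s => ?_)
    by_cases hs : c ≤ ENNReal.ofReal s
    · have h3 : c.toReal ≤ s := by
        have hs0 : 0 ≤ s := by
          by_contra h
          rw [ENNReal.ofReal_of_nonpos (not_le.1 h).le] at hs
          exact h0 (le_zero_iff.1 hs)
        exact ENNReal.toReal_le_of_le_ofReal hs0 hs
      rw [indicator_of_mem (show s ∈ Ici c.toReal from h3),
        indicator_of_mem (show s ∈ {s : ℝ | c ≤ ENNReal.ofReal s} from hs),
        ENNReal.ofReal_mul (by linarith)]
    · rw [indicator_of_notMem (show s ∉ {s : ℝ | c ≤ ENNReal.ofReal s} from hs)]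
      exact zero_le
  refine (mul_le_mul_right h2 _).trans (le_of_eq ?_)
  rw [lintegral_Ioi_rpow (by linarith) hc]
  have hcr : c = ENNReal.ofReal c.toReal := (ENNReal.ofReal_toReal h1).symm
  conv_lhs => rw [hcr]
  conv_rhs => rw [hcr]
  simp only [ENNReal.toReal_ofReal hc.le]
  rw [← ENNReal.ofReal_pow hc.le, ENNReal.ofReal_rpow_of_pos hc,
    ← ENNReal.ofReal_mul (by linarith), ← ENNReal.ofReal_mul (by positivity),
    ← ENNReal.ofReal_mul (div_nonneg (by linarith) (by linarith))]
  congr 1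
  have h4 : c.toReal ^ (p - 3 + 1) = c.toReal ^ p / c.toReal ^ 2 := by
    rw [show p - 3 + 1 = p - (2 : ℕ) by push_cast; ring, Real.rpow_sub_natCast hc.ne']
  have h5 : 2 - p ≠ 0 := by linarith
  have h6 : p - 3 + 1 ≠ 0 := by linarith
  rw [h4]
  field_simp
  ring

lemma exists_lintegral_gStar_rpow_le_of_lt_two (𝕜 : Type*) [RCLike 𝕜] (hn : 0 < n) (hα0 : 0 < α)
    (hα1 : α ≤ 1) (hlam : 3 < lam) {p : ℝ} (hp1 : 1 < p) (hp2 : p < 2) :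
    ∃ C : ℝ≥0∞, C ≠ ∞ ∧ ∀ f : Eu n → 𝕜, StronglyMeasurable f → LocallyIntegrable f volume →
      ∫⁻ x, gStar lam α f x ^ p ≤ C * ∫⁻ z, ‖f z‖ₑ ^ p := by
  obtain ⟨C, hC, hCf⟩ := exists_volume_lt_gStar_le 𝕜 (lam := lam) hn hα0 hα1 hlam
  obtain ⟨Cm, hCm, hCmw⟩ := exists_lintegral_maximalFn_rpow_le hn hp1
  have hp0 : 0 < p := by linarith
  -- The 1 makes the constant nonzero, so the inequality is trivial when f is not in L^p.
  refine ⟨2 ^ p * (C * (ENNReal.ofReal (p / (2 - p)) + Cm)) + 1, by finiteness,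
    fun f hfm hf => ?_⟩
  set I := ∫⁻ z, ‖f z‖ₑ ^ p with hI
  by_cases hItop : I = ∞
  · rw [hItop, ENNReal.mul_top (by simp)]
    exact le_top
  set M := maximalFn fun z => ‖f z‖ₑ with hM
  have hMm : Measurable M := measurable_maximalFn _
  have hMp : ∫⁻ x, M x ^ p ≤ Cm * I := hCmw _ hfm.enorm
  -- The Calderón–Zygmund decomposition needs level sets of finite volume; this follows from Mf in
  -- L^p.
  have hvol : ∀ s : ℝ≥0∞, s ≠ 0 → s ≠ ∞ → volume {x | s < M x} ≠ ∞ := by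
    intro s hs hs'
    have h1 := mul_meas_ge_le_lintegral (μ := volume) (hMm.pow_const p) (s ^ p)
    have h2 : volume {x | s < M x} ≤ volume {x | s ^ p ≤ M x ^ p} :=
      measure_mono fun x hx => by
        have hx : s < M x := hx
        show s ^ p ≤ M x ^ p
        gcongr
    refine ne_top_of_le_ne_top (fun h => ?_) h2
    rw [h, ENNReal.mul_top (ENNReal.rpow_pos (pos_iff_ne_zero.2 hs) hs').ne', top_le_iff] at h1
    exact ENNReal.mul_ne_top hCm hItop (top_le_iff.1 (h1 ▸ hMp))
  have hae : ∀ᵐ z, ‖f z‖ₑ ≤ M z := ae_le_maximalFn hfm.enorm fun r =>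
    ne_top_of_le_ne_top (lintegral_closedBall_ne_top hf 0 r) (lintegral_mono_set ball_subset_closedBall)
  have hgm := measurable_gStar hn hα0 hα1 lam hf
  have hms : Measurable fun z : ℝ × Eu n => {z : ℝ × Eu n | M z.2 ≤ ENNReal.ofReal z.1}.indicator
      (fun z => ENNReal.ofReal (p * z.1 ^ (p - 3))) z :=
    Measurable.indicator (by fun_prop) (measurableSet_le (by fun_prop) (by fun_prop))
  have hmain : ∫⁻ x, (gStar lam α f x / 2) ^ p ≤ C * (ENNReal.ofReal (p / (2 - p)) + Cm) * I := by
    rw [lintegral_rpow_eq_lintegral_meas_lt hp0 (hgm.div_const 2)]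
    calc ∫⁻ s in Ioi (0 : ℝ), ENNReal.ofReal (p * s ^ (p - 1)) *
          volume {x | ENNReal.ofReal s < gStar lam α f x / 2}
        ≤ ∫⁻ s in Ioi (0 : ℝ), C * ((∫⁻ z, ‖f z‖ₑ ^ 2 *
            {s : ℝ | M z ≤ ENNReal.ofReal s}.indicator
              (fun s => ENNReal.ofReal (p * s ^ (p - 3))) s) +
            ENNReal.ofReal (p * s ^ (p - 1)) * volume {x | ENNReal.ofReal s < M x}) := by
          refine setLIntegral_mono' measurableSet_Ioi fun s hs => ?_
          have hs : 0 < s := hs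
          have hs0 : ENNReal.ofReal s ≠ 0 := by simpa using hs
          have h1 := hCf f hfm hf (ENNReal.ofReal s) hs0 ENNReal.ofReal_ne_top
            (hvol _ hs0 ENNReal.ofReal_ne_top)
          have h2 : {x | ENNReal.ofReal s < gStar lam α f x / 2} =
              {x | 2 * ENNReal.ofReal s < gStar lam α f x} := by
            ext x
            simp only [mem_ofPred_eq]
            rw [ENNReal.lt_div_iff_mul_lt (by simp) (by simp), mul_comm]
          have h3 : ∫⁻ z, ‖f z‖ₑ ^ 2 * {s : ℝ | M z ≤ ENNReal.ofReal s}.indicator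
              (fun s => ENNReal.ofReal (p * s ^ (p - 3))) s =
              ENNReal.ofReal (p * s ^ (p - 1)) * ((ENNReal.ofReal s ^ 2)⁻¹ *
                ∫⁻ z in {x | M x ≤ ENNReal.ofReal s}, ‖f z‖ₑ ^ 2) := by
            have h4 : ENNReal.ofReal (p * s ^ (p - 1)) * (ENNReal.ofReal s ^ 2)⁻¹ =
                ENNReal.ofReal (p * s ^ (p - 3)) := by
              rw [← ENNReal.ofReal_pow hs.le, ← ENNReal.ofReal_inv_of_pos (by positivity),
                ← ENNReal.ofReal_mul (by positivity)]
              congr 1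
              rw [show p - 3 = p - 1 - (2 : ℕ) by push_cast; ring, Real.rpow_sub_natCast hs.ne']
              ring
            rw [← mul_assoc, h4, ← lintegral_const_mul' _ _ (by finiteness),
              ← lintegral_indicator (measurableSet_le hMm measurable_const)]
            refine lintegral_congr fun z => ?_
            by_cases hz : M z ≤ ENNReal.ofReal s
            · rw [indicator_of_mem (show s ∈ {s : ℝ | M z ≤ ENNReal.ofReal s} from hz),
                indicator_of_mem (show z ∈ {x | M x ≤ ENNReal.ofReal s} from hz), mul_comm]
            · rw [indicator_of_notMem (show s ∉ {s : ℝ | M z ≤ ENNReal.ofReal s} from hz),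
                indicator_of_notMem (show z ∉ {x | M x ≤ ENNReal.ofReal s} from hz), mul_zero]
          rw [h2, h3]
          refine (mul_le_mul_right h1 _).trans (le_of_eq ?_)
          ring
      _ = C * ((∫⁻ s in Ioi (0 : ℝ), ∫⁻ z, ‖f z‖ₑ ^ 2 *
            {s : ℝ | M z ≤ ENNReal.ofReal s}.indicator
              (fun s => ENNReal.ofReal (p * s ^ (p - 3))) s) + ∫⁻ x, M x ^ p) := by
          have h5 : Measurable fun s : ℝ => ∫⁻ z, ‖f z‖ₑ ^ 2 *
            {s : ℝ | M z ≤ ENNReal.ofReal s}.indicator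
              (fun s => ENNReal.ofReal (p * s ^ (p - 3))) s :=
            Measurable.lintegral_prod_right' (f := fun z : ℝ × Eu n => ‖f z.2‖ₑ ^ 2 *
              {z : ℝ × Eu n | M z.2 ≤ ENNReal.ofReal z.1}.indicator
                (fun z => ENNReal.ofReal (p * z.1 ^ (p - 3))) z)
              (((hfm.enorm.comp measurable_snd).pow_const 2).mul hms)
          rw [lintegral_const_mul' _ _ hC, lintegral_add_left h5,
            lintegral_rpow_eq_lintegral_meas_lt hp0 hMm]
      _ ≤ C * (ENNReal.ofReal (p / (2 - p)) * I + Cm * I) := by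
          gcongr
          rw [lintegral_lintegral_swap]
          · rw [hI, ← lintegral_const_mul' _ _ (by finiteness)]
            refine lintegral_mono_ae ?_
            -- Since |f| ≤ Mf almost everywhere, the levels s ≥ Mf are among the levels s ≥ |f|.
            filter_upwards [hae] with z hz
            refine le_trans (lintegral_mono fun s => ?_) (lintegral_rpow_sub_le hp1 hp2 ‖f z‖ₑ)
            gcongr
          · exact (((hfm.enorm.comp measurable_snd).pow_const 2).mul hms).aemeasurable
      _ = _ := by ring
  calc ∫⁻ x, gStar lam α f x ^ p = ∫⁻ x, 2 ^ p * (gStar lam α f x / 2) ^ p := by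
        refine lintegral_congr fun x => ?_
        rw [← ENNReal.mul_rpow_of_nonneg _ _ hp0.le, ENNReal.mul_div_cancel (by simp) (by simp)]
    _ = 2 ^ p * ∫⁻ x, (gStar lam α f x / 2) ^ p := lintegral_const_mul' _ _ (by finiteness)
    _ ≤ 2 ^ p * (C * (ENNReal.ofReal (p / (2 - p)) + Cm) * I) := by gcongr
    _ ≤ _ := by
        rw [add_mul, ← mul_assoc]
        exact le_self_add

/-- The boundedness of `g*` on `L^p`, `1 < p < ∞`. -/
theorem exists_lintegral_gStar_rpow_le (𝕜 : Type*) [RCLike 𝕜] (hn : 0 < n) (hα0 : 0 < α)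
    (hα1 : α ≤ 1) (hlam : 3 < lam) {p : ℝ} (hp1 : 1 < p) :
    ∃ C : ℝ≥0∞, C ≠ ∞ ∧ ∀ f : Eu n → 𝕜, LocallyIntegrable f volume →
      ∫⁻ x, gStar lam α f x ^ p ≤ C * ∫⁻ z, ‖f z‖ₑ ^ p := by
  obtain ⟨C, hC, hCf⟩ : ∃ C : ℝ≥0∞, C ≠ ∞ ∧ ∀ f : Eu n → 𝕜, StronglyMeasurable f →
      LocallyIntegrable f volume → ∫⁻ x, gStar lam α f x ^ p ≤ C * ∫⁻ z, ‖f z‖ₑ ^ p := by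
    rcases lt_or_ge p 2 with hp2 | hp2
    · exact exists_lintegral_gStar_rpow_le_of_lt_two 𝕜 hn hα0 hα1 hlam hp1 hp2
    · exact exists_lintegral_gStar_rpow_le_of_two_le 𝕜 hn hα0 hα1 (by linarith) hp2
  refine ⟨C, hC, fun f hf => ?_⟩
  have hm := hf.aestronglyMeasurable
  have h1 := hCf (hm.mk f) hm.stronglyMeasurable_mk (hf.congr hm.ae_eq_mk)
  refine le_trans (le_of_eq ?_) (h1.trans (le_of_eq ?_))
  · exact lintegral_congr fun x => by rw [gStar_congr hm.ae_eq_mk]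
  · congr 1
    refine lintegral_congr_ae ?_
    filter_upwards [hm.ae_eq_mk] with z hz
    rw [hz]

end

section

variable {𝕜 : Type*} [RCLike 𝕜] {n : ℕ} {α lam : ℝ} {f : Eu n → 𝕜}

/-! ### Morrey spaces -/

/-- The infimum defining the norm is itself admissible: for each ball the condition on C is a lower
bound, once solved for C. -/
lemma lintegral_ball_rpow_le_morreyNorm {ε : Type*} [ENorm ε] {p : ℝ} (hp : 0 < p) {Φ : ℝ → ℝ}
    (f : Eu n → ε) (x₀ : Eu n) {r : ℝ} (hr : 0 < r) (hΦ : 0 < Φ r) :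
    ∫⁻ x in ball x₀ r, ‖f x‖ₑ ^ p ≤ morreyNorm p Φ f ^ p * ENNReal.ofReal (Φ r) := by
  have h0 : ENNReal.ofReal (Φ r) ≠ 0 := by simpa using hΦ
  have h1 : ENNReal.ofReal (Φ r) ≠ ∞ := ENNReal.ofReal_ne_top
  rw [← ENNReal.div_le_iff h0 h1, ← ENNReal.rpow_inv_le_iff hp]
  refine le_sInf fun C hC => ?_
  rw [ENNReal.rpow_inv_le_iff hp, ENNReal.div_le_iff h0 h1]
  exact hC x₀ r hr

lemma lintegral_le_rpow_mul_rpow {X : Type*} [MeasurableSpace X] {μ : Measure X} {p : ℝ}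
    (hp : 1 < p) {g : X → ℝ≥0∞} (hg : AEMeasurable g μ) :
    ∫⁻ x, g x ∂μ ≤ (∫⁻ x, g x ^ p ∂μ) ^ (1 / p) * μ univ ^ (1 - 1 / p) := by
  have hpq : p.HolderConjugate (Real.conjExponent p) := Real.HolderConjugate.conjExponent hp
  have h := ENNReal.lintegral_mul_le_Lp_mul_Lq μ hpq hg (g := fun _ => 1) aemeasurable_const
  have h1 : 1 / Real.conjExponent p = 1 - 1 / p := by
    have := hpq.inv_add_inv_eq_one
    rw [one_div, one_div]
    linarith
  simpa [h1] using h

lemma doubling_pow_le {Φ : ℝ → ℝ} {D : ℝ} (hD : IsDoublingConst Φ D) {r : ℝ} (hr : 0 < r) (k : ℕ) :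
    Φ (2 ^ k * r) ≤ D ^ k * Φ r := by
  induction k with
  | zero => simp
  | succ k ih =>
    have hD0 : 0 ≤ D := by linarith [hD.1]
    calc Φ (2 ^ (k + 1) * r) = Φ (2 * (2 ^ k * r)) := by ring_nf
      _ ≤ D * Φ (2 ^ k * r) := hD.2 _ (by positivity)
      _ ≤ D * (D ^ k * Φ r) := by gcongr
      _ = D ^ (k + 1) * Φ r := by ring

/-- The pieces of `f` on the dyadic annuli around `x₀`. -/
def annulusPiece (f : Eu n → 𝕜) (x₀ : Eu n) (r : ℝ) (k : ℕ) : Eu n → 𝕜 :=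
  (disjointed (fun k : ℕ => ball x₀ (2 ^ (k + 1) * r)) k).indicator f

/-! ### Dyadic annuli around a ball -/

section annuli

variable {x₀ : Eu n} {r : ℝ}

lemma monotone_dyadic_ball (x₀ : Eu n) (hr : 0 < r) :
    Monotone fun k : ℕ => ball x₀ (2 ^ (k + 1) * r) := by
  intro j k hjk
  refine ball_subset_ball ?_
  gcongr
  exact one_le_two

lemma measurableSet_annulus (x₀ : Eu n) (r : ℝ) (k : ℕ) :
    MeasurableSet (disjointed (fun k : ℕ => ball x₀ (2 ^ (k + 1) * r)) k) :=
  MeasurableSet.disjointed (fun _ => measurableSet_ball) k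

lemma annulusPiece_zero (f : Eu n → 𝕜) (x₀ : Eu n) (r : ℝ) :
    annulusPiece f x₀ r 0 = (ball x₀ (2 * r)).indicator f := by
  rw [annulusPiece, disjointed_zero]
  norm_num

lemma annulusPiece_succ_eq_zero (hr : 0 < r) (k : ℕ) {z : Eu n}
    (hz : dist z x₀ < 2 ^ (k + 1) * r) : annulusPiece f x₀ r (k + 1) z = 0 := by
  rw [annulusPiece, Monotone.disjointed_add_one (monotone_dyadic_ball x₀ hr)]
  exact indicator_of_notMem (fun h => h.2 hz) _

lemma locallyIntegrable_annulusPiece (hf : LocallyIntegrable f volume) (x₀ : Eu n) (r : ℝ) (k : ℕ) :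
    LocallyIntegrable (annulusPiece f x₀ r k) volume :=
  hf.indicator (measurableSet_annulus x₀ r k)

lemma lintegral_annulusPiece_le (f : Eu n → 𝕜) (x₀ : Eu n) (r : ℝ) (k : ℕ) :
    ∫⁻ z, ‖annulusPiece f x₀ r k z‖ₑ ≤ ∫⁻ z in ball x₀ (2 ^ (k + 1) * r), ‖f z‖ₑ := by
  rw [← lintegral_indicator measurableSet_ball]
  refine lintegral_mono fun z => ?_
  rw [annulusPiece, enorm_indicator_eq_indicator_enorm]
  exact indicator_le_indicator_of_subset (disjointed_subset _ k) (fun _ => zero_le) z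

lemma exists_mem_annulus (hr : 0 < r) (z : Eu n) :
    ∃ k, z ∈ disjointed (fun k : ℕ => ball x₀ (2 ^ (k + 1) * r)) k := by
  rw [← mem_iUnion, iUnion_disjointed, mem_iUnion]
  obtain ⟨k, hk⟩ := pow_unbounded_of_one_lt (dist z x₀ / r) one_lt_two
  refine ⟨k, ?_⟩
  rw [div_lt_iff₀ hr] at hk
  rw [mem_ball, pow_succ]
  have : 0 < (2 : ℝ) ^ k * r := by positivity
  linarith

lemma annulusPiece_eq_zero_of_ne {z : Eu n} {k : ℕ}
    (hk : z ∈ disjointed (fun k : ℕ => ball x₀ (2 ^ (k + 1) * r)) k) {j : ℕ} (hj : j ≠ k) :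
    annulusPiece f x₀ r j z = 0 :=
  indicator_of_notMem (fun h => disjoint_left.1 (disjoint_disjointed _ hj) h hk) _

lemma hasSum_annulusPiece (hr : 0 < r) (f : Eu n → 𝕜) (z : Eu n) :
    HasSum (fun k => annulusPiece f x₀ r k z) (f z) := by
  obtain ⟨k, hk⟩ := exists_mem_annulus (x₀ := x₀) hr z
  have h := hasSum_single (f := fun k => annulusPiece f x₀ r k z) k
    fun j hj => annulusPiece_eq_zero_of_ne hk hj
  rwa [annulusPiece, indicator_of_mem hk] at h

lemma tsum_enorm_annulusPiece (hr : 0 < r) (f : Eu n → 𝕜) (z : Eu n) :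
    ∑' k, ‖annulusPiece f x₀ r k z‖ₑ = ‖f z‖ₑ := by
  obtain ⟨k, hk⟩ := exists_mem_annulus (x₀ := x₀) hr z
  rw [tsum_eq_single k fun j hj => by rw [annulusPiece_eq_zero_of_ne hk hj, enorm_zero],
    annulusPiece, indicator_of_mem hk]

lemma gStar_le_tsum_annulusPiece (hn : 0 < n) (hα0 : 0 < α) (hα1 : α ≤ 1)
    (hf : LocallyIntegrable f volume) (x₀ : Eu n) (hr : 0 < r) (x : Eu n) :
    gStar lam α f x ≤ gStar lam α ((ball x₀ (2 * r)).indicator f) x +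
      ∑' k, gStar lam α (annulusPiece f x₀ r (k + 1)) x := by
  have hF := locallyIntegrable_annulusPiece hf x₀ r
  have hsum : ∀ᵐ z, HasSum (fun k => annulusPiece f x₀ r k z) (f z) :=
    Filter.Eventually.of_forall (hasSum_annulusPiece hr f)
  have hfin : ∀ (y : Eu n) (t : ℝ),
      ∑' k, ∫⁻ z in closedBall y t, ‖annulusPiece f x₀ r k z‖ₑ ≠ ∞ := by
    intro y t
    rw [← lintegral_tsum fun k => (hF k).aestronglyMeasurable.enorm.restrict]
    simp_rw [tsum_enorm_annulusPiece hr]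
    exact lintegral_closedBall_ne_top hf y t
  have h := gStar_le_tsum (lam := lam) (F := annulusPiece f x₀ r) hn hα0 hα1 hF hsum hfin x
  have hsplit : ∑' k, gStar lam α (annulusPiece f x₀ r k) x =
      gStar lam α (annulusPiece f x₀ r 0) x + ∑' k, gStar lam α (annulusPiece f x₀ r (k + 1)) x :=
    tsum_eq_zero_add' ENNReal.summable
  rwa [hsplit, annulusPiece_zero] at h

end annuli

/-- No cancellation is needed here: the size bound A_α = O(t^{-n}) and the decay lemma with ε = 0
give the factor (2^k r)^{-n}. Hölder and k + 2 doublings bound the L¹ norm of the piece, and the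
product decays like (D/2^n)^{k/p}. -/
lemma exists_tsum_gStar_annulusPiece_le (𝕜 : Type*) [RCLike 𝕜] (hn : 0 < n) (hα0 : 0 < α)
    (hα1 : α ≤ 1) (hlam : 3 < lam) {p : ℝ} (hp : 1 < p) {Φ : ℝ → ℝ} (hΦ : IsGrowthFunction Φ)
    {D : ℝ} (hD : IsDoublingConst Φ D) (hDn : D < 2 ^ n) :
    ∃ K : ℝ≥0∞, K ≠ ∞ ∧ ∀ f : Eu n → 𝕜, LocallyIntegrable f volume →
      ∀ (x₀ : Eu n) (r : ℝ), 0 < r → ∀ x ∈ ball x₀ r,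
      ∑' k, gStar lam α (annulusPiece f x₀ r (k + 1)) x ≤
        K * morreyNorm p Φ f * ENNReal.ofReal ((Φ r / r ^ n) ^ (1 / p)) := by
  have hn' : (0 : ℝ) < n := by exact_mod_cast hn
  have hp0 : 0 < p := by linarith
  have hD0 : 0 < D := by linarith [hD.1]
  obtain ⟨C, hC, hCf⟩ := exists_gStar_le_of_decay (𝕜 := 𝕜) (α := α) (lam := lam) (ε := 0) hn le_rfl
    (by rw [mul_zero]; exact mul_pos (by linarith) hn')
  set q := 1 - 1 / p with hq
  have hq0 : 0 ≤ q := by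
    rw [hq, sub_nonneg, div_le_one hp0]
    exact hp.le
  set v := (unitVol n).toReal with hv
  set ρ := (D / 2 ^ n) ^ (1 / p) with hρ
  have hρ0 : 0 ≤ ρ := by positivity
  have hρ1 : ρ < 1 := by
    refine Real.rpow_lt_one (by positivity) ?_ (by positivity)
    rwa [div_lt_one (by positivity)]
  -- The piece lies in the ball of radius 2^{k+2} r, while the decay is at radius 2^k r; the two
  -- extra doublings cost D² and 4^n.
  set c := (D ^ 2) ^ (1 / p) * (4 ^ n * v) ^ q with hc
  have hc0 : 0 ≤ c := by positivity
  refine ⟨C * 3 * ENNReal.ofReal c * (1 - ENNReal.ofReal ρ)⁻¹, ?_, fun f hf x₀ r hr x hx => ?_⟩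
  · have : (1 - ENNReal.ofReal ρ)⁻¹ ≠ ∞ := by
      rw [ENNReal.inv_ne_top]
      exact (tsub_pos_of_lt (ENNReal.ofReal_lt_one.2 hρ1)).ne'
    finiteness
  set N := morreyNorm p Φ f with hN
  have hΦr := hΦ.pos r hr
  have hI : ∀ k : ℕ, ∫⁻ z in ball x₀ (2 ^ (k + 2) * r), ‖f z‖ₑ ≤
      N * ENNReal.ofReal ((D ^ (k + 2) * Φ r) ^ (1 / p) * ((2 ^ (k + 2) * r) ^ n * v) ^ q) := by
    intro k
    have hR : 0 < 2 ^ (k + 2) * r := by positivity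
    refine (lintegral_le_rpow_mul_rpow hp hf.aestronglyMeasurable.enorm.restrict).trans ?_
    rw [Measure.restrict_apply_univ]
    have h1 : ∫⁻ z in ball x₀ (2 ^ (k + 2) * r), ‖f z‖ₑ ^ p ≤
        N ^ p * ENNReal.ofReal (D ^ (k + 2) * Φ r) :=
      (lintegral_ball_rpow_le_morreyNorm hp0 f x₀ hR (hΦ.pos _ hR)).trans
        (mul_le_mul_right (ENNReal.ofReal_le_ofReal (doubling_pow_le hD hr _)) _)
    have h2 : volume (ball x₀ (2 ^ (k + 2) * r)) =
        ENNReal.ofReal ((2 ^ (k + 2) * r) ^ n * v) := by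
      rw [volume_ball_eq _ hR, ENNReal.ofReal_mul (by positivity), hv,
        ENNReal.ofReal_toReal (unitVol_ne_top n)]
    calc (∫⁻ z in ball x₀ (2 ^ (k + 2) * r), ‖f z‖ₑ ^ p) ^ (1 / p) *
          volume (ball x₀ (2 ^ (k + 2) * r)) ^ q
        ≤ (N ^ p * ENNReal.ofReal (D ^ (k + 2) * Φ r)) ^ (1 / p) *
          volume (ball x₀ (2 ^ (k + 2) * r)) ^ q := by gcongr
      _ = _ := by
          rw [ENNReal.mul_rpow_of_nonneg _ _ (by positivity), ← ENNReal.rpow_mul,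
            mul_one_div_cancel hp0.ne', ENNReal.rpow_one, h2,
            ENNReal.ofReal_rpow_of_nonneg (by positivity) (by positivity),
            ENNReal.ofReal_rpow_of_nonneg (by positivity) hq0, mul_assoc,
            ← ENNReal.ofReal_mul (by positivity)]
  have hterm : ∀ k : ℕ, gStar lam α (annulusPiece f x₀ r (k + 1)) x ≤
      C * 3 * ENNReal.ofReal c * N * ENNReal.ofReal ((Φ r / r ^ n) ^ (1 / p)) *
        ENNReal.ofReal ρ ^ k := by
    intro k
    have hR : 0 < 2 ^ k * r := by positivity
    set I := ∫⁻ z in ball x₀ (2 ^ (k + 2) * r), ‖f z‖ₑ with hIdef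
    have h1 := hCf (annulusPiece f x₀ r (k + 1)) x (2 ^ k * r) (3 * I) hR ?_ ?_
    · refine h1.trans ?_
      have h2 : (D ^ (k + 2) * Φ r) ^ (1 / p) * ((2 ^ (k + 2) * r) ^ n * v) ^ q *
          (2 ^ k * r) ^ (-n - 0 : ℝ) = c * (Φ r / r ^ n) ^ (1 / p) * ρ ^ k := by
        set X := (2 ^ k * r) ^ n with hX
        have hX0 : 0 < X := by positivity
        have e1 : (2 ^ (k + 2) * r) ^ n * v = (4 ^ n * v) * X := by
          rw [hX, show (2 : ℝ) ^ (k + 2) * r = 4 * (2 ^ k * r) by ring, mul_pow]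
          ring
        have e2 : (2 ^ k * r) ^ (-n - 0 : ℝ) = X⁻¹ := by
          rw [sub_zero, Real.rpow_neg hR.le, Real.rpow_natCast]
        have e3 : ρ ^ k = ((D / 2 ^ n) ^ k) ^ (1 / p) := by
          rw [hρ, ← Real.rpow_natCast, ← Real.rpow_mul (by positivity), mul_comm,
            Real.rpow_mul (by positivity), Real.rpow_natCast]
        have e4 : X ^ q * X⁻¹ = (X⁻¹) ^ (1 / p) := by
          rw [hq, Real.rpow_sub hX0, Real.rpow_one, Real.inv_rpow hX0.le]
          field_simp
        have e5 : D ^ (k + 2) * Φ r = D ^ 2 * (D ^ k * Φ r) := by ring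
        have e6 : Φ r / r ^ n * (D / 2 ^ n) ^ k = D ^ k * Φ r * X⁻¹ := by
          rw [hX, div_pow, mul_pow, ← pow_mul, ← pow_mul, mul_comm k n]
          field_simp
        rw [e1, e2, e3, e5, Real.mul_rpow (by positivity) (by positivity),
          Real.mul_rpow (x := 4 ^ n * v) (by positivity) hX0.le, mul_assoc c,
          ← Real.mul_rpow (x := Φ r / r ^ n) (y := (D / 2 ^ n) ^ k) (by positivity) (by positivity), e6,
          Real.mul_rpow (x := D ^ k * Φ r) (by positivity) (by positivity), ← e4, hc]
        ring
      calc C * (3 * I) * ENNReal.ofReal ((2 ^ k * r) ^ (-n - 0 : ℝ))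
          ≤ C * (3 * (N * ENNReal.ofReal ((D ^ (k + 2) * Φ r) ^ (1 / p) *
              ((2 ^ (k + 2) * r) ^ n * v) ^ q))) * ENNReal.ofReal ((2 ^ k * r) ^ (-n - 0 : ℝ)) := by
            gcongr
            exact hI k
        _ = C * 3 * N * ENNReal.ofReal (c * (Φ r / r ^ n) ^ (1 / p) * ρ ^ k) := by
            rw [← h2, ENNReal.ofReal_mul (q := (2 ^ k * r) ^ (-n - 0 : ℝ)) (by positivity)]
            ring
        _ = _ := by
            rw [ENNReal.ofReal_mul (by positivity), ENNReal.ofReal_mul hc0, ENNReal.ofReal_pow hρ0]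
            ring
    · intro y t ht
      refine (maximalConv_le hn hα0 hα1 _ y ht).trans ?_
      rw [sub_zero, Real.rpow_neg ht.le, Real.rpow_natCast, ENNReal.ofReal_mul (by norm_num),
        ENNReal.ofReal_ofNat, mul_right_comm]
      gcongr
      exact (setLIntegral_le_lintegral _ _).trans (lintegral_annulusPiece_le f x₀ r (k + 1))
    · intro y t ht hty
      refine maximalConv_eq_zero ht fun z hz => annulusPiece_succ_eq_zero hr k ?_
      have h1 := dist_triangle z x x₀
      have h2 := dist_triangle z y x
      rw [dist_comm y x] at h2
      rw [← dist_eq_norm] at hty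
      have h3 : r ≤ 2 ^ k * r := le_mul_of_one_le_left hr.le (one_le_pow₀ one_le_two)
      rw [pow_succ]
      linarith [mem_closedBall.1 hz, mem_ball.1 hx]
  refine (ENNReal.tsum_le_tsum hterm).trans (le_of_eq ?_)
  rw [ENNReal.tsum_mul_left, ENNReal.tsum_geometric]
  ring

/-- The near part is handled by the global L^p bound and one doubling. The far part is at most the
constant T on the ball, and T^p times the volume is a multiple of Φ(r). -/
lemma exists_lintegral_ball_gStar_rpow_le (𝕜 : Type*) [RCLike 𝕜] (hn : 0 < n) (hα0 : 0 < α)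
    (hα1 : α ≤ 1) (hlam : 3 < lam) {p : ℝ} (hp : 1 < p) {Φ : ℝ → ℝ} (hΦ : IsGrowthFunction Φ)
    {D : ℝ} (hD : IsDoublingConst Φ D) (hDn : D < 2 ^ n) :
    ∃ E : ℝ≥0∞, E ≠ ∞ ∧ ∀ f : Eu n → 𝕜, LocallyIntegrable f volume →
      ∀ (x₀ : Eu n) (r : ℝ), 0 < r →
      ∫⁻ x in ball x₀ r, gStar lam α f x ^ p ≤
        E * morreyNorm p Φ f ^ p * ENNReal.ofReal (Φ r) := by
  have hp0 : 0 < p := by linarith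
  have hD0 : 0 < D := by linarith [hD.1]
  obtain ⟨K, hK, hKf⟩ := exists_tsum_gStar_annulusPiece_le 𝕜 hn hα0 hα1 hlam hp hΦ hD hDn
  obtain ⟨C, hC, hCf⟩ := exists_lintegral_gStar_rpow_le 𝕜 hn hα0 hα1 hlam hp
  refine ⟨2 ^ (p - 1) * (C * ENNReal.ofReal D + K ^ p * unitVol n), ?_, fun f hf x₀ r hr => ?_⟩
  · have := unitVol_ne_top n
    finiteness
  set N := morreyNorm p Φ f with hN
  have hΦr := hΦ.pos r hr
  set f₁ := (ball x₀ (2 * r)).indicator f with hf₁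
  have hf₁loc : LocallyIntegrable f₁ volume := hf.indicator measurableSet_ball
  set T := K * N * ENNReal.ofReal ((Φ r / r ^ n) ^ (1 / p)) with hT
  have h1 : ∫⁻ x, gStar lam α f₁ x ^ p ≤ C * (N ^ p * ENNReal.ofReal (D * Φ r)) := by
    refine (hCf f₁ hf₁loc).trans ?_
    gcongr
    have h2 : ∫⁻ z, ‖f₁ z‖ₑ ^ p = ∫⁻ z in ball x₀ (2 * r), ‖f z‖ₑ ^ p := by
      rw [← lintegral_indicator measurableSet_ball]
      refine lintegral_congr fun z => ?_
      by_cases hz : z ∈ ball x₀ (2 * r)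
      · rw [hf₁, indicator_of_mem hz, indicator_of_mem hz]
      · rw [hf₁, indicator_of_notMem hz, indicator_of_notMem hz, enorm_zero,
          ENNReal.zero_rpow_of_pos hp0]
    rw [h2]
    refine (lintegral_ball_rpow_le_morreyNorm hp0 f x₀ (by positivity)
      (hΦ.pos _ (by positivity))).trans ?_
    gcongr
    exact hD.2 r hr
  have h3 : T ^ p * volume (ball x₀ r) = K ^ p * unitVol n * N ^ p * ENNReal.ofReal (Φ r) := by
    have h4 : ENNReal.ofReal ((Φ r / r ^ n) ^ (1 / p)) ^ p * ENNReal.ofReal (r ^ n) =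
        ENNReal.ofReal (Φ r) := by
      rw [ENNReal.ofReal_rpow_of_nonneg (by positivity) hp0.le, ← Real.rpow_mul (by positivity),
        one_div_mul_cancel hp0.ne', Real.rpow_one, ← ENNReal.ofReal_mul (by positivity)]
      congr 1
      field_simp
    rw [hT, ENNReal.mul_rpow_of_nonneg _ _ hp0.le, ENNReal.mul_rpow_of_nonneg _ _ hp0.le,
      volume_ball_eq _ hr, ← h4]
    ring
  calc ∫⁻ x in ball x₀ r, gStar lam α f x ^ p
      ≤ ∫⁻ x in ball x₀ r, 2 ^ (p - 1) * (gStar lam α f₁ x ^ p + T ^ p) := by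
        refine setLIntegral_mono' measurableSet_ball fun x hx => ?_
        refine le_trans ?_ (ENNReal.rpow_add_le_mul_rpow_add_rpow _ _ hp.le)
        gcongr
        refine (gStar_le_tsum_annulusPiece hn hα0 hα1 hf x₀ hr x).trans ?_
        gcongr
        exact hKf f hf x₀ r hr x hx
    _ = 2 ^ (p - 1) * ((∫⁻ x in ball x₀ r, gStar lam α f₁ x ^ p) + T ^ p * volume (ball x₀ r)) := by
        have : (2 : ℝ≥0∞) ^ (p - 1) ≠ ∞ := by finiteness
        rw [lintegral_const_mul' _ _ this, lintegral_add_right _ measurable_const,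
          setLIntegral_const]
    _ ≤ 2 ^ (p - 1) * (C * (N ^ p * ENNReal.ofReal (D * Φ r)) +
          K ^ p * unitVol n * N ^ p * ENNReal.ofReal (Φ r)) := by
        rw [h3]
        gcongr
        exact (setLIntegral_le_lintegral _ _).trans h1
    _ = _ := by
        rw [ENNReal.ofReal_mul hD0.le]
        ring

end

end IntrinsicSquare

end

/-! ### The boundedness theorem on Morrey spaces -/

open IntrinsicSquare

theorem theorem1p4 {𝕜 : Type*} [RCLike 𝕜] (n : ℕ) (α p lam : ℝ)
    (hα0 : 0 < α) (hα1 : α ≤ 1) (hp : 1 < p) (hlam : 3 < lam)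
    (Φ : ℝ → ℝ) (hΦ : IntrinsicSquare.IsGrowthFunction Φ)
    (D : ℝ) (hD : IntrinsicSquare.IsDoublingConst Φ D) (hDn : D < 2 ^ n) :
    ∃ C : ℝ, 0 < C ∧
      ∀ f : EuclideanSpace ℝ (Fin n) → 𝕜, IntrinsicSquare.MemMorrey p Φ f →
        IntrinsicSquare.MemMorrey p Φ (IntrinsicSquare.gStar lam α f) ∧
        IntrinsicSquare.morreyNorm p Φ (IntrinsicSquare.gStar lam α f) ≤
          ENNReal.ofReal C * IntrinsicSquare.morreyNorm p Φ f := by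
  -- Dimension zero is excluded by 1 ≤ D < 2^n.
  have hn : 0 < n := by
    refine Nat.pos_of_ne_zero ?_
    rintro rfl
    linarith [hD.1, pow_zero (2 : ℝ)]
  have hp0 : 0 < p := by linarith
  obtain ⟨E, hE, hEf⟩ := exists_lintegral_ball_gStar_rpow_le 𝕜 hn hα0 hα1 hlam hp hΦ hD hDn
  refine ⟨(E ^ (1 / p)).toReal + 1, by positivity, fun f hf => ?_⟩
  have hC : E ^ (1 / p) ≤ ENNReal.ofReal ((E ^ (1 / p)).toReal + 1) := by
    rw [ENNReal.le_ofReal_iff_toReal_le (by finiteness) (by positivity)]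
    linarith
  have hnorm : morreyNorm p Φ (gStar lam α f) ≤
      ENNReal.ofReal ((E ^ (1 / p)).toReal + 1) * morreyNorm p Φ f := by
    refine le_trans (sInf_le fun x₀ r hr => ?_) (mul_le_mul_left hC _)
    refine (hEf f hf.1 x₀ r hr).trans (le_of_eq ?_)
    rw [ENNReal.mul_rpow_of_nonneg _ _ hp0.le, ← ENNReal.rpow_mul, one_div_mul_cancel hp0.ne',
      ENNReal.rpow_one]
  have hfin : morreyNorm p Φ (gStar lam α f) < ∞ :=
    hnorm.trans_lt (ENNReal.mul_lt_top ENNReal.ofReal_lt_top hf.2)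
  have hm := measurable_gStar hn hα0 hα1 lam hf.1
  refine ⟨⟨fun x => ⟨Metric.ball x 1, Metric.ball_mem_nhds x one_pos,
    hm.aestronglyMeasurable, ?_⟩, hfin⟩, hnorm⟩
  -- Local integrability of `g*(f)`: Hölder on a unit ball, where the Morrey bound controls the p-th
  -- power.
  have h1 := lintegral_le_rpow_mul_rpow (μ := volume.restrict (Metric.ball x 1)) hp hm.aemeasurable
  have h2 := lintegral_ball_rpow_le_morreyNorm hp0 (gStar lam α f) x one_pos (hΦ.pos 1 one_pos)
  rw [Measure.restrict_apply_univ] at h1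
  refine lt_of_le_of_lt h1 (ENNReal.mul_lt_top ?_ ?_)
  · refine ENNReal.rpow_lt_top_of_nonneg (by positivity) (ne_top_of_le_ne_top ?_ h2)
    have := hfin.ne
    finiteness
  · refine ENNReal.rpow_lt_top_of_nonneg ?_ measure_ball_lt_top.ne
    rw [sub_nonneg, div_le_one hp0]
    exact hp.le
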